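/- All spaces are over a fixed scalar field $\mathbb{F}\in\{\mathbb{R},\mathbb{C}\}$, and finite direct sums carry the supremum norm (or any equivalent one). A finite family $(X_i)_{i\in I}$ of Banach spaces is called \emph{splitting for unconditional bases} if, for every unconditional basis $(b_n)_{n\in N}$ of $\bigoplus_{i\in I}X_i$, there is a partition $(N_i)_{i\in I}$ of $N$ such that, for each $i\in I$, the closed linear span of $(b_n)_{n\in N_i}$ is isomorphic (linearly homeomorphic) to $X_i$. For a scalar sequence $a=(a_n)_{n=1}^\infty$ put $\|a\|_0=\sup_n|a_n|$ and $$\|a\|_{m+1}=\max\Big\{\|a\|_m,\ \tfrac12\sup\Big\{\sum_{j=1}^k\|E_ja\|_m:\ k\in\mathbb{N},\ k\le E_1<E_2<\dots<E_k\Big\}\Big\},\qquad m\ge 0,$$ where the $E_j$ are finite subsets of $\mathbb{N}=\{1,2,\dots\}$, $E_ja$ is the restriction of $a$ to $E_j$ (extended by zero), and $k\le E_1<\dots<E_k$ means that $k\le\min E_1$ and $\max E_j<\min E_{j+1}$ for $1\le j<k$. Let $\|a\|_{\mathcal T}=\sup_m\|a\|_m$. For $1\le r<\infty$, the $r$-convexified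 Tsirelson space $\mathcal{T}^{(r)}$ is the completion of the space of finitely supported sequences with the norm $\|x\|=\big\|(|x_n|^r)_{n=1}^\infty\big\|_{\mathcal T}^{1/r}$. For $1<s\le\infty$, $\mathcal{T}_*^{(s)}$ is the dual space of $\mathcal{T}^{(r)}$, where $r=s/(s-1)$ (and $r=1$ if $s=\infty$). \textbf{Theorem.} Let $A\subseteq[1,\infty]$, $B\subseteq[1,\infty)$ and $D\subseteq(1,\infty]$ be finite sets. Then the family $$(\ell_p)_{p\in A}\ \sqcup\ (\mathcal{T}^{(r)})_{r\in B}\ \sqcup\ (\mathcal{T}_*^{(s)})_{s\in D},$$ where $\ell_\infty$ is to be read as $c_0$, is splitting for unconditional bases. -/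

import Mathlib

open scoped ENNReal Topology

universe u v t w

namespace UncBasis

noncomputable section

/-! ### Splitting families -/

/-- A finite family `(X i)` of normed spaces is splitting for unconditional bases if the index set
of every unconditional basis `b` of the direct sum (the finite product, with the sup norm) can be
partitioned into sets `σ ⁻¹' {i}`, such that the closed linear span of `(b n)`, `σ n = i`, is
isomorphic to `X i` for every `i`. -/
def SplittingForUnconditionalBases (𝕜 : Type u) [RCLike 𝕜] {ι : Type v} [Fintype ι]
    (X : ι → Type t) [∀ i, NormedAddCommGroup (X i)] [∀ i, NormedSpace 𝕜 (X i)] : Prop :=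
  ∀ (β : Type w) (b : UnconditionalSchauderBasis β 𝕜 (∀ i, X i)),
    ∃ σ : β → ι, ∀ i,
      Nonempty ((Submodule.span 𝕜 (b '' (σ ⁻¹' {i}))).topologicalClosure ≃L[𝕜] X i)

/-! ### The spaces `ℓ_p`, with `ℓ_∞` meaning `c₀` -/

instance factIci (p : Set.Ici (1 : ℝ≥0∞)) : Fact (1 ≤ (p : ℝ≥0∞)) := ⟨p.2⟩

/-- The null sequences in `ℓ_p`, `1 ≤ p ≤ ∞`. This is all of `ℓ_p` for `p < ∞`, and `c₀` (with the
supremum norm) for `p = ∞`. -/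
def ellSubmodule (𝕜 : Type*) [RCLike 𝕜] (p : Set.Ici (1 : ℝ≥0∞)) :
    Submodule 𝕜 (lp (fun _ : ℕ => 𝕜) (p : ℝ≥0∞)) where
  carrier := {x | Filter.Tendsto (fun n => x n) Filter.atTop (𝓝 0)}
  zero_mem' := by
    simp only [Set.mem_ofPred_eq, lp.coeFn_zero, Pi.zero_apply]
    exact tendsto_const_nhds
  add_mem' := by
    intro x y hx hy
    simp only [Set.mem_ofPred_eq, lp.coeFn_add, Pi.add_apply] at *
    simpa using hx.add hy
  smul_mem' := by
    intro c x hx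
    simp only [Set.mem_ofPred_eq, lp.coeFn_smul, Pi.smul_apply] at *
    simpa using hx.const_smul c

theorem ellSubmodule_eq_top (𝕜 : Type*) [RCLike 𝕜] (p : Set.Ici (1 : ℝ≥0∞))
    (hp : (p : ℝ≥0∞) ≠ ∞) : ellSubmodule 𝕜 p = ⊤ := by
  refine eq_top_iff.2 fun x _ => ?_
  have h0 : 0 < (p : ℝ≥0∞).toReal := ENNReal.toReal_pos (zero_lt_one.trans_le p.2).ne' hp
  have h := ((lp.memℓp x).summable h0).tendsto_atTop_zero
  change Filter.Tendsto (fun n => x n) Filter.atTop (𝓝 0)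
  rw [tendsto_zero_iff_norm_tendsto_zero]
  have h2 := h.rpow_const (p := (p : ℝ≥0∞).toReal⁻¹) (Or.inr (inv_nonneg.2 h0.le))
  rw [Real.zero_rpow (inv_ne_zero h0.ne')] at h2
  refine h2.congr fun n => ?_
  rw [← Real.rpow_mul (norm_nonneg _), mul_inv_cancel₀ h0.ne', Real.rpow_one]

/-- The space `ℓ_p` for `1 ≤ p < ∞`, and `c₀` for `p = ∞`. -/
abbrev Ell (𝕜 : Type*) [RCLike 𝕜] (p : Set.Ici (1 : ℝ≥0∞)) : Type _ := ellSubmodule 𝕜 p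

/-! ### The Tsirelson norm -/

/-- `k ≤ E₁ < E₂ < ⋯ < E_k` for finite sets of positive integers, where `i : ℕ` stands for the
positive integer `i + 1`. (Empty sets are allowed; they contribute nothing to the norm.) -/
def Admissible {k : ℕ} (E : Fin k → Finset ℕ) : Prop :=
  (∀ j, ∀ i ∈ E j, k ≤ i + 1) ∧ ∀ j l, j < l → ∀ i ∈ E j, ∀ i' ∈ E l, i < i'

/-- The Figiel-Johnson iteration, applied to the sequence of absolute values `a` :
`‖a‖₀ = sup_i a_i` and `‖a‖_{m+1} = max (‖a‖_m, (1/2) sup ∑_{j ≤ k} ‖E_j a‖_m)`, the supremum being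
over all `k` and all `k ≤ E₁ < ⋯ < E_k`. -/
def tsirelsonAux : ℕ → (ℕ → ℝ≥0∞) → ℝ≥0∞
  | 0, a => ⨆ i, a i
  | m + 1, a => max (tsirelsonAux m a)
      (⨆ (k : ℕ) (E : Fin k → Finset ℕ) (_ : Admissible E),
        2⁻¹ * ∑ j, tsirelsonAux m ((E j : Set ℕ).indicator a))

/-- The Tsirelson norm `‖a‖_T = sup_m ‖a‖_m` of the sequence of absolute values `a`
(possibly `∞`). -/
def tsirelsonNorm (a : ℕ → ℝ≥0∞) : ℝ≥0∞ := ⨆ m, tsirelsonAux m a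

/-- The norm of the `r`-convexification: `‖ |x|^r ‖_T^{1/r}`. -/
def convexNorm {𝕜 : Type*} [RCLike 𝕜] (r : ℝ) (x : ℕ → 𝕜) : ℝ≥0∞ :=
  (tsirelsonNorm fun i => ‖x i‖ₑ ^ r) ^ r⁻¹

theorem tsirelsonAux_mono (m : ℕ) : Monotone (tsirelsonAux m) := by
  induction m with
  | zero => exact fun a b h => iSup_mono h
  | succ m ih =>
    intro a b h
    refine max_le_max (ih h) ?_
    refine iSup_mono fun k => iSup_mono fun E => iSup_mono fun _ => ?_
    gcongr with j
    exact ih fun i => Set.indicator_le_indicator (h i)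

theorem tsirelsonAux_add (m : ℕ) (a b : ℕ → ℝ≥0∞) :
    tsirelsonAux m (a + b) ≤ tsirelsonAux m a + tsirelsonAux m b := by
  induction m generalizing a b with
  | zero => exact iSup_le fun i => add_le_add (le_iSup a i) (le_iSup b i)
  | succ m ih =>
    refine max_le ((ih a b).trans (add_le_add (le_max_left _ _) (le_max_left _ _))) ?_
    refine iSup_le fun k => iSup_le fun E => iSup_le fun hE => ?_
    have hle : ∀ c : ℕ → ℝ≥0∞, 2⁻¹ * ∑ j, tsirelsonAux m ((E j : Set ℕ).indicator c) ≤
        tsirelsonAux (m + 1) c := fun c => le_max_of_le_right (le_iSup_of_le k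
      (le_iSup₂ (f := fun (E : Fin k → Finset ℕ) (_ : Admissible E) =>
        2⁻¹ * ∑ j, tsirelsonAux m ((E j : Set ℕ).indicator c)) E hE))
    calc 2⁻¹ * ∑ j, tsirelsonAux m ((E j : Set ℕ).indicator (a + b))
        ≤ 2⁻¹ * ∑ j, (tsirelsonAux m ((E j : Set ℕ).indicator a)
            + tsirelsonAux m ((E j : Set ℕ).indicator b)) := by
          gcongr with j
          rw [Set.indicator_add']
          exact ih _ _
      _ = 2⁻¹ * ∑ j, tsirelsonAux m ((E j : Set ℕ).indicator a)
            + 2⁻¹ * ∑ j, tsirelsonAux m ((E j : Set ℕ).indicator b) := by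
          rw [Finset.sum_add_distrib, mul_add]
      _ ≤ _ := add_le_add
          (hle a)
          (hle b)

theorem tsirelsonAux_mul (m : ℕ) (c : ℝ≥0∞) (a : ℕ → ℝ≥0∞) :
    tsirelsonAux m (fun i => c * a i) = c * tsirelsonAux m a := by
  induction m generalizing a with
  | zero => exact (ENNReal.mul_iSup c a).symm
  | succ m ih =>
    have hi : ∀ s : Set ℕ, s.indicator (fun i => c * a i) = fun i => c * s.indicator a i := by
      intro s
      ext i
      by_cases h : i ∈ s <;> simp [h]
    simp only [tsirelsonAux, hi, ih, ← Finset.mul_sum, mul_max, ENNReal.mul_iSup]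
    simp only [mul_left_comm c]

theorem tsirelsonNorm_mono {a b : ℕ → ℝ≥0∞} (h : a ≤ b) : tsirelsonNorm a ≤ tsirelsonNorm b :=
  iSup_mono fun m => tsirelsonAux_mono m h

theorem tsirelsonNorm_add (a b : ℕ → ℝ≥0∞) :
    tsirelsonNorm (a + b) ≤ tsirelsonNorm a + tsirelsonNorm b :=
  iSup_le fun m => (tsirelsonAux_add m a b).trans
    (add_le_add (le_iSup (fun m => tsirelsonAux m a) m) (le_iSup (fun m => tsirelsonAux m b) m))

theorem tsirelsonNorm_mul (c : ℝ≥0∞) (a : ℕ → ℝ≥0∞) :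
    tsirelsonNorm (fun i => c * a i) = c * tsirelsonNorm a := by
  simp only [tsirelsonNorm, tsirelsonAux_mul, ENNReal.mul_iSup]

theorem le_tsirelsonNorm (a : ℕ → ℝ≥0∞) (i : ℕ) : a i ≤ tsirelsonNorm a :=
  (le_iSup a i).trans (le_iSup (fun m => tsirelsonAux m a) 0)

section convexNorm

variable {𝕜 : Type*} [RCLike 𝕜] {r : ℝ}

theorem enorm_le_convexNorm (hr : 1 ≤ r) (x : ℕ → 𝕜) (i : ℕ) : ‖x i‖ₑ ≤ convexNorm r x := by
  have h0 : 0 < r := zero_lt_one.trans_le hr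
  calc ‖x i‖ₑ = (‖x i‖ₑ ^ r) ^ r⁻¹ := (ENNReal.rpow_rpow_inv h0.ne' _).symm
    _ ≤ _ := ENNReal.rpow_le_rpow (le_tsirelsonNorm (fun i => ‖x i‖ₑ ^ r) i)
        (inv_nonneg.2 h0.le)

theorem convexNorm_smul (hr : 1 ≤ r) (c : 𝕜) (x : ℕ → 𝕜) :
    convexNorm r (c • x) = ‖c‖ₑ * convexNorm r x := by
  have h0 : 0 < r := zero_lt_one.trans_le hr
  simp only [convexNorm, Pi.smul_apply, enorm_smul, ENNReal.mul_rpow_of_nonneg _ _ h0.le,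
    tsirelsonNorm_mul, ENNReal.mul_rpow_of_nonneg _ _ (inv_nonneg.2 h0.le),
    ENNReal.rpow_rpow_inv h0.ne']

theorem convexNorm_zero (hr : 1 ≤ r) : convexNorm r (0 : ℕ → 𝕜) = 0 := by
  simpa using convexNorm_smul hr (0 : 𝕜) (0 : ℕ → 𝕜)

theorem eq_zero_of_convexNorm_eq_zero (hr : 1 ≤ r) {x : ℕ → 𝕜} (h : convexNorm r x = 0) :
    x = 0 := by
  ext i
  have := enorm_le_convexNorm hr x i
  rw [h] at this
  simpa using this

theorem convexNorm_add (hr : 1 ≤ r) (x y : ℕ → 𝕜) :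
    convexNorm r (x + y) ≤ convexNorm r x + convexNorm r y := by
  have h0 : 0 < r := zero_lt_one.trans_le hr
  by_cases hx0 : convexNorm r x = 0
  · rw [eq_zero_of_convexNorm_eq_zero hr hx0]; simp
  by_cases hy0 : convexNorm r y = 0
  · rw [eq_zero_of_convexNorm_eq_zero hr hy0]; simp
  by_cases hx : convexNorm r x = ∞
  · simp [hx]
  by_cases hy : convexNorm r y = ∞
  · simp [hy]
  have hX : tsirelsonNorm (fun i => ‖x i‖ₑ ^ r) = convexNorm r x ^ r :=
    (ENNReal.rpow_inv_rpow h0.ne' _).symm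
  have hY : tsirelsonNorm (fun i => ‖y i‖ₑ ^ r) = convexNorm r y ^ r :=
    (ENNReal.rpow_inv_rpow h0.ne' _).symm
  set S := convexNorm r x
  set T := convexNorm r y
  have hST0 : S + T ≠ 0 := by simp [hx0]
  have hST : S + T ≠ ∞ := by simp [hx, hy]
  have hw : S / (S + T) + T / (S + T) = 1 := by
    rw [← ENNReal.add_div, ENNReal.div_self hST0 hST]
  have h5 : ∀ U : ℝ≥0∞, U ≠ 0 → U ≠ ∞ → U / (S + T) * ((S + T) / U) = 1 := by
    intro U hU0 hU
    rw [← mul_div_assoc, ENNReal.div_mul_cancel hST0 hST, ENNReal.div_self hU0 hU]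
  have key : (fun i => ‖(x + y) i‖ₑ ^ r) ≤
      (fun i => (S / (S + T) * ((S + T) / S) ^ r) * ‖x i‖ₑ ^ r) +
      (fun i => (T / (S + T) * ((S + T) / T) ^ r) * ‖y i‖ₑ ^ r) := by
    intro i
    have h1 : S / (S + T) * ((S + T) / S * ‖x i‖ₑ) = ‖x i‖ₑ := by
      rw [← mul_assoc, h5 S hx0 hx, one_mul]
    have h2 : T / (S + T) * ((S + T) / T * ‖y i‖ₑ) = ‖y i‖ₑ := by
      rw [← mul_assoc, h5 T hy0 hy, one_mul]
    calc ‖(x + y) i‖ₑ ^ r ≤ (‖x i‖ₑ + ‖y i‖ₑ) ^ r :=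
          ENNReal.rpow_le_rpow (enorm_add_le _ _) h0.le
      _ = (S / (S + T) * ((S + T) / S * ‖x i‖ₑ) + T / (S + T) * ((S + T) / T * ‖y i‖ₑ)) ^ r := by
          rw [h1, h2]
      _ ≤ _ := ENNReal.rpow_arith_mean_le_arith_mean2_rpow _ _ _ _ hw hr
      _ = _ := by
          simp only [ENNReal.mul_rpow_of_nonneg _ _ h0.le, Pi.add_apply, mul_assoc]
  have h3 : ∀ U : ℝ≥0∞, U ≠ 0 → U ≠ ∞ →
      U / (S + T) * ((S + T) / U) ^ r * U ^ r = U / (S + T) * (S + T) ^ r := by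
    intro U hU0 hU
    rw [mul_assoc, ← ENNReal.mul_rpow_of_nonneg _ _ h0.le, ENNReal.div_mul_cancel hU0 hU]
  have h4 : tsirelsonNorm (fun i => ‖(x + y) i‖ₑ ^ r) ≤ (S + T) ^ r := by
    refine (tsirelsonNorm_mono key).trans ((tsirelsonNorm_add _ _).trans ?_)
    rw [tsirelsonNorm_mul, tsirelsonNorm_mul, hX, hY, h3 S hx0 hx, h3 T hy0 hy, ← add_mul, hw,
      one_mul]
  calc convexNorm r (x + y) ≤ ((S + T) ^ r) ^ r⁻¹ :=
        ENNReal.rpow_le_rpow h4 (inv_nonneg.2 h0.le)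
    _ = S + T := ENNReal.rpow_rpow_inv h0.ne' _

end convexNorm

/-! ### The convexified Tsirelson spaces and their duals -/

/-- All scalar sequences `x` with `‖ |x|^r ‖_T < ∞`. -/
def finiteNormSubmodule (𝕜 : Type*) [RCLike 𝕜] (r : Set.Ici (1 : ℝ)) : Submodule 𝕜 (ℕ → 𝕜) where
  carrier := {x | convexNorm (r : ℝ) x ≠ ∞}
  zero_mem' := by simp [convexNorm_zero r.2]
  add_mem' := fun {x y} hx hy => ne_top_of_le_ne_top
    (ENNReal.add_ne_top.2 ⟨hx, hy⟩) (convexNorm_add r.2 x y)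
  smul_mem' := fun c x hx => by
    simp only [Set.mem_ofPred_eq, convexNorm_smul r.2] at *
    exact ENNReal.mul_ne_top enorm_ne_top hx

/-- The space of all scalar sequences `x` with `‖ |x|^r ‖_T < ∞`, normed by
`‖x‖ = ‖ |x|^r ‖_T^{1/r}`. -/
def FiniteNorm (𝕜 : Type*) [RCLike 𝕜] (r : Set.Ici (1 : ℝ)) : Type _ := finiteNormSubmodule 𝕜 r

section FiniteNorm

variable (𝕜 : Type*) [RCLike 𝕜] (r : Set.Ici (1 : ℝ))

instance : AddCommGroup (FiniteNorm 𝕜 r) := inferInstanceAs (AddCommGroup (finiteNormSubmodule 𝕜 r))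

instance : Module 𝕜 (FiniteNorm 𝕜 r) := inferInstanceAs (Module 𝕜 (finiteNormSubmodule 𝕜 r))

/-- The inclusion of `FiniteNorm 𝕜 r` into the space of all sequences. -/
def FiniteNorm.toSeq : FiniteNorm 𝕜 r →ₗ[𝕜] (ℕ → 𝕜) := (finiteNormSubmodule 𝕜 r).subtype

instance : Norm (FiniteNorm 𝕜 r) := ⟨fun x => (convexNorm (r : ℝ) (FiniteNorm.toSeq 𝕜 r x)).toReal⟩

theorem FiniteNorm.core : NormedSpace.Core 𝕜 (FiniteNorm 𝕜 r) where
  norm_nonneg _ := ENNReal.toReal_nonneg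
  norm_smul c x := by
    change (convexNorm (r : ℝ) (FiniteNorm.toSeq 𝕜 r (c • x))).toReal = _
    rw [map_smul, convexNorm_smul r.2, ENNReal.toReal_mul, toReal_enorm]
    rfl
  norm_triangle x y := by
    change (convexNorm (r : ℝ) (FiniteNorm.toSeq 𝕜 r (x + y))).toReal ≤
      (convexNorm (r : ℝ) (FiniteNorm.toSeq 𝕜 r x)).toReal +
      (convexNorm (r : ℝ) (FiniteNorm.toSeq 𝕜 r y)).toReal
    have hx : convexNorm (r : ℝ) (FiniteNorm.toSeq 𝕜 r x) ≠ ∞ := Subtype.property x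
    have hy : convexNorm (r : ℝ) (FiniteNorm.toSeq 𝕜 r y) ≠ ∞ := Subtype.property y
    rw [map_add, ← ENNReal.toReal_add hx hy]
    exact ENNReal.toReal_mono (ENNReal.add_ne_top.2 ⟨hx, hy⟩) (convexNorm_add r.2 _ _)
  norm_eq_zero_iff x := by
    have hx : convexNorm (r : ℝ) (FiniteNorm.toSeq 𝕜 r x) ≠ ∞ := Subtype.property x
    constructor
    · intro h
      have h' : convexNorm (r : ℝ) (FiniteNorm.toSeq 𝕜 r x) = 0 :=
        ((ENNReal.toReal_eq_zero_iff _).1 h).resolve_right hx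
      exact Subtype.ext (eq_zero_of_convexNorm_eq_zero r.2 h')
    · rintro rfl
      change (convexNorm (r : ℝ) (FiniteNorm.toSeq 𝕜 r 0)).toReal = 0
      rw [map_zero, convexNorm_zero r.2, ENNReal.toReal_zero]

instance : NormedAddCommGroup (FiniteNorm 𝕜 r) := NormedAddCommGroup.ofCore (FiniteNorm.core 𝕜 r)

instance : NormedSpace 𝕜 (FiniteNorm 𝕜 r) := NormedSpace.ofCore (FiniteNorm.core 𝕜 r)

/-- The finitely supported sequences. -/
def finiteSupport : Submodule 𝕜 (FiniteNorm 𝕜 r) where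
  carrier := {x | (Function.support (FiniteNorm.toSeq 𝕜 r x)).Finite}
  zero_mem' := by simp
  add_mem' := fun {x y} hx hy => by
    simp only [Set.mem_ofPred_eq, map_add] at *
    exact (hx.union hy).subset (Function.support_add _ _)
  smul_mem' := fun c x hx => by
    simp only [Set.mem_ofPred_eq, map_smul] at *
    exact hx.subset (Function.support_const_smul_subset c _)

/-- The `r`-convexified Tsirelson space `T^{(r)}`, `1 ≤ r < ∞`: the completion of the finitely
supported sequences in the norm `x ↦ ‖ |x|^r ‖_T^{1/r}`, realized as their closure in the space of
all sequences of finite norm. -/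
abbrev Tsirelson : Type _ := (finiteSupport 𝕜 r).topologicalClosure

end FiniteNorm

/-- The conjugate exponent `r = s / (s - 1)` of `1 < s ≤ ∞`, with `r = 1` for `s = ∞`. -/
def conjExp (s : Set.Ioi (1 : ℝ≥0∞)) : Set.Ici (1 : ℝ) :=
  ⟨(ENNReal.conjExponent (s : ℝ≥0∞)).toReal, by
    have hs : ((s : ℝ≥0∞) - 1)⁻¹ ≠ ∞ := ENNReal.inv_ne_top.2 (tsub_pos_of_lt s.2).ne'
    rw [Set.mem_Ici, ENNReal.conjExponent, ENNReal.toReal_add ENNReal.one_ne_top hs,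
      ENNReal.toReal_one]
    exact le_add_of_nonneg_right ENNReal.toReal_nonneg⟩

/-- `T_*^{(s)}`, `1 < s ≤ ∞`: the dual of `T^{(r)}`, where `r = s / (s - 1)`. -/
abbrev TsirelsonDual (𝕜 : Type*) [RCLike 𝕜] (s : Set.Ioi (1 : ℝ≥0∞)) : Type _ :=
  StrongDual 𝕜 (Tsirelson 𝕜 (conjExp s))

/-! ### The family of the theorem -/

section Family

variable (𝕜 : Type*) [RCLike 𝕜] (A : Finset (Set.Ici (1 : ℝ≥0∞))) (B : Finset (Set.Ici (1 : ℝ)))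
  (D : Finset (Set.Ioi (1 : ℝ≥0∞)))

/-- The disjoint union of the families `(ℓ_p)_{p ∈ A}`, `(T^{(r)})_{r ∈ B}` and
`(T_*^{(s)})_{s ∈ D}`. -/
def Family : A ⊕ B ⊕ D → Type _
  | .inl p => Ell 𝕜 p
  | .inr (.inl r) => Tsirelson 𝕜 r
  | .inr (.inr s) => TsirelsonDual 𝕜 s

instance : ∀ i, NormedAddCommGroup (Family 𝕜 A B D i)
  | .inl p => inferInstanceAs (NormedAddCommGroup (Ell 𝕜 p))
  | .inr (.inl r) => inferInstanceAs (NormedAddCommGroup (Tsirelson 𝕜 r))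
  | .inr (.inr s) => inferInstanceAs (NormedAddCommGroup (TsirelsonDual 𝕜 s))

instance : ∀ i, NormedSpace 𝕜 (Family 𝕜 A B D i)
  | .inl p => inferInstanceAs (NormedSpace 𝕜 (Ell 𝕜 p))
  | .inr (.inl r) => inferInstanceAs (NormedSpace 𝕜 (Tsirelson 𝕜 r))
  | .inr (.inr s) => inferInstanceAs (NormedSpace 𝕜 (TsirelsonDual 𝕜 s))

end Family

end

end UncBasis

universe w'

open Filter

namespace UncBasis

/-! ### Shift bases -/

/-! Say that operators from `X` to `Y` are small on tails if `‖T ∘ tail n‖ → 0` for every bounded `T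
: X → Y`. The proof has two halves: for any two different members of the family this holds in at
least one of the two directions, and this property alone forces splitting.

From smallness to splitting. Let `b` be an unconditional basis of the sum and `P i` the projection
onto `X i`. The diagonal entries of the `P i` at `b n` add up to 1, so some `i = σ n` has an entry
bounded below. Let `Q i` be the basis projection onto `σ ⁻¹' {i}`. Averaging over signs recovers the
diagonal of `P i` from its sign conjugates. Since that diagonal is bounded below on `σ ⁻¹' {i}`, `Q
i` is controlled by `P i` composed with coordinate projections (`exists_norm_part_le_left`,
`exists_norm_part_le_right`). A Baire category argument over all sets of indices makes the smallness
on tails uniform over these projections (`exists_forall_norm_part_le`). Hence, for `i ≠ j`, `P j ∘ Q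
i` restricted to `X j` is small between tails, and a tail of `X j` is complemented in the range of
`Q j`. Compactness makes the complement finite-dimensional, and the shift on `X j` absorbs it
(`nonempty_equiv_closure_span`).

Proving smallness. Each space has an exponent `α` (`1/p`, `1/r` or `1/s`): sums of `N` normalized
blocks starting beyond the `N`-th block grow like `N ^ α`, with only boundedness required when `α =
0`. If an operator is not small on tails, a gliding hump gives blocks whose images are almost blocks
with norms bounded below. For `α < α'` the growth rates then contradict each other
(`smallOnTails_of_estimates`).

For equal exponents the rates say nothing, and constants are compared on one block plus a normalized
sum of `N` later blocks. Its norm is exactly `2 ^ α` in `ℓ_p` for normalized blocks when `p < ∞`,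
and at most `1` in `c₀`. In `T^{(r)}` it is eventually at most `(7/4) ^ α`, because an admissible
family that sees the first block has too few sets to split most of the later ones
(`tsirelsonNorm_spread_le`). By duality it is eventually bounded below in `T_*^{(s)}` by a constant
larger than `2 ^ α`. On far tails an operator has norm close to its limiting value `L`, and blocks
nearly attain it, so a strict gap between constants is impossible (`smallOnTails_of_spread`). Thus
operators from `T^{(r)}` to `ℓ_p`, from `ℓ_p` to `T_*^{(s)}` and from `T^{(r)}` to `T_*^{(s)}` are
small on tails when the exponents agree. -/

/-- A monotone Schauder basis `vec` of `X`, with coordinate functionals `coord`, whose right and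
left shifts are bounded operators. -/
structure ShiftBasis (𝕜 : Type*) [RCLike 𝕜] (X : Type*) [NormedAddCommGroup X]
    [NormedSpace 𝕜 X] where
  /-- The basis vectors. -/
  vec : ℕ → X
  /-- The coordinate functionals. -/
  coord : ℕ → StrongDual 𝕜 X
  coord_vec : ∀ i j, coord i (vec j) = if i = j then 1 else 0
  /-- The right shift. -/
  right : X →L[𝕜] X
  /-- The left shift. -/
  left : X →L[𝕜] X
  left_right : ∀ x, left (right x) = x
  right_left : ∀ x, right (left x) = x - coord 0 x • vec 0
  right_vec : ∀ k, right (vec k) = vec (k + 1)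
  coord_left : ∀ k x, coord k (left x) = coord (k + 1) x
  norm_partialSum_le : ∀ n x, ‖∑ k ∈ Finset.range n, coord k x • vec k‖ ≤ ‖x‖
  norm_remainder_le : ∀ n x, ‖x - ∑ k ∈ Finset.range n, coord k x • vec k‖ ≤ ‖x‖
  tendsto_remainder :
    ∀ x, Tendsto (fun n => x - ∑ k ∈ Finset.range n, coord k x • vec k) atTop (𝓝 0)

namespace ShiftBasis

variable {𝕜 : Type*} [RCLike 𝕜] {X : Type*} [NormedAddCommGroup X] [NormedSpace 𝕜 X]
  {Y : Type*} [NormedAddCommGroup Y] [NormedSpace 𝕜 Y]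
  (E : ShiftBasis 𝕜 X)

/-- The projection onto the first `n` basis vectors. -/
noncomputable def head (n : ℕ) : X →L[𝕜] X :=
  ∑ k ∈ Finset.range n, (E.coord k).smulRight (E.vec k)

/-- The tail projection, which removes the first `n` coordinates. -/
noncomputable def tail (n : ℕ) : X →L[𝕜] X := ContinuousLinearMap.id 𝕜 X - E.head n

theorem head_apply (n : ℕ) (x : X) :
    E.head n x = ∑ k ∈ Finset.range n, E.coord k x • E.vec k := by
  simp [head]

theorem tail_apply (n : ℕ) (x : X) :
    E.tail n x = x - ∑ k ∈ Finset.range n, E.coord k x • E.vec k := by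
  simp [tail, head_apply]

theorem head_add_tail (n : ℕ) (x : X) : E.head n x + E.tail n x = x := by simp [tail]

theorem norm_head_apply_le (n : ℕ) (x : X) : ‖E.head n x‖ ≤ ‖x‖ := by
  rw [head_apply]; exact E.norm_partialSum_le n x

theorem norm_tail_apply_le (n : ℕ) (x : X) : ‖E.tail n x‖ ≤ ‖x‖ := by
  rw [tail_apply]; exact E.norm_remainder_le n x

theorem norm_tail_le (n : ℕ) : ‖E.tail n‖ ≤ 1 :=
  ContinuousLinearMap.opNorm_le_bound _ zero_le_one fun x => by
    simpa using E.norm_tail_apply_le n x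

theorem tendsto_tail (x : X) : Tendsto (fun n => E.tail n x) atTop (𝓝 0) := by
  simpa only [tail_apply] using E.tendsto_remainder x

theorem coord_tail (i n : ℕ) (x : X) :
    E.coord i (E.tail n x) = if i < n then 0 else E.coord i x := by
  rw [tail_apply, map_sub, map_sum]
  simp only [map_smul, E.coord_vec, smul_eq_mul, mul_ite, mul_one, mul_zero, Finset.sum_ite_eq,
    Finset.mem_range]
  split_ifs <;> simp

theorem tail_tail (m n : ℕ) (x : X) : E.tail m (E.tail n x) = E.tail (max m n) x := by
  rw [tail_apply E m]
  simp only [coord_tail]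
  rcases le_total m n with h | h
  · rw [max_eq_right h, sub_eq_self]
    refine Finset.sum_eq_zero fun k hk => ?_
    rw [if_pos ((Finset.mem_range.1 hk).trans_le h), zero_smul]
  · rw [max_eq_left h, tail_apply E n, tail_apply E m, sub_sub,
      ← Finset.sum_range_add_sum_Ico (fun k => E.coord k x • E.vec k) h]
    congr 2
    rw [← Finset.sum_range_add_sum_Ico _ h, Finset.sum_eq_zero, zero_add]
    · refine Finset.sum_congr rfl fun k hk => ?_
      rw [if_neg (not_lt.2 (Finset.mem_Ico.1 hk).1)]
    · intro k hk
      rw [if_pos (Finset.mem_range.1 hk), zero_smul]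

theorem tail_eq_self_of_le {m n : ℕ} (h : m ≤ n) {x : X} (hx : E.tail n x = x) :
    E.tail m x = x := by
  rw [← hx, tail_tail, max_eq_right h]

theorem tail_eq_zero_of_le {m n : ℕ} (h : m ≤ n) {x : X} (hx : E.tail m x = 0) :
    E.tail n x = 0 := by
  rw [← max_eq_left h, ← tail_tail, hx, map_zero]

theorem isCompactOperator_head (n : ℕ) : IsCompactOperator (E.head n) := by
  unfold head
  induction n with
  | zero => simpa using! (isCompactOperator_zero : IsCompactOperator (0 : X → X))
  | succ n ih =>
    rw [Finset.sum_range_succ]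
    refine ih.add ?_
    exact (isCompactOperator_of_locallyCompactSpace_rng
      (ContinuousLinearMap.toSpanSingleton 𝕜 (E.vec n))).comp_clm (E.coord n)

theorem tendsto_norm_comp_rankOne_tail (f : StrongDual 𝕜 X) (y : Y)
    (hf : Tendsto (fun n => ‖f ∘L E.tail n‖) atTop (𝓝 0)) :
    Tendsto (fun n => ‖(f.smulRight y) ∘L E.tail n‖) atTop (𝓝 0) := by
  have h : ∀ n, ‖(f.smulRight y) ∘L E.tail n‖ = ‖f ∘L E.tail n‖ * ‖y‖ := by
    intro n
    rw [← ContinuousLinearMap.norm_smulRight_apply]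
    rfl
  simpa [h] using hf.mul_const ‖y‖

/-- Tails tend to zero uniformly on the range of an operator that is small on tails. -/
theorem tendsto_norm_tail_comp (F : ShiftBasis 𝕜 Y) (T : X →L[𝕜] Y)
    (hT : Tendsto (fun n => ‖T ∘L E.tail n‖) atTop (𝓝 0)) :
    Tendsto (fun n => ‖F.tail n ∘L T‖) atTop (𝓝 0) := by
  rw [Metric.tendsto_atTop]
  intro ε hε
  obtain ⟨m, hm⟩ := (Metric.tendsto_atTop.1 hT (ε / 2) (half_pos hε))
  have hm := hm m le_rfl
  simp only [dist_zero_right, norm_norm] at hm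
  have h1 : Tendsto (fun n => ∑ k ∈ Finset.range m, ‖E.coord k‖ * ‖F.tail n (T (E.vec k))‖)
      atTop (𝓝 0) := by
    have : ∑ k ∈ Finset.range m, ‖E.coord k‖ * (0 : ℝ) = 0 := by simp
    rw [← this]
    refine tendsto_finsetSum _ fun k _ => ?_
    exact (tendsto_zero_iff_norm_tendsto_zero.1 (F.tendsto_tail (T (E.vec k)))).const_mul _
  obtain ⟨N, hN⟩ := (Metric.tendsto_atTop.1 h1 (ε / 2) (half_pos hε))
  refine ⟨N, fun n hn => ?_⟩
  have hN := hN n hn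
  simp only [dist_zero_right, norm_norm] at hN ⊢
  have hN' := (le_abs_self _).trans_lt hN
  -- `T` is a small operator plus a finite-rank one. Tails tend to zero on each of the finitely many
  -- vectors `T (E.vec k)`, `k < m`.
  have h2 : F.tail n ∘L T = F.tail n ∘L (T ∘L E.tail m) +
      ∑ k ∈ Finset.range m, (E.coord k).smulRight (F.tail n (T (E.vec k))) := by
    ext x
    simp only [ContinuousLinearMap.comp_apply, add_apply,
      sum_apply, ContinuousLinearMap.smulRight_apply]
    conv_lhs => rw [← E.head_add_tail m x, E.head_apply]
    simp only [map_add, map_sum, map_smul]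
    rw [add_comm]
  calc ‖F.tail n ∘L T‖ ≤ ‖F.tail n ∘L (T ∘L E.tail m)‖ +
        ‖∑ k ∈ Finset.range m, (E.coord k).smulRight (F.tail n (T (E.vec k)))‖ := by
        rw [h2]; exact norm_add_le _ _
    _ ≤ 1 * ‖T ∘L E.tail m‖ +
        ∑ k ∈ Finset.range m, ‖E.coord k‖ * ‖F.tail n (T (E.vec k))‖ := by
        refine add_le_add ((ContinuousLinearMap.opNorm_comp_le _ _).trans
          (mul_le_mul_of_nonneg_right (F.norm_tail_le n) (norm_nonneg _))) ?_
        refine (norm_sum_le _ _).trans (Finset.sum_le_sum fun k _ => ?_)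
        rw [ContinuousLinearMap.norm_smulRight_apply]
    _ < ε := by linarith

/-- `T` is then the norm limit of the finite-rank operators `T ∘L E.head n`. -/
theorem isCompactOperator_of_tendsto_comp_tail [CompleteSpace Y] (T : X →L[𝕜] Y)
    (hT : Tendsto (fun n => ‖T ∘L E.tail n‖) atTop (𝓝 0)) : IsCompactOperator T := by
  have h : Tendsto (fun n => T ∘L E.head n) atTop (𝓝 T) := by
    rw [tendsto_iff_norm_sub_tendsto_zero]
    refine hT.congr fun n => ?_
    rw [← norm_neg]
    congr 1
    ext x
    simp [tail]
  exact isCompactOperator_of_tendsto h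
    (Eventually.of_forall fun n => (E.isCompactOperator_head n).clm_comp T)

theorem isCompactOperator_of_tendsto_tail_comp [CompleteSpace X] (T : Y →L[𝕜] X)
    (hT : Tendsto (fun n => ‖E.tail n ∘L T‖) atTop (𝓝 0)) : IsCompactOperator T := by
  have h : Tendsto (fun n => E.head n ∘L T) atTop (𝓝 T) := by
    rw [tendsto_iff_norm_sub_tendsto_zero]
    refine hT.congr fun n => ?_
    rw [← norm_neg]
    congr 1
    ext x
    simp [tail]
  exact isCompactOperator_of_tendsto h
    (Eventually.of_forall fun n => (E.isCompactOperator_head n).comp_clm T)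

/-! #### Shifts -/

theorem left_pow_right_pow (n : ℕ) (x : X) : (E.left ^ n) ((E.right ^ n) x) = x := by
  induction n generalizing x with
  | zero => simp
  | succ n ih =>
    rw [pow_succ, pow_succ', mul_apply_eq_comp, mul_apply_eq_comp,
      E.left_right, ih]

theorem right_pow_vec (n : ℕ) : (E.right ^ n) (E.vec 0) = E.vec n := by
  induction n with
  | zero => simp
  | succ n ih => rw [pow_succ', mul_apply_eq_comp, ih, E.right_vec]

theorem coord_left_pow (n k : ℕ) (x : X) : E.coord k ((E.left ^ n) x) = E.coord (k + n) x := by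
  induction n generalizing k with
  | zero => simp
  | succ n ih => rw [pow_succ', mul_apply_eq_comp, E.coord_left, ih, add_right_comm,
      add_assoc]

theorem right_pow_left_pow (n : ℕ) (x : X) : (E.right ^ n) ((E.left ^ n) x) = E.tail n x := by
  induction n with
  | zero => simp [tail_apply]
  | succ n ih =>
    rw [pow_succ, pow_succ' E.left, mul_apply_eq_comp, mul_apply_eq_comp,
      E.right_left, map_sub, ih, map_smul, right_pow_vec, coord_left_pow, zero_add, tail_apply,
      tail_apply, Finset.sum_range_succ, sub_sub]

theorem left_vec_zero : E.left (E.vec 0) = 0 := by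
  have h := E.left_right (E.left (E.vec 0))
  rw [E.right_left, E.coord_vec] at h
  simpa using h.symm

theorem coord_zero_right (x : X) : E.coord 0 (E.right x) = 0 := by
  have h := E.right_left (E.right x)
  rw [E.left_right] at h
  have h2 := congrArg (E.coord 0) h
  rw [map_sub, map_smul, E.coord_vec] at h2
  simpa using h2

theorem tail_right_pow (n : ℕ) (x : X) : E.tail n ((E.right ^ n) x) = (E.right ^ n) x := by
  rw [← right_pow_left_pow, left_pow_right_pow]

/-- `X ≃ X × 𝕜`. -/
noncomputable def equivProd : X ≃L[𝕜] X × 𝕜 :=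
  ContinuousLinearEquiv.equivOfInverse (E.left.prod (E.coord 0))
    (E.right.coprod ((ContinuousLinearMap.id 𝕜 𝕜).smulRight (E.vec 0)))
    (fun x => by simp [E.right_left])
    (fun x => by
      refine Prod.ext ?_ ?_
      · simp [E.left_right, E.left_vec_zero]
      · simp [E.coord_zero_right, E.coord_vec])

theorem nonempty_equiv_prod_fin (E : ShiftBasis 𝕜 X) (n : ℕ) :
    Nonempty ((X × (Fin n → 𝕜)) ≃L[𝕜] X) := by
  induction n with
  | zero =>
    exact ⟨ContinuousLinearEquiv.prodUnique 𝕜 X (Fin 0 → 𝕜)⟩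
  | succ n ih =>
    obtain ⟨e⟩ := ih
    exact ⟨((ContinuousLinearEquiv.refl 𝕜 X).prodCongr
      (Fin.consEquivL 𝕜 (fun _ : Fin (n + 1) => 𝕜)).symm).trans
      ((ContinuousLinearEquiv.prodAssoc 𝕜 X 𝕜 (Fin n → 𝕜)).symm.trans
        ((E.equivProd.symm.prodCongr (ContinuousLinearEquiv.refl 𝕜 _)).trans e))⟩

/-- The shift makes `X` isomorphic to `X × 𝕜`. This absorbs the finite-dimensional kernel that
remains at the end of the splitting argument. -/
theorem nonempty_equiv_prod (E : ShiftBasis 𝕜 X) (W : Type*) [NormedAddCommGroup W]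
    [NormedSpace 𝕜 W]
    [FiniteDimensional 𝕜 W] : Nonempty ((X × W) ≃L[𝕜] X) := by
  obtain ⟨e⟩ := E.nonempty_equiv_prod_fin (Module.finrank 𝕜 W)
  have e' : W ≃L[𝕜] (Fin (Module.finrank 𝕜 W) → 𝕜) :=
    ContinuousLinearEquiv.ofFinrankEq (by simp)
  exact ⟨((ContinuousLinearEquiv.refl 𝕜 X).prodCongr e').trans e⟩

end ShiftBasis

/-! ### Multipliers with respect to an unconditional basis -/

section Multipliers

variable {𝕜 : Type*} [RCLike 𝕜] {V : Type*} [NormedAddCommGroup V] [NormedSpace 𝕜 V]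
  {β : Type*} (b : UnconditionalSchauderBasis β 𝕜 V)
  {Y : Type*} [NormedAddCommGroup Y] [NormedSpace 𝕜 Y]
  {Z : Type*} [NormedAddCommGroup Z] [NormedSpace 𝕜 Z]

theorem sum_abs_le_two_mul (t : β → ℝ) (F : Finset β) (B : ℝ)
    (h : ∀ G ⊆ F, |∑ n ∈ G, t n| ≤ B) : ∑ n ∈ F, |t n| ≤ 2 * B := by
  classical
  rw [← Finset.sum_filter_add_sum_filter_not F (fun n => 0 ≤ t n)]
  have h1 := (abs_le.1 (h _ (Finset.filter_subset (fun n => 0 ≤ t n) F))).2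
  have h2 := (abs_le.1 (h _ (Finset.filter_subset (fun n => ¬ 0 ≤ t n) F))).1
  have e1 : ∑ n ∈ F with 0 ≤ t n, |t n| = ∑ n ∈ F with 0 ≤ t n, t n :=
    Finset.sum_congr rfl fun n hn => abs_of_nonneg (Finset.mem_filter.1 hn).2
  have e2 : ∑ n ∈ F with ¬ 0 ≤ t n, |t n| = - ∑ n ∈ F with ¬ 0 ≤ t n, t n := by
    rw [← Finset.sum_neg_distrib]
    exact Finset.sum_congr rfl fun n hn => abs_of_neg (not_le.1 (Finset.mem_filter.1 hn).2)
  rw [e1, e2]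
  linarith

/-- Real and imaginary parts are each split by sign. Each of the four resulting sums is a subset
sum, hence at most `B`. -/
theorem sum_norm_le_four_mul (t : β → 𝕜) (F : Finset β) (B : ℝ)
    (h : ∀ G ⊆ F, ‖∑ n ∈ G, t n‖ ≤ B) : ∑ n ∈ F, ‖t n‖ ≤ 4 * B := by
  have h1 : ∑ n ∈ F, |RCLike.re (t n)| ≤ 2 * B := sum_abs_le_two_mul _ F B fun G hG => by
    rw [← map_sum]; exact (RCLike.abs_re_le_norm _).trans (h G hG)
  have h2 : ∑ n ∈ F, |RCLike.im (t n)| ≤ 2 * B := sum_abs_le_two_mul _ F B fun G hG => by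
    rw [← map_sum]; exact (RCLike.abs_im_le_norm _).trans (h G hG)
  have h3 : ∑ n ∈ F, ‖t n‖ ≤ ∑ n ∈ F, (|RCLike.re (t n)| + |RCLike.im (t n)|) :=
    Finset.sum_le_sum fun n _ => by
      refine (sq_le_sq₀ (norm_nonneg _) (by positivity)).1 ?_
      rw [RCLike.norm_sq_eq_def, add_sq, sq_abs, sq_abs]
      nlinarith [mul_nonneg (abs_nonneg (RCLike.re (t n))) (abs_nonneg (RCLike.im (t n)))]
  rw [Finset.sum_add_distrib] at h3
  linarith

/-- The multiplier `x ↦ ∑ n ∈ F, c n * x n` in terms of the coordinates. -/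
noncomputable def finDiag (F : Finset β) (c : β → 𝕜) : V →L[𝕜] V :=
  ∑ n ∈ F, c n • (b.coord n).smulRight (b n)

theorem finDiag_apply (F : Finset β) (c : β → 𝕜) (x : V) :
    finDiag b F c x = ∑ n ∈ F, (c n * b.coord n x) • b n := by
  simp [finDiag, mul_smul]

/-- Pairing with a norming functional turns the uniform bound on finite coordinate projections into
absolute summability of the scalar series, at the price of the factor 4. Bounded multipliers then
act termwise. -/
theorem exists_norm_finDiag_le [CompleteSpace V] :
    ∃ K : ℝ, 0 ≤ K ∧ ∀ (F : Finset β) (c : β → 𝕜) (r : ℝ), 0 ≤ r → (∀ n ∈ F, ‖c n‖ ≤ r) →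
      ‖finDiag b F c‖ ≤ r * K := by
  obtain ⟨C, hC⟩ := b.exists_norm_proj_le
  have hC0 : 0 ≤ C := (norm_nonneg _).trans (hC ∅)
  refine ⟨4 * C, by positivity, fun F c r hr hc => ?_⟩
  refine ContinuousLinearMap.opNorm_le_bound _ (by positivity) fun x => ?_
  obtain ⟨f, hf, hfx⟩ := exists_dual_vector'' 𝕜 (finDiag b F c x)
  have h1 : ‖finDiag b F c x‖ = ‖f (finDiag b F c x)‖ := by rw [hfx]; simp
  have h2 : ∑ n ∈ F, ‖b.coord n x * f (b n)‖ ≤ 4 * (C * ‖x‖) := by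
    refine sum_norm_le_four_mul _ F _ fun G _ => ?_
    have : ∑ n ∈ G, b.coord n x * f (b n) = f (b.proj G x) := by simp
    rw [this]
    calc ‖f (b.proj G x)‖ ≤ ‖f‖ * ‖b.proj G x‖ := f.le_opNorm _
      _ ≤ 1 * (C * ‖x‖) := by
        gcongr
        exact (b.proj G).le_of_opNorm_le (hC G) x
      _ = _ := one_mul _
  rw [h1, finDiag_apply, map_sum]
  calc ‖∑ n ∈ F, f ((c n * b.coord n x) • b n)‖
      ≤ ∑ n ∈ F, ‖f ((c n * b.coord n x) • b n)‖ := norm_sum_le _ _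
    _ ≤ ∑ n ∈ F, r * ‖b.coord n x * f (b n)‖ := by
        refine Finset.sum_le_sum fun n hn => ?_
        rw [map_smul, smul_eq_mul, mul_assoc, norm_mul]
        gcongr
        exact hc n hn
    _ = r * ∑ n ∈ F, ‖b.coord n x * f (b n)‖ := by rw [Finset.mul_sum]
    _ ≤ r * (4 * (C * ‖x‖)) := by gcongr
    _ = _ := by ring

theorem hasSum_indicator [CompleteSpace V] (s : Set β) (x : V) :
    HasSum (s.indicator fun n => b.coord n x • b n)
      (∑' n, s.indicator (fun n => b.coord n x • b n) n) :=
  ((b.expansion x).summable.indicator s).hasSum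

open scoped Classical in
theorem sum_indicator_eq_finDiag (s : Set β) (F : Finset β) (x : V) :
    ∑ n ∈ F, s.indicator (fun n => b.coord n x • b n) n =
      finDiag b F (fun n => if n ∈ s then 1 else 0) x := by
  rw [finDiag_apply]
  refine Finset.sum_congr rfl fun n _ => ?_
  by_cases h : n ∈ s <;> simp [h]

variable [CompleteSpace V]

/-- The projection onto the basis vectors with index in `s`. -/
noncomputable def part (s : Set β) : V →L[𝕜] V :=
  LinearMap.mkContinuousOfExistsBound
    { toFun := fun x => ∑' n, s.indicator (fun n => b.coord n x • b n) n
      map_add' := fun x y => by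
        rw [← ((hasSum_indicator b s x).add (hasSum_indicator b s y)).tsum_eq]
        congr 1
        ext n
        by_cases h : n ∈ s <;> simp [h, add_smul]
      map_smul' := fun a x => by
        simp only [RingHom.id_apply]
        rw [← ((hasSum_indicator b s x).const_smul a).tsum_eq]
        congr 1
        ext n
        by_cases h : n ∈ s <;> simp [h, mul_smul] }
    (by
      classical
      obtain ⟨K, hK0, hK⟩ := exists_norm_finDiag_le b
      refine ⟨K, fun x => ?_⟩
      refine le_of_tendsto (hasSum_indicator b s x).norm (Eventually.of_forall fun F => ?_)
      rw [sum_indicator_eq_finDiag]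
      refine (finDiag b F _).le_of_opNorm_le ?_ x
      rw [← one_mul K]
      refine hK F _ 1 zero_le_one fun n _ => ?_
      split_ifs <;> simp)

theorem hasSum_part (s : Set β) (x : V) :
    HasSum (s.indicator fun n => b.coord n x • b n) (part b s x) :=
  hasSum_indicator b s x

/-- `part b s x` is the limit of the finite projections onto subsets of `s`, so estimates need only
be proved for finite sets. -/
theorem norm_part_apply_le (A : V →L[𝕜] Y) (s : Set β) (x : V) (C : ℝ)
    (h : ∀ F : Finset β, ↑F ⊆ s → ‖A (b.proj F x)‖ ≤ C) : ‖A (part b s x)‖ ≤ C := by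
  classical
  have := (A.continuous.tendsto _).comp (hasSum_part b s x)
  refine le_of_tendsto this.norm (Eventually.of_forall fun F => ?_)
  have h2 := h (F.filter (· ∈ s)) fun n hn => (Finset.mem_filter.1 hn).2
  rw [GeneralSchauderBasis.proj_apply, Finset.sum_filter] at h2
  simpa only [Function.comp_apply, Set.indicator_apply] using h2

theorem part_basis (s : Set β) (n : β) [Decidable (n ∈ s)] :
    part b s (b n) = if n ∈ s then b n else 0 := by
  classical
  have h := hasSum_part b s (b n)
  have h2 : HasSum (s.indicator fun k => b.coord k (b n) • b k) (if n ∈ s then b n else 0) := by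
    convert hasSum_single n (f := s.indicator fun k => b.coord k (b n) • b k) ?_ using 1
    · simp [Set.indicator_apply, b.ortho]
    · intro k hk
      simp [Set.indicator_apply, b.ortho, Pi.single_apply, hk]
  exact h.unique h2

theorem part_coe (F : Finset β) (x : V) : part b F x = b.proj F x := by
  classical
  have h : HasSum ((F : Set β).indicator fun k => b.coord k x • b k)
      (∑ n ∈ F, (F : Set β).indicator (fun k => b.coord k x • b k) n) :=
    hasSum_sum_of_ne_finset_zero fun n hn => by simp [hn]
  rw [(hasSum_part b F x).unique h, GeneralSchauderBasis.proj_apply]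
  exact Finset.sum_congr rfl fun n hn => by simp [hn]

/-- Uniform estimates are available for coordinate projections only. Writing a sign change as a
difference of two of them transfers the estimates to sign changes, with a factor 2. -/
theorem finDiag_sign (F : Finset β) (ε : β → 𝕜) (hε : ∀ n, ε n = 1 ∨ ε n = -1) :
    ∃ s s' : Set β, finDiag b F ε = part b s - part b s' := by
  classical
  refine ⟨(F.filter fun n => ε n = 1 : Finset β), (F.filter fun n => ¬ ε n = 1 : Finset β), ?_⟩
  ext x
  rw [sub_apply, part_coe, part_coe, finDiag_apply, GeneralSchauderBasis.proj_apply,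
    GeneralSchauderBasis.proj_apply,
    ← Finset.sum_filter_add_sum_filter_not F (fun n => ε n = 1), sub_eq_add_neg]
  congr 1
  · exact Finset.sum_congr rfl fun n hn => by rw [(Finset.mem_filter.1 hn).2, one_mul]
  · rw [← Finset.sum_neg_distrib]
    exact Finset.sum_congr rfl fun n hn => by
      rw [(hε n).resolve_left (Finset.mem_filter.1 hn).2, neg_one_mul, neg_smul]

/-- The diagonal of a matrix is an average of sign changes of that matrix. -/
theorem norm_add_sum_diag_le (F : Finset β) (g : β → β → Y) (v : Y) (η : ℝ)
    (h : ∀ ε : β → 𝕜, (∀ n, ε n = 1 ∨ ε n = -1) →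
      ‖v + ∑ n ∈ F, ∑ m ∈ F, (ε n * ε m) • g n m‖ ≤ η) :
    ‖v + ∑ n ∈ F, g n n‖ ≤ η := by
  classical
  induction F using Finset.induction_on generalizing v with
  | empty => simpa using h (fun _ => 1) (fun _ => Or.inl rfl)
  | insert a F ha ih =>
    rw [Finset.sum_insert ha, ← add_assoc]
    refine ih (v + g a a) fun ε hε => ?_
    set S := ∑ n ∈ F, ∑ m ∈ F, (ε n * ε m) • g n m with hS
    set R := ∑ m ∈ F, ε m • (g a m + g m a) with hR
    -- Changing the sign at `a` alone affects only the cross terms, which are linear in `θ`. The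
    -- term `g a a` carries `θ * θ = 1`. Averaging over `θ = ±1` removes the cross terms.
    have key : ∀ θ : 𝕜, (θ = 1 ∨ θ = -1) → ‖v + g a a + S + θ • R‖ ≤ η := by
      intro θ hθ
      have h1 := h (Function.update ε a θ) fun n => by
        by_cases hn : n = a
        · subst hn; simpa using hθ
        · simpa [hn] using hε n
      have hθ2 : θ * θ = 1 := by rcases hθ with rfl | rfl <;> simp
      have hne : ∀ m ∈ F, m ≠ a := fun m hm hma => ha (hma ▸ hm)
      have e1 : ∑ n ∈ insert a F, ∑ m ∈ insert a F,
          (Function.update ε a θ n * Function.update ε a θ m) • g n m = g a a + S + θ • R := by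
        rw [Finset.sum_insert ha, Finset.sum_insert ha]
        have e2 : ∀ n ∈ F, ∑ m ∈ insert a F,
            (Function.update ε a θ n * Function.update ε a θ m) • g n m =
            (θ * ε n) • g n a + ∑ m ∈ F, (ε n * ε m) • g n m := by
          intro n hn
          rw [Finset.sum_insert ha]
          congr 1
          · simp [hne n hn, mul_comm]
          · exact Finset.sum_congr rfl fun m hm => by simp [hne n hn, hne m hm]
        have e3 : ∑ m ∈ F, (Function.update ε a θ a * Function.update ε a θ m) • g a m =
            ∑ m ∈ F, (θ * ε m) • g a m :=
          Finset.sum_congr rfl fun m hm => by simp [hne m hm]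
        rw [Finset.sum_congr rfl e2, e3, Finset.sum_add_distrib, hR, Finset.smul_sum]
        simp only [Function.update_self, hθ2, one_smul, smul_add, smul_smul,
          Finset.sum_add_distrib]
        abel
      rw [e1] at h1
      simpa [add_assoc] using h1
    have h1 := key 1 (Or.inl rfl)
    have h2 := key (-1) (Or.inr rfl)
    rw [one_smul] at h1
    rw [neg_one_smul] at h2
    set x := v + g a a + S
    have h3 : (2 : 𝕜) • x = (x + R) + (x + -R) := by rw [two_smul]; abel
    have h4 : 2 * ‖x‖ ≤ η + η := by
      calc 2 * ‖x‖ = ‖(2 : 𝕜) • x‖ := by rw [norm_smul]; simp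
        _ ≤ ‖x + R‖ + ‖x + -R‖ := by rw [h3]; exact norm_add_le _ _
        _ ≤ _ := add_le_add h1 h2
    linarith

/-- If the diagonal of `P` is bounded below on `s`, then the projection onto `s` is controlled by
`P` composed with coordinate projections. -/
theorem exists_norm_part_le_left {δ : ℝ} (hδ : 0 < δ) :
    ∃ C : ℝ, 0 ≤ C ∧ ∀ (s : Set β) (P : V →L[𝕜] V),
      (∀ n ∈ s, δ ≤ ‖b.coord n (P (b n))‖) → ∀ (x : V) (η : ℝ),
      (∀ a : Set β, ‖P (part b a x)‖ ≤ η) → ‖part b s x‖ ≤ C * η := by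
  obtain ⟨K, hK0, hK⟩ := exists_norm_finDiag_le b
  refine ⟨2 * (δ⁻¹ * K), by positivity, fun s P hs x η hη => ?_⟩
  have := norm_part_apply_le b (ContinuousLinearMap.id 𝕜 V) s x (2 * (δ⁻¹ * K) * η) fun F hF => ?_
  · simpa using this
  rw [ContinuousLinearMap.id_apply]
  set d : β → 𝕜 := fun n => b.coord n (P (b n)) with hd
  have hd0 : ∀ n ∈ F, d n ≠ 0 := fun n hn h0 => by
    have := hs n (hF hn)
    rw [← hd] at *
    change δ ≤ ‖d n‖ at this
    rw [h0, norm_zero] at this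
    linarith
  -- Row `n` of the matrix of `P` is divided by its diagonal entry, so the diagonal of the new
  -- matrix, applied to `x`, is the projection of `x` to `F`. Its sign conjugates factor through `P`
  -- applied to sign changes of `x`.
  have hg := norm_add_sum_diag_le (𝕜 := 𝕜) F
    (fun n m => ((d n)⁻¹ * b.coord n (P (b m)) * b.coord m x) • b n) 0
    (2 * (δ⁻¹ * K) * η) fun ε hε => ?_
  · rw [zero_add] at hg
    convert hg using 2
    rw [GeneralSchauderBasis.proj_apply]
    refine Finset.sum_congr rfl fun n hn => ?_
    rw [inv_mul_cancel₀ (hd0 n hn), one_mul]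
  · have e : (0 + ∑ n ∈ F, ∑ m ∈ F,
        (ε n * ε m) • ((d n)⁻¹ * b.coord n (P (b m)) * b.coord m x) • b n) =
        finDiag b F (fun n => ε n * (d n)⁻¹) (P (finDiag b F ε x)) := by
      rw [zero_add, finDiag_apply]
      refine Finset.sum_congr rfl fun n _ => ?_
      rw [finDiag_apply, map_sum, map_sum, Finset.mul_sum, Finset.sum_smul]
      refine Finset.sum_congr rfl fun m _ => ?_
      rw [smul_smul, map_smul, map_smul, smul_eq_mul]
      congr 1
      ring
    rw [e]
    obtain ⟨a, a', haa⟩ := finDiag_sign b F ε hε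
    have h1 : ‖P (finDiag b F ε x)‖ ≤ 2 * η := by
      rw [haa, sub_apply, map_sub]
      refine (norm_sub_le _ _).trans ?_
      linarith [hη a, hη a']
    have h2 : ‖finDiag b F (fun n => ε n * (d n)⁻¹)‖ ≤ δ⁻¹ * K := by
      refine hK F _ _ (by positivity) fun n hn => ?_
      have h1 : ‖ε n‖ = 1 := by rcases hε n with h | h <;> simp [h]
      rw [norm_mul, h1, one_mul, norm_inv]
      exact inv_anti₀ hδ (hs n (hF hn))
    calc _ ≤ (δ⁻¹ * K) * (2 * η) :=
          ((finDiag b F _).le_of_opNorm_le h2 _).trans (by gcongr)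
      _ = _ := by ring

/-- Mirror image of `exists_norm_part_le_left`: the weights `(d m)⁻¹` now sit on the input side,
before `R`. What remains on the left is `A` after a sign change after `J`, which is what the
hypothesis controls. -/
theorem exists_norm_part_le_right {δ : ℝ} (hδ : 0 < δ) :
    ∃ C : ℝ, 0 ≤ C ∧ ∀ (s : Set β) (J : Z →L[𝕜] V) (R : V →L[𝕜] Z),
      (∀ n ∈ s, δ ≤ ‖b.coord n (J (R (b n)))‖) → ‖R‖ ≤ 1 → ∀ (A : V →L[𝕜] Y) (η : ℝ), 0 ≤ η →
      (∀ a : Set β, ∀ z, ‖A (part b a (J z))‖ ≤ η * ‖z‖) →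
        ∀ x, ‖A (part b s x)‖ ≤ C * η * ‖x‖ := by
  obtain ⟨K, hK0, hK⟩ := exists_norm_finDiag_le b
  refine ⟨2 * (δ⁻¹ * K), by positivity, fun s J R hs hR A η hη0 hη x => ?_⟩
  refine norm_part_apply_le b A s x (2 * (δ⁻¹ * K) * η * ‖x‖) fun F hF => ?_
  set d : β → 𝕜 := fun n => b.coord n (J (R (b n))) with hd
  have hd0 : ∀ n ∈ F, d n ≠ 0 := fun n hn h0 => by
    have := hs n (hF hn)
    change δ ≤ ‖d n‖ at this
    rw [h0, norm_zero] at this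
    linarith
  have hg := norm_add_sum_diag_le (𝕜 := 𝕜) F
    (fun n m => (b.coord n (J (R (b m))) * ((d m)⁻¹ * b.coord m x)) • A (b n)) 0
    (2 * (δ⁻¹ * K) * η * ‖x‖) fun ε hε => ?_
  · rw [zero_add] at hg
    convert hg using 2
    rw [GeneralSchauderBasis.proj_apply, map_sum]
    refine Finset.sum_congr rfl fun n hn => ?_
    rw [← mul_assoc, mul_inv_cancel₀ (hd0 n hn), one_mul, map_smul]
  · have e : (0 + ∑ n ∈ F, ∑ m ∈ F,
        (ε n * ε m) • (b.coord n (J (R (b m))) * ((d m)⁻¹ * b.coord m x)) • A (b n)) =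
        A (finDiag b F ε (J (R (finDiag b F (fun n => ε n * (d n)⁻¹) x)))) := by
      rw [zero_add, finDiag_apply, map_sum]
      refine Finset.sum_congr rfl fun n _ => ?_
      rw [finDiag_apply, map_sum, map_sum, map_sum, Finset.mul_sum, Finset.sum_smul, map_sum]
      refine Finset.sum_congr rfl fun m _ => ?_
      rw [smul_smul, map_smul, map_smul, map_smul, map_smul, smul_eq_mul]
      congr 1
      ring
    rw [e]
    obtain ⟨a, a', haa⟩ := finDiag_sign b F ε hε
    have h2 : ‖finDiag b F (fun n => ε n * (d n)⁻¹)‖ ≤ δ⁻¹ * K := by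
      refine hK F _ _ (by positivity) fun n hn => ?_
      have h1 : ‖ε n‖ = 1 := by rcases hε n with h | h <;> simp [h]
      rw [norm_mul, h1, one_mul, norm_inv]
      exact inv_anti₀ hδ (hs n (hF hn))
    set z := R (finDiag b F (fun n => ε n * (d n)⁻¹) x) with hz
    have hzn : ‖z‖ ≤ δ⁻¹ * K * ‖x‖ :=
      (R.le_of_opNorm_le hR _).trans (by
        rw [one_mul]; exact (finDiag b F _).le_of_opNorm_le h2 _)
    have h1 : ‖A (finDiag b F ε (J z))‖ ≤ 2 * (η * ‖z‖) := by
      rw [haa, sub_apply, map_sub]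
      refine (norm_sub_le _ _).trans ?_
      linarith [hη a z, hη a' z]
    calc _ ≤ 2 * (η * (δ⁻¹ * K * ‖x‖)) := h1.trans (by gcongr)
      _ = _ := by ring

end Multipliers

/-! ### Uniformity over coordinate projections -/

section Uniform

variable {𝕜 : Type*} [RCLike 𝕜] {V : Type*} [NormedAddCommGroup V] [NormedSpace 𝕜 V]
  [CompleteSpace V] {β : Type*} (b : UnconditionalSchauderBasis β 𝕜 V)
  {Y : Type*} [NormedAddCommGroup Y] [NormedSpace 𝕜 Y]
  {Z : Type*} [NormedAddCommGroup Z] [NormedSpace 𝕜 Z]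

theorem part_sub_part_of_inter_eq (a a' : Set β) (F : Finset β) (h : ∀ n ∈ F, n ∈ a ↔ n ∈ a')
    (x : V) : part b a x - part b a' x = part b (a \ F) x - part b (a' \ F) x := by
  refine ((hasSum_part b a x).sub (hasSum_part b a' x)).unique ?_
  convert (hasSum_part b (a \ F) x).sub (hasSum_part b (a' \ F) x) using 2 with n
  by_cases hn : n ∈ F
  · have := h n hn
    by_cases h1 : n ∈ a
    · simp [hn, h1, this.1 h1]
    · simp [hn, h1, mt this.2 h1]
  · by_cases h1 : n ∈ a <;> by_cases h2 : n ∈ a' <;> simp [hn, h1, h2]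

/-- By unconditional convergence, the coordinates outside a suitable finite set contribute little,
uniformly over all index sets. Two index sets that agree on this finite set have nearby projections.
This is the continuity needed for a Baire argument on `β → Bool`. -/
theorem continuous_part (x : V) :
    Continuous fun a : β → Bool => part b {n | a n = true} x := by
  classical
  rw [continuous_iff_continuousAt]
  intro a
  rw [Metric.continuousAt_iff']
  intro ε hε
  obtain ⟨F, hF⟩ := summable_iff_vanishing_norm.mp (b.expansion x).summable (ε / 3) (by positivity)
  have hsmall : ∀ s : Set β, ‖part b (s \ F) x‖ ≤ ε / 3 := by
    intro s
    refine norm_part_apply_le b (ContinuousLinearMap.id 𝕜 V) _ x _ fun G hG => ?_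
    have := hF G (Finset.disjoint_left.2 fun n hn => (hG hn).2)
    simpa using this.le
  have hnhds : {a' : β → Bool | ∀ n ∈ F, a' n = a n} ∈ 𝓝 a := by
    have : {a' : β → Bool | ∀ n ∈ F, a' n = a n} = ⋂ n ∈ F, (fun a' => a' n) ⁻¹' {a n} := by
      ext; simp
    rw [this]
    refine (F.iInter_mem_sets).2 fun n _ => ?_
    exact (continuous_apply n).continuousAt.preimage_mem_nhds (by simp)
  filter_upwards [hnhds] with a' ha'
  rw [dist_eq_norm, part_sub_part_of_inter_eq b _ _ F]
  · refine (norm_sub_le _ _).trans_lt ?_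
    linarith [hsmall {n | a' n = true}, hsmall {n | a n = true}]
  · intro n hn
    simp [ha' n hn]

theorem part_eq_add_finDiag (a a' : Set β) (F : Finset β) (h : ∀ n ∉ F, n ∈ a ↔ n ∈ a') :
    ∃ c : β → 𝕜, (∀ n, ‖c n‖ ≤ 1) ∧ part b a = part b a' + finDiag b F c := by
  classical
  refine ⟨fun n => (if n ∈ a then 1 else 0) - (if n ∈ a' then 1 else 0), fun n => ?_, ?_⟩
  · by_cases h1 : n ∈ a <;> by_cases h2 : n ∈ a' <;> simp [h1, h2]
  · ext x
    rw [add_apply, ← sub_eq_iff_eq_add', finDiag_apply]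
    refine ((hasSum_part b a x).sub (hasSum_part b a' x)).unique ?_
    have h2 := hasSum_sum_of_ne_finset_zero (L := SummationFilter.unconditional β) (s := F)
      (f := fun n => ((((if n ∈ a then 1 else 0) - (if n ∈ a' then 1 else 0) : 𝕜) *
        b.coord n x) • b n)) fun n hn => by
        have := h n hn
        by_cases h1 : n ∈ a
        · simp [h1, this.1 h1]
        · simp [h1, mt this.2 h1]
    convert h2 using 2 with n
    by_cases h1 : n ∈ a <;> by_cases h2 : n ∈ a' <;> simp [h1, h2]

/-- If `A n * T * B n` tends to zero for every operator `T`, then this holds uniformly for the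
coordinate projections `T` of an unconditional basis. -/
theorem exists_forall_norm_part_le (A : ℕ → V →L[𝕜] Y) (B : ℕ → Z →L[𝕜] V)
    (h : ∀ T : V →L[𝕜] V, Tendsto (fun n => ‖A n ∘L T ∘L B n‖) atTop (𝓝 0)) {η : ℝ} (hη : 0 < η) :
    ∃ N, ∀ n ≥ N, ∀ (a : Set β) (z : Z), ‖A n (part b a (B n z))‖ ≤ η * ‖z‖ := by
  classical
  -- Baire category in the compact Hausdorff space `β → Bool`: the sets `C N` are closed and, by the
  -- hypothesis for each single projection, cover the space.
  let C : ℕ → Set (β → Bool) := fun N =>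
    {a | ∀ n ≥ N, ∀ z, ‖A n (part b {k | a k = true} (B n z))‖ ≤ η / 2 * ‖z‖}
  have hclosed : ∀ N, IsClosed (C N) := by
    intro N
    simp only [C, Set.ofPred_forall]
    refine isClosed_iInter fun n => isClosed_iInter fun _ => isClosed_iInter fun z => ?_
    exact isClosed_le ((A n).continuous.comp (continuous_part b (B n z))).norm continuous_const
  have hcover : ⋃ N, C N = Set.univ := by
    refine Set.eq_univ_of_forall fun a => Set.mem_iUnion.2 ?_
    obtain ⟨N, hN⟩ := Metric.tendsto_atTop.1 (h (part b {k | a k = true})) (η / 2) (half_pos hη)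
    refine ⟨N, fun n hn z => ?_⟩
    have := hN n hn
    rw [dist_zero_right, norm_norm] at this
    exact (A n ∘L part b {k | a k = true} ∘L B n).le_of_opNorm_le this.le z
  -- Some `C N` contains all index sets that agree with `a₀` on a finite set `F`.
  obtain ⟨N, a₀, ha₀⟩ := nonempty_interior_of_iUnion_of_closed hclosed hcover
  rw [mem_interior_iff_mem_nhds, nhds_pi, Filter.mem_pi] at ha₀
  obtain ⟨I, hI, t, ht, htC⟩ := ha₀
  set F := hI.toFinset with hF
  have hsum : Tendsto (fun n => ∑ k ∈ F, ‖A n ∘L ((b.coord k).smulRight (b k)) ∘L B n‖) atTop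
      (𝓝 0) := by
    rw [← Finset.sum_const_zero (s := F)]
    exact tendsto_finsetSum _ fun k _ => h _
  obtain ⟨M, hM⟩ := Metric.tendsto_atTop.1 hsum (η / 2) (half_pos hη)
  refine ⟨max N M, fun n hn a z => ?_⟩
  -- An arbitrary `a`, altered on `F` to agree with `a₀`, lies in `C N`. The alteration is a
  -- combination of finitely many rank-one operators with coefficients of norm at most 1, and the
  -- hypothesis applies to each of these as well.
  let a' : β → Bool := fun k => if k ∈ F then a₀ k else decide (k ∈ a)
  have ha' : a' ∈ C N := htC fun k hk => by
    have : a' k = a₀ k := if_pos (hI.mem_toFinset.2 hk)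
    rw [this]
    exact mem_of_mem_nhds (ht k)
  obtain ⟨c, hc, hac⟩ := part_eq_add_finDiag b a {k | a' k = true} F fun k hk => by
    simp [a', hk]
  have h1 := ha' n ((le_max_left _ _).trans hn) z
  have h2 := hM n ((le_max_right _ _).trans hn)
  rw [dist_zero_right, Real.norm_eq_abs] at h2
  have h2 := (le_abs_self _).trans h2.le
  have h3 : ‖A n (finDiag b F c (B n z))‖ ≤ η / 2 * ‖z‖ := by
    have e : A n (finDiag b F c (B n z)) =
        ∑ k ∈ F, c k • (A n ∘L ((b.coord k).smulRight (b k)) ∘L B n) z := by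
      rw [finDiag_apply, map_sum]
      refine Finset.sum_congr rfl fun k _ => ?_
      simp [mul_smul]
    rw [e]
    calc _ ≤ ∑ k ∈ F, ‖A n ∘L ((b.coord k).smulRight (b k)) ∘L B n‖ * ‖z‖ := by
          refine (norm_sum_le _ _).trans (Finset.sum_le_sum fun k _ => ?_)
          rw [norm_smul]
          refine (mul_le_of_le_one_left (norm_nonneg _) (hc k)).trans ?_
          exact ContinuousLinearMap.le_opNorm _ _
      _ ≤ _ := by rw [← Finset.sum_mul]; gcongr
  rw [hac, add_apply, map_add]
  refine (norm_add_le _ _).trans ?_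
  linarith

/-- The closed span of the basis vectors with index in `s`. -/
theorem mem_closure_span_iff (s : Set β) (x : V) :
    x ∈ (Submodule.span 𝕜 (b '' s)).topologicalClosure ↔ part b s x = x := by
  classical
  constructor
  · intro hx
    have hcl : IsClosed {x | part b s x = x} := isClosed_eq (part b s).continuous continuous_id
    refine hcl.closure_subset_iff.2 (fun y hy => ?_) hx
    change part b s y = y
    induction hy using Submodule.span_induction with
    | mem y hy =>
      obtain ⟨n, hn, rfl⟩ := hy
      rw [part_basis, if_pos hn]
    | zero => simp
    | add y z _ _ hy hz => rw [map_add, hy, hz]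
    | smul c y _ hy => rw [map_smul, hy]
  · intro hx
    rw [← hx]
    refine mem_closure_of_tendsto (hasSum_part b s x) (Eventually.of_forall fun F => ?_)
    refine Submodule.sum_mem _ fun n _ => ?_
    by_cases hn : n ∈ s
    · rw [Set.indicator_of_mem hn]
      exact Submodule.smul_mem _ _ (Submodule.subset_span ⟨n, hn, rfl⟩)
    · rw [Set.indicator_of_notMem hn]
      exact Submodule.zero_mem _

theorem part_part (s : Set β) (x : V) : part b s (part b s x) = part b s x := by
  classical
  have h := (part b s).continuous.tendsto _ |>.comp (hasSum_part b s x)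
  refine tendsto_nhds_unique h ((hasSum_part b s x).congr fun F => ?_)
  rw [Function.comp_apply, map_sum]
  refine Finset.sum_congr rfl fun n _ => ?_
  by_cases hn : n ∈ s
  · rw [Set.indicator_of_mem hn, map_smul, part_basis, if_pos hn]
  · rw [Set.indicator_of_notMem hn, map_zero]

end Uniform

/-! ### The splitting criterion -/

section Splitting

variable {𝕜 : Type u} [RCLike 𝕜] {ι : Type v} [Fintype ι] {X : ι → Type t}
  [∀ i, NormedAddCommGroup (X i)] [∀ i, NormedSpace 𝕜 (X i)]

/-- Every operator from `X` (with basis `E`) to `Y` is small on the tails of `X`. -/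
def SmallOnTails {X : Type*} [NormedAddCommGroup X] [NormedSpace 𝕜 X] (E : ShiftBasis 𝕜 X)
    (Y : Type*) [NormedAddCommGroup Y] [NormedSpace 𝕜 Y] : Prop :=
  ∀ T : X →L[𝕜] Y, Tendsto (fun n => ‖T ∘L E.tail n‖) atTop (𝓝 0)

variable {β : Type w} (b : UnconditionalSchauderBasis β 𝕜 (∀ i, X i))

theorem sum_part_preimage [∀ i, CompleteSpace (X i)] (σ : β → ι) (x : ∀ i, X i) :
    ∑ i, part b (σ ⁻¹' {i}) x = x := by
  refine (hasSum_sum fun i _ => hasSum_part b (σ ⁻¹' {i}) x).unique ?_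
  convert b.expansion x using 2 with n
  rw [Finset.sum_eq_single (σ n)]
  · simp
  · intro i _ hi
    rw [Set.indicator_of_notMem]
    exact fun h => hi (by simpa using h.symm)
  · simp

variable [DecidableEq ι]

theorem sum_single_proj (x : ∀ i, X i) :
    ∑ i, ContinuousLinearMap.single 𝕜 X i (x i) = x := by
  simpa using Finset.univ_sum_single x

/-- For fixed `n`, the numbers `b.coord n` of the components of `b n` in the summands `X i` add up
to `b.coord n (b n) = 1`. They cannot all be smaller than `1 / (card ι + 1)`. -/
theorem exists_partition : ∃ (σ : β → ι) (δ : ℝ), 0 < δ ∧ ∀ n,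
    δ ≤ ‖b.coord n (ContinuousLinearMap.single 𝕜 X (σ n)
      (ContinuousLinearMap.proj (R := 𝕜) (φ := X) (σ n) (b n)))‖ := by
  have h : ∀ n, ∃ i, ((Fintype.card ι : ℝ) + 1)⁻¹ ≤ ‖b.coord n (ContinuousLinearMap.single 𝕜 X i
      (ContinuousLinearMap.proj (R := 𝕜) (φ := X) i (b n)))‖ := by
    intro n
    by_contra! hcon
    have h1 : b.coord n (∑ i, ContinuousLinearMap.single 𝕜 X i (b n i)) = (1 : 𝕜) := by
      rw [sum_single_proj (𝕜 := 𝕜) (b n), b.ortho]; simp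
    rw [map_sum] at h1
    have h2 : (1 : ℝ) ≤ ∑ _i : ι, ((Fintype.card ι : ℝ) + 1)⁻¹ := by
      calc (1 : ℝ) = ‖∑ i, b.coord n (ContinuousLinearMap.single 𝕜 X i (b n i))‖ := by
            rw [h1]; simp
        _ ≤ _ := (norm_sum_le _ _).trans (Finset.sum_le_sum fun i _ => (hcon i).le)
    rw [Finset.sum_const, Finset.card_univ, nsmul_eq_mul, ← div_eq_mul_inv,
      le_div_iff₀ (by positivity)] at h2
    linarith
  choose σ hσ using h
  exact ⟨σ, _, by positivity, hσ⟩

end Splitting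

/-! ### Cross terms between the two decompositions, and the resulting isomorphisms. -/

section Splitting

variable {𝕜 : Type u} [RCLike 𝕜] {ι : Type v} [Fintype ι] {X : ι → Type t}
  [∀ i, NormedAddCommGroup (X i)] [∀ i, NormedSpace 𝕜 (X i)]

theorem norm_proj_le_one (i : ι) :
    ‖(ContinuousLinearMap.proj i : (∀ i, X i) →L[𝕜] X i)‖ ≤ 1 :=
  ContinuousLinearMap.opNorm_le_bound _ zero_le_one fun x => by
    simpa using norm_le_pi_norm x i

theorem tendsto_zero_of_forall_norm_apply_le {V Y : Type*} [NormedAddCommGroup V]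
    [NormedSpace 𝕜 V] [NormedAddCommGroup Y] [NormedSpace 𝕜 Y] (A : ℕ → V →L[𝕜] Y) {C : ℝ}
    (hC : 0 ≤ C) (h : ∀ η > 0, ∃ N, ∀ n ≥ N, ∀ z, ‖A n z‖ ≤ C * η * ‖z‖) :
    Tendsto (fun n => ‖A n‖) atTop (𝓝 0) := by
  rw [Metric.tendsto_atTop]
  intro ε hε
  obtain ⟨N, hN⟩ := h (ε / (2 * (C + 1))) (by positivity)
  refine ⟨N, fun n hn => ?_⟩
  rw [dist_zero_right, norm_norm]
  refine (ContinuousLinearMap.opNorm_le_bound _ (by positivity) (hN n hn)).trans_lt ?_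
  have : C * (ε / (2 * (C + 1))) = ε / 2 * (C / (C + 1)) := by field_simp
  rw [this]
  have h2 : C / (C + 1) ≤ 1 := (div_le_one (by linarith)).2 (by linarith)
  nlinarith

variable [DecidableEq ι] [∀ i, CompleteSpace (X i)] {β : Type w}
  {b : UnconditionalSchauderBasis β 𝕜 (∀ i, X i)} (E : ∀ i, ShiftBasis 𝕜 (X i)) {σ : β → ι} {δ : ℝ}
  (hδ : 0 < δ) (hσ : ∀ n,
    δ ≤ ‖b.coord n (ContinuousLinearMap.single 𝕜 X (σ n)
      (ContinuousLinearMap.proj (R := 𝕜) (φ := X) (σ n) (b n)))‖)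
include hδ hσ

/-- The diagonal of the projection onto `X i` is bounded below on `σ ⁻¹' {i}`, so
`exists_norm_part_le_left` reduces the claim to operators from `X j` to `X i` made from coordinate
projections. For these, smallness on tails is uniform. -/
theorem tendsto_part_comp_tail {i j : ι} (h : SmallOnTails (E j) (X i)) :
    Tendsto (fun n => ‖(part b (σ ⁻¹' {i}) ∘L ContinuousLinearMap.single 𝕜 X j) ∘L
      (E j).tail n‖) atTop (𝓝 0) := by
  obtain ⟨C, hC0, hC⟩ := exists_norm_part_le_left b hδ
  refine tendsto_zero_of_forall_norm_apply_le _ hC0 fun η hη => ?_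
  obtain ⟨N, hN⟩ := exists_forall_norm_part_le b
    (fun _ => (ContinuousLinearMap.proj i : (∀ i, X i) →L[𝕜] X i))
    (fun n => ContinuousLinearMap.single 𝕜 X j ∘L (E j).tail n)
    (fun T => h ((ContinuousLinearMap.proj i : (∀ i, X i) →L[𝕜] X i) ∘L T ∘L
      ContinuousLinearMap.single 𝕜 X j)) hη
  refine ⟨N, fun n hn z => ?_⟩
  rw [mul_assoc]
  refine hC (σ ⁻¹' {i}) (ContinuousLinearMap.single 𝕜 X i ∘L
    (ContinuousLinearMap.proj i : (∀ i, X i) →L[𝕜] X i)) (fun k hk => ?_) _ _ fun a => ?_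
  · have : σ k = i := hk
    subst this
    exact hσ k
  · refine le_trans (le_of_eq ?_) (hN n hn a z)
    exact Pi.norm_single _

/-- Smallness on tails of the domain gives uniformly vanishing tails of the image
(`tendsto_norm_tail_comp`). The uniform version of this is combined with
`exists_norm_part_le_right`. -/
theorem tendsto_tail_comp_part {i j : ι} (h : SmallOnTails (E j) (X i)) :
    Tendsto (fun n => ‖(E i).tail n ∘L ((ContinuousLinearMap.proj i : (∀ i, X i) →L[𝕜] X i) ∘L
      part b (σ ⁻¹' {j}))‖) atTop (𝓝 0) := by
  obtain ⟨C, hC0, hC⟩ := exists_norm_part_le_right (Y := X i) (Z := X j) b hδ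
  refine tendsto_zero_of_forall_norm_apply_le _ hC0 fun η hη => ?_
  obtain ⟨N, hN⟩ := exists_forall_norm_part_le b
    (fun n => (E i).tail n ∘L (ContinuousLinearMap.proj i : (∀ i, X i) →L[𝕜] X i))
    (fun _ => ContinuousLinearMap.single 𝕜 X j)
    (fun T => by
      simpa only [ContinuousLinearMap.comp_assoc] using
        (E j).tendsto_norm_tail_comp (E i) _
          (h ((ContinuousLinearMap.proj i : (∀ i, X i) →L[𝕜] X i) ∘L T ∘L
            ContinuousLinearMap.single 𝕜 X j))) hη
  refine ⟨N, fun n hn z => ?_⟩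
  have hs : ∀ k ∈ σ ⁻¹' {j}, δ ≤ ‖b.coord k (ContinuousLinearMap.single 𝕜 X j
      ((ContinuousLinearMap.proj j : (∀ i, X i) →L[𝕜] X j) (b k)))‖ := by
    rintro k rfl
    exact hσ k
  have hA : ∀ a : Set β, ∀ z, ‖((E i).tail n ∘L (ContinuousLinearMap.proj i :
      (∀ i, X i) →L[𝕜] X i)) (part b a (ContinuousLinearMap.single 𝕜 X j z))‖ ≤ η * ‖z‖ :=
    fun a z => hN n hn a z
  exact hC (σ ⁻¹' {j}) _ _ hs (norm_proj_le_one j) _ η hη.le hA z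

variable (hE : ∀ i j, i ≠ j → SmallOnTails (E i) (X j) ∨ SmallOnTails (E j) (X i))
include hE

/-- The difference is the sum over `k ≠ j` of the parts `σ ⁻¹' {k}` compressed to `X j`. Each term
is small because of the tail on its right or the tail on its left, according to the direction in
which operators between `X j` and `X k` are small on tails. -/
theorem tendsto_tail_sub_tail (j : ι) :
    Tendsto (fun n => ‖(E j).tail n ∘L (ContinuousLinearMap.id 𝕜 (X j) -
      (ContinuousLinearMap.proj j : (∀ i, X i) →L[𝕜] X j) ∘L part b (σ ⁻¹' {j}) ∘L
        ContinuousLinearMap.single 𝕜 X j) ∘L (E j).tail n‖) atTop (𝓝 0) := by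
  set pr := (ContinuousLinearMap.proj j : (∀ i, X i) →L[𝕜] X j) with hpr
  set inc := ContinuousLinearMap.single 𝕜 X j with hinc
  have hinc1 : ‖inc‖ ≤ 1 := ContinuousLinearMap.opNorm_le_bound _ zero_le_one fun x => by
    rw [one_mul]; exact (Pi.norm_single _).le
  have hK : ContinuousLinearMap.id 𝕜 (X j) - pr ∘L part b (σ ⁻¹' {j}) ∘L inc =
      ∑ k ∈ Finset.univ.erase j, pr ∘L part b (σ ⁻¹' {k}) ∘L inc := by
    rw [sub_eq_iff_eq_add, Finset.sum_erase_add _ _ (Finset.mem_univ j)]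
    ext x
    have h1 : x = pr (inc x) := by simp [hpr, hinc]
    conv_lhs => rw [ContinuousLinearMap.id_apply, h1, ← sum_part_preimage b σ (inc x)]
    rw [map_sum]
    simp
  have hle : ∀ n, ‖(E j).tail n ∘L (ContinuousLinearMap.id 𝕜 (X j) -
      pr ∘L part b (σ ⁻¹' {j}) ∘L inc) ∘L (E j).tail n‖ ≤
      ∑ k ∈ Finset.univ.erase j, ‖(E j).tail n ∘L (pr ∘L part b (σ ⁻¹' {k}) ∘L inc) ∘L
        (E j).tail n‖ := by
    intro n
    rw [hK, ContinuousLinearMap.finsetSum_comp, ContinuousLinearMap.comp_finsetSum]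
    exact norm_sum_le _ _
  refine squeeze_zero (fun n => norm_nonneg _) hle ?_
  rw [← Finset.sum_const_zero (s := Finset.univ.erase j)]
  refine tendsto_finsetSum _ fun k hk => ?_
  rcases hE j k (Finset.ne_of_mem_erase hk).symm with h | h
  · refine squeeze_zero (fun n => norm_nonneg _) (fun n => ?_)
      (tendsto_part_comp_tail E hδ hσ h)
    calc _ = ‖((E j).tail n ∘L pr) ∘L ((part b (σ ⁻¹' {k}) ∘L inc) ∘L (E j).tail n)‖ := rfl
      _ ≤ ‖(E j).tail n ∘L pr‖ * _ := ContinuousLinearMap.opNorm_comp_le _ _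
      _ ≤ 1 * _ := by
        gcongr
        refine (ContinuousLinearMap.opNorm_comp_le _ _).trans ?_
        exact mul_le_one₀ ((E j).norm_tail_le n) (norm_nonneg _) (norm_proj_le_one j)
      _ = _ := one_mul _
  · refine squeeze_zero (fun n => norm_nonneg _) (fun n => ?_)
      (tendsto_tail_comp_part E hδ hσ h)
    calc _ = ‖((E j).tail n ∘L (pr ∘L part b (σ ⁻¹' {k}))) ∘L (inc ∘L (E j).tail n)‖ := rfl
      _ ≤ _ * ‖inc ∘L (E j).tail n‖ := ContinuousLinearMap.opNorm_comp_le _ _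
      _ ≤ _ * 1 := by
        gcongr
        refine (ContinuousLinearMap.opNorm_comp_le _ _).trans ?_
        exact mul_le_one₀ hinc1 (norm_nonneg _) ((E j).norm_tail_le n)
      _ = _ := mul_one _

/-- One of the two factors, `part ∘ single` or `proj ∘ part`, is a norm limit of finite-rank
operators. -/
theorem isCompactOperator_part_comp {j k : ι} (hk : k ≠ j) :
    IsCompactOperator (part b (σ ⁻¹' {j}) ∘L ContinuousLinearMap.single 𝕜 X k ∘L
      (ContinuousLinearMap.proj k : (∀ i, X i) →L[𝕜] X k) ∘L part b (σ ⁻¹' {j})) := by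
  rcases hE k j hk with h | h
  · have h1 := ShiftBasis.isCompactOperator_of_tendsto_comp_tail (E k) _
      (tendsto_part_comp_tail E hδ hσ h)
    exact h1.comp_clm ((ContinuousLinearMap.proj k : (∀ i, X i) →L[𝕜] X k) ∘L
      part b (σ ⁻¹' {j}))
  · have h1 := ShiftBasis.isCompactOperator_of_tendsto_tail_comp (E k) _
      (tendsto_tail_comp_part E hδ hσ h)
    exact h1.clm_comp (part b (σ ⁻¹' {j}) ∘L ContinuousLinearMap.single 𝕜 X k)

/-- `X j`, shifted beyond `n`, embeds into `Z` through `Q`, with a left inverse `S` obtained from a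
Neumann series. So `Z` is `X j` plus `S.ker`. On this kernel a compact operator is the identity, so
it is finite-dimensional and is absorbed by `X j`. -/
theorem nonempty_equiv_closure_span (j : ι) :
    Nonempty ((Submodule.span 𝕜 (b '' (σ ⁻¹' {j}))).topologicalClosure ≃L[𝕜] X j) := by
  set pr := (ContinuousLinearMap.proj j : (∀ i, X i) →L[𝕜] X j) with hpr
  set inc := ContinuousLinearMap.single 𝕜 X j with hinc
  set Q := part b (σ ⁻¹' {j}) with hQ
  set Z := (Submodule.span 𝕜 (b '' (σ ⁻¹' {j}))).topologicalClosure with hZ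
  have hZmem : ∀ x, x ∈ Z ↔ Q x = x := fun x => mem_closure_span_iff b _ x
  obtain ⟨n, hn⟩ := (Metric.tendsto_atTop.1 (tendsto_tail_sub_tail E hδ hσ hE j) 1 one_pos)
  have hn := hn n le_rfl
  rw [dist_zero_right, norm_norm] at hn
  set R := (E j).tail n with hR
  set K := ContinuousLinearMap.id 𝕜 (X j) - pr ∘L Q ∘L inc with hK
  have hRR : ∀ x, R (R x) = R x := fun x => by rw [hR, ShiftBasis.tail_tail, max_self]
  -- `U = 1 - R K R` is invertible by the Neumann series. On the range of `R` it coincides with `R`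
  -- after `pr ∘ Q ∘ inc`.
  have hUnit := isUnit_one_sub_of_norm_lt_one hn
  obtain ⟨U, hU⟩ := hUnit
  have hUx : ∀ x, (U : X j →L[𝕜] X j) x = x - R (K (R x)) := fun x => by rw [hU]; rfl
  set Ui : X j →L[𝕜] X j := ((U⁻¹ : (X j →L[𝕜] X j)ˣ) : X j →L[𝕜] X j) with hUi
  have hUiU : ∀ x, Ui ((U : X j →L[𝕜] X j) x) = x := fun x => by
    rw [← mul_apply_eq_comp, hUi, Units.inv_mul]; rfl
  have hUUi : ∀ x, (U : X j →L[𝕜] X j) (Ui x) = x := fun x => by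
    rw [← mul_apply_eq_comp, hUi, Units.mul_inv]; rfl
  -- `R` is idempotent, hence commutes with `R K R`, with `U` and with its inverse.
  have hcomm : ∀ x, R (Ui x) = Ui (R x) := fun x => by
    rw [← hUiU (R (Ui x))]
    congr 1
    conv_rhs => rw [← hUUi x]
    rw [hUx, hUx, hRR, map_sub, hRR]
  -- `T` moves `X j` onto its tail before projecting. `S` projects back to this tail, applies the
  -- inverse of `U` and shifts left.
  let T : X j →L[𝕜] Z := (Q ∘L inc ∘L (E j).right ^ n).codRestrict Z fun x =>
    (hZmem _).2 (part_part b _ _)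
  let S : Z →L[𝕜] X j := ((E j).left ^ n) ∘L Ui ∘L R ∘L pr ∘L Z.subtypeL
  have hST : ∀ x, S (T x) = x := by
    intro x
    set y := ((E j).right ^ n) x with hy
    have hRy : R y = y := (E j).tail_right_pow n x
    have h1 : R (pr (Q (inc y))) = (U : X j →L[𝕜] X j) y := by
      rw [hUx, hRy, hK, sub_apply, map_sub, ContinuousLinearMap.id_apply, hRy]
      simp
    change ((E j).left ^ n) (Ui (R (pr (Q (inc y))))) = x
    rw [h1, hUiU, hy, (E j).left_pow_right_pow]
  have hker : ∀ z : Z, S z = 0 → R (pr z) = 0 := by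
    intro z hz
    have h1 : ((E j).left ^ n) (Ui (R (pr z))) = 0 := hz
    have h2 := congrArg ((E j).right ^ n) h1
    rw [(E j).right_pow_left_pow, map_zero] at h2
    change R (Ui (R (pr z))) = 0 at h2
    rw [hcomm, hRR] at h2
    have h3 := congrArg (U : X j →L[𝕜] X j) h2
    rwa [hUUi, map_zero] at h3
  -- If `S w = 0`, then the `j`-th component of `w` lies in the first `n` coordinates. Expanding `w
  -- = Q w` over the summands gives `G w = w`, where every term of `G` is compact.
  let G : (∀ i, X i) →L[𝕜] (∀ i, X i) := Q ∘L inc ∘L (E j).head n ∘L pr +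
    ∑ k ∈ Finset.univ.erase j, Q ∘L ContinuousLinearMap.single 𝕜 X k ∘L
      (ContinuousLinearMap.proj k : (∀ i, X i) →L[𝕜] X k) ∘L Q
  have hG : IsCompactOperator G := by
    have : G ∈ compactOperator (RingHom.id 𝕜) (∀ i, X i) (∀ i, X i) := by
      refine Submodule.add_mem _ ?_ (Submodule.sum_mem _ fun k hk => ?_)
      · exact (((E j).isCompactOperator_head n).comp_clm pr).clm_comp (Q ∘L inc)
      · exact isCompactOperator_part_comp E hδ hσ hE (Finset.ne_of_mem_erase hk)
    exact this
  have hGw : ∀ w : S.ker, G ((w : Z) : ∀ i, X i) = ((w : Z) : ∀ i, X i) := by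
    intro w
    have hw : Q ((w : Z) : ∀ i, X i) = ((w : Z) : ∀ i, X i) := (hZmem _).1 (w : Z).2
    have h1 : (E j).head n (pr ((w : Z) : ∀ i, X i)) = pr ((w : Z) : ∀ i, X i) := by
      have := (E j).head_add_tail n (pr ((w : Z) : ∀ i, X i))
      rwa [show (E j).tail n (pr ((w : Z) : ∀ i, X i)) = 0 from hker w w.2, add_zero] at this
    simp only [G, add_apply, sum_apply, ContinuousLinearMap.comp_apply, hw, h1]
    conv_rhs => rw [← hw, ← sum_single_proj (𝕜 := 𝕜) ((w : Z) : ∀ i, X i), map_sum,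
      ← Finset.add_sum_erase _ _ (Finset.mem_univ j)]
    rfl
  have hZcl : IsClosed (Z : Set (∀ i, X i)) := Submodule.isClosed_topologicalClosure _
  have hc1 : IsCompactOperator (fun w : S.ker => (w : Z)) := by
    have h1 := hG.comp_clm (Z.subtypeL ∘L S.ker.subtypeL)
    have h2 := IsCompactOperator.codRestrict (V := Z) h1 (fun w => by
      change G ((w : Z) : ∀ i, X i) ∈ Z
      rw [hGw]; exact (w : Z).2) hZcl
    refine (congrArg IsCompactOperator (funext fun w => ?_)).mpr h2
    exact Subtype.ext (hGw w).symm
  -- The identity of the kernel is compact, so the kernel is finite-dimensional by Riesz's theorem.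
  have hc2 : IsCompactOperator (id : S.ker → S.ker) :=
    IsCompactOperator.codRestrict (V := S.ker) hc1 (fun w => w.2) S.isClosed_ker
  have hfd : FiniteDimensional 𝕜 S.ker := FiniteDimensional.of_isCompactOperator_id hc2
  obtain ⟨e⟩ := (E j).nonempty_equiv_prod S.ker
  exact ⟨(ContinuousLinearEquiv.equivOfRightInverse S T hST).trans e⟩

omit hδ hσ hE in
/-- A finite family of Banach spaces with shift bases is splitting for unconditional bases, if for
any two of them all operators from one to the other (in one of the two directions) are small on
tails. -/
theorem splitting_of_smallOnTails
    (hE : ∀ i j, i ≠ j → SmallOnTails (E i) (X j) ∨ SmallOnTails (E j) (X i)) :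
    SplittingForUnconditionalBases.{u, v, t, w'} 𝕜 X := by
  intro β b
  obtain ⟨σ, δ, hδ, hσ⟩ := exists_partition b
  exact ⟨σ, nonempty_equiv_closure_span E hδ hσ hE⟩

end Splitting

/-! ### Block sequences and operators that are small on tails -/

theorem exists_seq_of_step {S A : Type*} (r : ℕ → S → S → A → Prop)
    (h : ∀ k s, ∃ s' a, r k s s' a) (s₀ : S) :
    ∃ (s : ℕ → S) (a : ℕ → A), s 0 = s₀ ∧ ∀ k, r k (s k) (s (k + 1)) (a k) := by
  choose f g hfg using h
  exact ⟨fun k => Nat.rec s₀ f k, fun k => g k (Nat.rec s₀ f k), rfl, fun k => hfg k _⟩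

namespace ShiftBasis

variable {𝕜 : Type*} [RCLike 𝕜] {X : Type*} [NormedAddCommGroup X] [NormedSpace 𝕜 X]
  {Y : Type*} [NormedAddCommGroup Y] [NormedSpace 𝕜 Y]
  (E : ShiftBasis 𝕜 X) (F : ShiftBasis 𝕜 Y)

/-- `u k` is supported in `[n k, n (k + 1))` for all `k`. -/
def IsBlockSeq (n : ℕ → ℕ) (u : ℕ → X) : Prop :=
  StrictMono n ∧ ∀ k, E.tail (n k) (u k) = u k ∧ E.tail (n (k + 1)) (u k) = 0

/-- An asymptotic upper estimate for sums of blocks. -/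
def UpperEstimate (α C : ℝ) : Prop :=
  ∀ n u, E.IsBlockSeq n u → (∀ k, ‖u k‖ ≤ 1) →
    ∀ N : ℕ, ‖∑ k ∈ Finset.range N, u (N + k)‖ ≤ C * (N : ℝ) ^ α

/-- An asymptotic lower estimate for sums of blocks. -/
def LowerEstimate (α c : ℝ) : Prop :=
  ∀ n u, E.IsBlockSeq n u → (∀ k, 1 ≤ ‖u k‖) →
    ∀ N : ℕ, c * (N : ℝ) ^ α ≤ ‖∑ k ∈ Finset.range N, u (N + k)‖

/-- The sum of the first block and an average of blocks far to the right. -/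
noncomputable def spread (𝕜 : Type*) [RCLike 𝕜] {X : Type*} [NormedAddCommGroup X]
    [NormedSpace 𝕜 X] (α : ℝ) (N : ℕ) (u : ℕ → X) : X :=
  u 0 + (((N : ℝ) ^ (-α) : ℝ) : 𝕜) • ∑ k ∈ Finset.range N, u (k + 1)

/-- An upper estimate for a block plus an average of subsequent blocks. -/
def UpperSpread (α κ : ℝ) : Prop :=
  ∀ n u, E.IsBlockSeq n u → (∀ k, ‖u k‖ ≤ 1) → ∃ N₀, ∀ N ≥ N₀, ‖spread 𝕜 α N u‖ ≤ κ

/-- A lower estimate for a block plus an average of subsequent blocks. -/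
def LowerSpread (α κ : ℝ) : Prop :=
  ∀ n u, E.IsBlockSeq n u → (∀ k, 1 ≤ ‖u k‖) → ∃ N₀, ∀ N ≥ N₀, κ ≤ ‖spread 𝕜 α N u‖

variable {E F}

theorem IsBlockSeq.smul {n : ℕ → ℕ} {u : ℕ → X} (h : E.IsBlockSeq n u) (c : 𝕜) :
    E.IsBlockSeq n (fun k => c • u k) :=
  ⟨h.1, fun k => by simp [(h.2 k).1, (h.2 k).2]⟩

theorem IsBlockSeq.tail_eq {n : ℕ → ℕ} {u : ℕ → X} (h : E.IsBlockSeq n u) {p : ℕ}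
    (hp : p ≤ n 0) (k : ℕ) : E.tail p (u k) = u k :=
  E.tail_eq_self_of_le (hp.trans (h.1.monotone (Nat.zero_le k))) (h.2 k).1

theorem spread_smul (α : ℝ) (N : ℕ) (u : ℕ → X) (c : 𝕜) :
    spread 𝕜 α N (fun k => c • u k) = c • spread 𝕜 α N u := by
  simp only [spread, smul_add, Finset.smul_sum, smul_smul, mul_comm]

theorem spread_map (α : ℝ) (N : ℕ) (u : ℕ → X) (T : X →L[𝕜] Y) :
    T (spread 𝕜 α N u) = spread 𝕜 α N (fun k => T (u k)) := by
  simp [spread]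

theorem spread_sub (α : ℝ) (N : ℕ) (u v : ℕ → X) :
    spread 𝕜 α N u - spread 𝕜 α N v = spread 𝕜 α N (fun k => u k - v k) := by
  simp only [spread, Finset.sum_sub_distrib, smul_sub]
  abel

theorem norm_spread_le {α : ℝ} (hα : 0 ≤ α) {N : ℕ} (u : ℕ → X) :
    ‖spread 𝕜 α N u‖ ≤ ∑ k ∈ Finset.range (N + 1), ‖u k‖ := by
  rw [Finset.sum_range_succ', add_comm]
  refine (norm_add_le _ _).trans (add_le_add le_rfl ?_)
  have h1 : ‖(((N : ℝ) ^ (-α) : ℝ) : 𝕜)‖ ≤ 1 := by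
    rw [RCLike.norm_ofReal, abs_of_nonneg (by positivity)]
    rcases Nat.eq_zero_or_pos N with rfl | hN
    · rcases hα.eq_or_lt with rfl | h
      · simp
      · rw [Nat.cast_zero, Real.zero_rpow (by linarith)]; exact zero_le_one
    · exact Real.rpow_le_one_of_one_le_of_nonpos (by exact_mod_cast hN) (by linarith)
  rw [norm_smul]
  exact (mul_le_of_le_one_left (norm_nonneg _) h1).trans (norm_sum_le _ _)

/-! ### Blocks far out on which an operator stays large. -/

theorem antitone_norm_comp_tail (T : X →L[𝕜] Y) : Antitone fun n => ‖T ∘L E.tail n‖ := by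
  intro m n h
  have : T ∘L E.tail n = (T ∘L E.tail m) ∘L E.tail n := by
    ext x; simp [tail_tail, max_eq_right h]
  change ‖T ∘L E.tail n‖ ≤ ‖T ∘L E.tail m‖
  rw [this]
  refine (ContinuousLinearMap.opNorm_comp_le _ _).trans ?_
  exact mul_le_of_le_one_right (norm_nonneg _) (E.norm_tail_le n)

/-- The norms on tails decrease to a positive limit `L`. Having norm nearly `L` on one tail and at
least `L` on every tail is what makes sharp constants comparable later. -/
theorem exists_limit_of_not_tendsto (T : X →L[𝕜] Y)
    (h : ¬ Tendsto (fun n => ‖T ∘L E.tail n‖) atTop (𝓝 0)) :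
    ∃ L : ℝ, 0 < L ∧ (∀ n, L ≤ ‖T ∘L E.tail n‖) ∧ ∀ ε > 0, ∃ p, ‖T ∘L E.tail p‖ < L + ε := by
  have hbdd : BddBelow (Set.range fun n => ‖T ∘L E.tail n‖) :=
    ⟨0, by rintro _ ⟨n, rfl⟩; exact norm_nonneg _⟩
  have hlim := tendsto_atTop_ciInf (antitone_norm_comp_tail (E := E) T) hbdd
  refine ⟨⨅ n, ‖T ∘L E.tail n‖, ?_, fun n => ciInf_le hbdd n, fun ε hε => ?_⟩
  · refine lt_of_le_of_ne (le_ciInf fun n => norm_nonneg _) fun h0 => h ?_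
    rwa [← h0] at hlim
  · exact exists_lt_of_ciInf_lt (lt_add_of_pos_right _ hε)

/-- A finitely supported vector far to the right with large image. -/
theorem exists_block_lt (T : X →L[𝕜] Y) {τ : ℝ} (p : ℕ) (h : τ < ‖T ∘L E.tail p‖) :
    ∃ (x : X) (p' : ℕ), p < p' ∧ ‖x‖ ≤ 1 ∧ τ < ‖T x‖ ∧ E.tail p x = x ∧ E.tail p' x = 0 := by
  obtain ⟨x₀, hx₀, hTx₀⟩ := ContinuousLinearMap.exists_lt_apply_of_lt_opNorm _ h
  set x₁ := E.tail p x₀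
  have hx₁ : ‖x₁‖ < 1 := (E.norm_tail_apply_le p x₀).trans_lt hx₀
  have hlim : Tendsto (fun n => x₁ - E.tail n x₁) atTop (𝓝 x₁) := by
    simpa using tendsto_const_nhds.sub (E.tendsto_tail x₁)
  have h1 := hlim.norm.eventually_lt_const hx₁
  have h2 := ((T.continuous.tendsto _).comp hlim).norm.eventually_const_lt hTx₀
  obtain ⟨p', h1, h2, h3⟩ := (h1.and (h2.and (eventually_gt_atTop p))).exists
  refine ⟨x₁ - E.tail p' x₁, p', h3, h1.le, h2, ?_, ?_⟩
  · simp only [x₁, map_sub, E.tail_tail, max_self, max_eq_left h3.le, max_eq_right h3.le]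
  · simp only [map_sub, E.tail_tail p' p', max_self, sub_self]

theorem exists_blockSeq (T : X →L[𝕜] Y) {τ : ℝ} (h : ∀ n, τ < ‖T ∘L E.tail n‖) (p : ℕ) :
    ∃ n u, n 0 = p ∧ E.IsBlockSeq n u ∧ ∀ k, ‖u k‖ ≤ 1 ∧ τ < ‖T (u k)‖ := by
  obtain ⟨n, u, h0, hu⟩ := exists_seq_of_step
    (fun _ p p' x => p < p' ∧ ‖x‖ ≤ 1 ∧ τ < ‖T x‖ ∧ E.tail p x = x ∧ E.tail p' x = 0)
    (fun _ p => by
      obtain ⟨x, p', hx⟩ := exists_block_lt T p (h p)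
      exact ⟨p', x, hx⟩) p
  exact ⟨n, u, h0, ⟨strictMono_nat_of_lt_succ fun k => (hu k).1, fun k => (hu k).2.2.2⟩,
    fun k => ⟨(hu k).2.1, (hu k).2.2.1⟩⟩

variable (E) in
/-- The basis is shrinking. -/
def Shrinking : Prop := SmallOnTails E 𝕜

variable (F) in
/-- The gliding hump argument. -/
theorem exists_blockSeq_image (hE : E.Shrinking) (T : X →L[𝕜] Y) {τ : ℝ}
    (h : ∀ n, τ < ‖T ∘L E.tail n‖) (p : ℕ) (η : ℕ → ℝ) (hη : ∀ k, 0 < η k) :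
    ∃ n u m v, n 0 = p ∧ E.IsBlockSeq n u ∧ F.IsBlockSeq m v ∧
      ∀ k, ‖u k‖ ≤ 1 ∧ τ < ‖T (u k)‖ ∧ ‖T (u k) - v k‖ ≤ η k := by
  have step : ∀ (k : ℕ) (s : ℕ × ℕ), ∃ (s' : ℕ × ℕ) (a : X × Y),
      s.1 < s'.1 ∧ s.2 < s'.2 ∧ ‖a.1‖ ≤ 1 ∧ τ < ‖T a.1‖ ∧ E.tail s.1 a.1 = a.1 ∧
        E.tail s'.1 a.1 = 0 ∧ F.tail s.2 a.2 = a.2 ∧ F.tail s'.2 a.2 = 0 ∧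
        ‖T a.1 - a.2‖ ≤ η k := by
    rintro k ⟨p, q⟩
    -- Each of the first `q` coordinates of `T` is a functional, and the basis of `X` is shrinking.
    -- Hence vectors far enough out have images almost vanishing on these coordinates, so the next
    -- image nearly starts at `q`.
    have hhead : Tendsto (fun n => ∑ i ∈ Finset.range q,
        ‖((F.coord i ∘L T).smulRight (F.vec i)) ∘L E.tail n‖) atTop (𝓝 0) := by
      rw [← Finset.sum_const_zero (s := Finset.range q)]
      exact tendsto_finsetSum _ fun i _ => E.tendsto_norm_comp_rankOne_tail _ _ (hE _)
    obtain ⟨p₁, hp₁, hp₁'⟩ := ((hhead.eventually_lt_const (half_pos (hη k))).and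
      (eventually_ge_atTop p)).exists
    obtain ⟨x, p', hp', hx, hTx, hx1, hx2⟩ := exists_block_lt T p₁ (h p₁)
    obtain ⟨q', hq', hqq'⟩ := (((F.tendsto_tail (T x)).norm.eventually_lt_const
      (by rw [norm_zero]; exact half_pos (hη k) : ‖(0 : Y)‖ < η k / 2)).and
          (eventually_gt_atTop q)).exists
    refine ⟨(p', q'), (x, F.tail q (T x) - F.tail q' (T x)), hp₁'.trans_lt hp', hqq', hx, hTx,
      E.tail_eq_self_of_le hp₁' hx1, hx2, ?_, ?_, ?_⟩
    · simp only [map_sub, F.tail_tail, max_self, max_eq_right hqq'.le]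
    · simp only [map_sub, F.tail_tail, max_self, max_eq_left hqq'.le, sub_self]
    · have e : T x - (F.tail q (T x) - F.tail q' (T x)) = F.head q (T x) + F.tail q' (T x) := by
        rw [eq_sub_of_add_eq (F.head_add_tail q (T x))]
        abel
      have h2 : ‖F.head q (T x)‖ ≤ η k / 2 := by
        have e2 : F.head q (T x) = ∑ i ∈ Finset.range q,
            (((F.coord i ∘L T).smulRight (F.vec i)) ∘L E.tail p₁) x := by
          rw [F.head_apply]
          refine Finset.sum_congr rfl fun i _ => ?_
          simp [hx1]
        rw [e2]
        calc _ ≤ ∑ i ∈ Finset.range q,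
              ‖((F.coord i ∘L T).smulRight (F.vec i)) ∘L E.tail p₁‖ := by
              refine (norm_sum_le _ _).trans (Finset.sum_le_sum fun i _ => ?_)
              refine (ContinuousLinearMap.le_opNorm _ _).trans ?_
              exact mul_le_of_le_one_right (norm_nonneg _) hx
          _ ≤ _ := hp₁.le
      rw [e]
      refine (norm_add_le _ _).trans ?_
      linarith
  obtain ⟨s, a, h0, hs⟩ := exists_seq_of_step _ step (p, 0)
  refine ⟨fun k => (s k).1, fun k => (a k).1, fun k => (s k).2, fun k => (a k).2, by simp [h0],
    ⟨strictMono_nat_of_lt_succ fun k => (hs k).1, fun k => ?_⟩,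
    ⟨strictMono_nat_of_lt_succ fun k => (hs k).2.1, fun k => ?_⟩, fun k => ?_⟩
  · exact ⟨(hs k).2.2.2.2.1, (hs k).2.2.2.2.2.1⟩
  · exact ⟨(hs k).2.2.2.2.2.2.1, (hs k).2.2.2.2.2.2.2.1⟩
  · exact ⟨(hs k).2.2.1, (hs k).2.2.2.1, (hs k).2.2.2.2.2.2.2.2⟩

/-- Blocks on which `f` is large are rotated by unimodular scalars. The values then add up without
cancellation. -/
theorem exists_blockSeq_functional (f : StrongDual 𝕜 X) {τ : ℝ} (hτ : 0 ≤ τ)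
    (h : ∀ n, τ < ‖f ∘L E.tail n‖) (p : ℕ) :
    ∃ n u, n 0 = p ∧ E.IsBlockSeq n u ∧ ∀ k, ‖u k‖ ≤ 1 ∧ ∃ t : ℝ, τ < t ∧ f (u k) = t := by
  obtain ⟨n, u, h0, hu, hk⟩ := exists_blockSeq f h p
  have hne : ∀ k, f (u k) ≠ 0 := fun k hk0 => by
    have := (hk k).2
    rw [hk0, norm_zero] at this
    linarith
  let c : ℕ → 𝕜 := fun k => (‖f (u k)‖ : 𝕜) / f (u k)
  have hc : ∀ k, ‖c k‖ = 1 := fun k => by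
    simp only [c, norm_div, RCLike.norm_ofReal, abs_norm]
    exact div_self (norm_ne_zero_iff.2 (hne k))
  refine ⟨n, fun k => c k • u k, h0, ⟨hu.1, fun k => ?_⟩, fun k => ⟨?_, ‖f (u k)‖, (hk k).2, ?_⟩⟩
  · simp [(hu.2 k).1, (hu.2 k).2]
  · rw [norm_smul, hc, one_mul]; exact (hk k).1
  · rw [map_smul, smul_eq_mul]
    exact div_mul_cancel₀ _ (hne k)

/-! ### Comparing block sums in the domain and in the range. -/

theorem not_rpow_le {α α' c D : ℝ} (hα : 0 ≤ α) (hα' : α < α') (hc : 0 < c)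
    (h : ∀ N : ℕ, c * (N : ℝ) ^ α' ≤ D * (N : ℝ) ^ α + D) : False := by
  have hlim : Tendsto (fun N : ℕ => (N : ℝ) ^ (α' - α)) atTop atTop :=
    (tendsto_rpow_atTop (sub_pos.2 hα')).comp tendsto_natCast_atTop_atTop
  obtain ⟨N, hN, hN1⟩ := ((hlim.eventually_gt_atTop (2 * |D| / c)).and
    (eventually_ge_atTop 1)).exists
  have hN0 : (1 : ℝ) ≤ N := by exact_mod_cast hN1
  have h1 : (N : ℝ) ^ α' = (N : ℝ) ^ (α' - α) * (N : ℝ) ^ α := by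
    rw [← Real.rpow_add (by linarith)]; ring_nf
  have h2 : 1 ≤ (N : ℝ) ^ α := Real.one_le_rpow hN0 hα
  have h3 := h N
  rw [div_lt_iff₀ hc] at hN
  rw [h1] at h3
  have h4 := le_abs_self D
  nlinarith [abs_nonneg D, mul_le_mul_of_nonneg_right h4 (zero_le_one.trans h2)]

/-- A functional that is not small on tails is at least `L / 2` on each term of a block sequence, so
it grows linearly on sums of `N` blocks, while their norms grow only like `N ^ α` with `α < 1`. -/
theorem shrinking_of_upperEstimate {α C : ℝ} (hα : 0 ≤ α) (hα1 : α < 1)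
    (h : E.UpperEstimate α C) : E.Shrinking := by
  intro f
  by_contra hf
  obtain ⟨L, hL, hL1, -⟩ := exists_limit_of_not_tendsto f hf
  obtain ⟨n, u, -, hu, hk⟩ := exists_blockSeq_functional (E := E) f (half_pos hL).le
    (fun n => (half_lt_self hL).trans_le (hL1 n)) 0
  choose t ht hft using fun k => (hk k).2
  refine not_rpow_le (D := ‖f‖ * C) (c := L / 2) hα hα1 (half_pos hL) fun N => ?_
  have h1 := h n u hu (fun k => (hk k).1) N
  have h2 : f (∑ k ∈ Finset.range N, u (N + k)) = ((∑ k ∈ Finset.range N, t (N + k) : ℝ) : 𝕜) := by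
    rw [map_sum]; push_cast
    exact Finset.sum_congr rfl fun k _ => hft _
  have hC : 0 ≤ C := by
    have := (norm_nonneg _).trans (h n u hu (fun k => (hk k).1) 1)
    simpa using this
  have h3 : L / 2 * N ≤ ∑ k ∈ Finset.range N, t (N + k) := by
    calc L / 2 * N = ∑ k ∈ Finset.range N, L / 2 := by simp [mul_comm]
      _ ≤ _ := Finset.sum_le_sum fun k _ => (ht _).le
  have h4 : ∑ k ∈ Finset.range N, t (N + k) ≤ ‖f‖ * (C * (N : ℝ) ^ α) := by
    refine le_trans ?_ ((f.le_opNorm _).trans (mul_le_mul_of_nonneg_left h1 (norm_nonneg f)))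
    rw [h2, RCLike.norm_ofReal]
    exact le_abs_self _
  rw [Real.rpow_one]
  have : 0 ≤ ‖f‖ * C := by positivity
  nlinarith

/-- This covers exponent 1, where growth rates give nothing. On far blocks `f` takes values close to
`L`, hence almost `2 * L` on a block plus an average. Its norm on the tail is close to `L` too, so
the spread would have norm almost 2. -/
theorem shrinking_of_upperSpread {κ : ℝ} (hκ0 : 0 < κ) (hκ : κ < 2) (h : E.UpperSpread 1 κ) :
    E.Shrinking := by
  intro f
  by_contra hf
  obtain ⟨L, hL, hL1, hL2⟩ := exists_limit_of_not_tendsto f hf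
  -- The inequality to be contradicted is `2 * (L - ε) ≤ (L + ε) * κ`, that is `L * (2 - κ) ≤ ε * (2
  -- + κ)`. Since `2 + κ < 4`, the right side is smaller than half the left side.
  set ε := L * (2 - κ) / 8 with hε
  have hε0 : 0 < ε := by have : 0 < 2 - κ := by linarith
                         positivity
  obtain ⟨p, hp⟩ := hL2 ε hε0
  have hεL : 0 ≤ L - ε := by rw [hε]; nlinarith
  obtain ⟨n, u, hn, hu, hk⟩ := exists_blockSeq_functional (E := E) f hεL
    (fun n => (sub_lt_self L hε0).trans_le (hL1 n)) p
  choose t ht hft using fun k => (hk k).2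
  obtain ⟨N₀, hN₀⟩ := h n u hu fun k => (hk k).1
  set N := N₀ + 1
  have hN := hN₀ N (Nat.le_succ _)
  have hN1 : (0 : ℝ) < N := by positivity
  have h2 : f (spread 𝕜 1 N u) = ((t 0 + (N : ℝ)⁻¹ * ∑ k ∈ Finset.range N, t (k + 1) : ℝ) : 𝕜) := by
    rw [spread_map, spread]
    simp only [hft, smul_eq_mul]
    rw [Real.rpow_neg_one]
    push_cast
    rfl
  have h3 : (L - ε) * N ≤ ∑ k ∈ Finset.range N, t (k + 1) := by
    calc (L - ε) * N = ∑ k ∈ Finset.range N, (L - ε) := by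
            rw [Finset.sum_const, Finset.card_range, nsmul_eq_mul, mul_comm]
      _ ≤ _ := Finset.sum_le_sum fun k _ => (ht _).le
  have h4 : 2 * (L - ε) ≤ ‖f (spread 𝕜 1 N u)‖ := by
    rw [h2, RCLike.norm_ofReal]
    refine le_trans ?_ (le_abs_self _)
    have : L - ε ≤ (N : ℝ)⁻¹ * ∑ k ∈ Finset.range N, t (k + 1) := by
      rw [inv_mul_eq_div, le_div_iff₀ hN1]; exact h3
    linarith [ht 0]
  have h5 : f (spread 𝕜 1 N u) = (f ∘L E.tail p) (spread 𝕜 1 N u) := by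
    rw [ContinuousLinearMap.comp_apply, spread_map (T := E.tail p)]
    simp only [hu.tail_eq hn.ge]
  have h6 : ‖f (spread 𝕜 1 N u)‖ ≤ (L + ε) * κ := by
    rw [h5]
    refine ((f ∘L E.tail p).le_of_opNorm_le hp.le _).trans ?_
    exact mul_le_mul_of_nonneg_left hN (by linarith)
  nlinarith

/-- If `T` is not small on tails, block sums of order at most `N ^ α` are mapped, up to a bounded
error, to block sums of order at least `N ^ α'`. -/
theorem smallOnTails_of_estimates (hE : E.Shrinking) {α α' C c : ℝ} (hα : 0 ≤ α) (hα' : α < α')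
    (hc : 0 < c) (h : E.UpperEstimate α C) (h' : F.LowerEstimate α' c) : SmallOnTails E Y := by
  intro T
  by_contra hT
  obtain ⟨L, hL, hL1, -⟩ := exists_limit_of_not_tendsto T hT
  -- Each error is at most `L / 4` while `T (u k)` has norm more than `L / 2`, so `‖v k‖ ≥ L / 4`.
  -- The errors add up to at most `L / 2`.
  obtain ⟨n, u, m, v, -, hu, hv, hk⟩ := exists_blockSeq_image F hE T
    (fun n => (half_lt_self hL).trans_le (hL1 n)) 0 (fun k => L / 4 * (1 / 2) ^ k)
    (fun k => by positivity)
  have hvk : ∀ k, L / 4 ≤ ‖v k‖ := by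
    intro k
    have h1 := (hk k).2.1
    have h2 := (hk k).2.2
    have h3 : ‖T (u k)‖ ≤ ‖T (u k) - v k‖ + ‖v k‖ := by
      simpa using norm_add_le (T (u k) - v k) (v k)
    have h4 : (1 / 2 : ℝ) ^ k ≤ 1 := pow_le_one₀ (by norm_num) (by norm_num)
    nlinarith
  set a : 𝕜 := ((4 / L : ℝ) : 𝕜) with ha
  have hna : ‖a‖ = 4 / L := by rw [ha, RCLike.norm_ofReal, abs_of_pos (by positivity)]
  have hC : 0 ≤ C := by
    have := (norm_nonneg _).trans (h n u hu (fun k => (hk k).1) 1)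
    simpa using this
  refine not_rpow_le (D := 4 / L * (‖T‖ * C) + 2) (c := c) hα hα' hc fun N => ?_
  have h1 := h' m _ (hv.smul a) (fun k => by
    rw [norm_smul, hna, div_mul_eq_mul_div, one_le_div hL]
    linarith [hvk k]) N
  rw [← Finset.smul_sum, norm_smul, hna] at h1
  have h2 := h n u hu (fun k => (hk k).1) N
  have h3 : ‖∑ k ∈ Finset.range N, v (N + k)‖ ≤ ‖T‖ * (C * (N : ℝ) ^ α) + L / 2 := by
    have e : ∑ k ∈ Finset.range N, v (N + k) = T (∑ k ∈ Finset.range N, u (N + k)) -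
        ∑ k ∈ Finset.range N, (T (u (N + k)) - v (N + k)) := by
      rw [map_sum, Finset.sum_sub_distrib]; abel
    rw [e]
    refine (norm_sub_le _ _).trans (add_le_add ((T.le_opNorm _).trans
      (mul_le_mul_of_nonneg_left h2 (norm_nonneg _))) ?_)
    calc _ ≤ ∑ k ∈ Finset.range N, L / 4 * (1 / 2) ^ k := by
          refine (norm_sum_le _ _).trans (Finset.sum_le_sum fun k _ => ?_)
          refine (hk _).2.2.trans ?_
          refine mul_le_mul_of_nonneg_left ?_ (by positivity)
          exact pow_le_pow_of_le_one (by norm_num) (by norm_num) (Nat.le_add_left _ _)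
      _ ≤ _ := by
          rw [← Finset.mul_sum]
          nlinarith [sum_geometric_two_le N]
  refine h1.trans ((mul_le_mul_of_nonneg_left h3 (by positivity)).trans ?_)
  have e2 : 4 / L * (‖T‖ * (C * (N : ℝ) ^ α) + L / 2) =
      4 / L * (‖T‖ * C) * (N : ℝ) ^ α + 2 := by field_simp; ring
  rw [e2]
  have h5 : 0 ≤ (N : ℝ) ^ α := by positivity
  have h6 : 0 ≤ 4 / L * (‖T‖ * C) := by positivity
  nlinarith

/-- On a far tail `T` has norm close to its limit `L`, and blocks nearly attain it. The image of a
spread of norm at most `κ` has norm at most about `L * κ`, yet it is nearly a spread of blocks of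
norm about `L`, hence at least about `L * κ'`. -/
theorem smallOnTails_of_spread (hE : E.Shrinking) {α κ κ' : ℝ} (hα : 0 ≤ α) (hκ : 0 ≤ κ)
    (hκ' : κ < κ') (h : E.UpperSpread α κ) (h' : F.LowerSpread α κ') : SmallOnTails E Y := by
  intro T
  by_contra hT
  obtain ⟨L, hL, hL1, hL2⟩ := exists_limit_of_not_tendsto T hT
  -- The final inequality is `κ' * (1 - 2 * ε) ≤ (1 + ε) * κ + 2 * ε`, that is `κ' - κ ≤ ε * (2 * κ'
  -- + κ + 2)`. With this `ε` the right side is half of `κ' - κ`.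
  set ε := (κ' - κ) / (2 * (2 * κ' + κ + 2)) with hε
  have hε0 : 0 < ε := div_pos (by linarith) (by linarith)
  have hε1 : ε * (2 * κ' + κ + 2) = (κ' - κ) / 2 := by
    have h0 : ε * (2 * (2 * κ' + κ + 2)) = κ' - κ :=
      div_mul_cancel₀ _ (by linarith : (2 * (2 * κ' + κ + 2)) ≠ 0)
    linarith
  have hε2 : ε < 1 / 2 := by
    rw [hε, div_lt_iff₀ (by linarith)]; linarith
  obtain ⟨p, hp⟩ := hL2 (ε * L) (by positivity)
  obtain ⟨n, u, m, v, hn, hu, hv, hk⟩ := exists_blockSeq_image F hE T (τ := (1 - ε) * L)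
    (fun n => lt_of_lt_of_le (by nlinarith) (hL1 n)) p (fun k => ε * L * (1 / 2) ^ k)
    (fun k => by positivity)
  have hδ : 0 < (1 - 2 * ε) * L := mul_pos (by linarith) hL
  have hvk : ∀ k, (1 - 2 * ε) * L ≤ ‖v k‖ := by
    intro k
    have h1 := (hk k).2.1
    have h2 := (hk k).2.2
    have h3 : ‖T (u k)‖ ≤ ‖T (u k) - v k‖ + ‖v k‖ := by
      simpa using norm_add_le (T (u k) - v k) (v k)
    have h4 : (1 / 2 : ℝ) ^ k ≤ 1 := pow_le_one₀ (by norm_num) (by norm_num)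
    have h5 : 0 < ε * L := by positivity
    nlinarith
  set a : 𝕜 := ((((1 - 2 * ε) * L)⁻¹ : ℝ) : 𝕜) with ha
  have hna : ‖a‖ = ((1 - 2 * ε) * L)⁻¹ := by
    rw [ha, RCLike.norm_ofReal, abs_of_pos (by positivity)]
  obtain ⟨N₁, hN₁⟩ := h n u hu fun k => (hk k).1
  obtain ⟨N₂, hN₂⟩ := h' m _ (hv.smul a) fun k => by
    rw [norm_smul, hna, inv_mul_eq_div, one_le_div hδ]
    exact hvk k
  set N := max N₁ N₂
  have h1 := hN₁ N (le_max_left _ _)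
  have h2 := hN₂ N (le_max_right _ _)
  rw [spread_smul, norm_smul, hna, inv_mul_eq_div, le_div_iff₀ hδ] at h2
  have h5 : T (spread 𝕜 α N u) = (T ∘L E.tail p) (spread 𝕜 α N u) := by
    rw [ContinuousLinearMap.comp_apply, spread_map (T := E.tail p)]
    simp only [hu.tail_eq hn.ge]
  have h6 : ‖T (spread 𝕜 α N u)‖ ≤ (L + ε * L) * κ := by
    rw [h5]
    refine ((T ∘L E.tail p).le_of_opNorm_le hp.le _).trans ?_
    exact mul_le_mul_of_nonneg_left h1 (by positivity)
  have h7 : ‖spread 𝕜 α N v‖ ≤ (L + ε * L) * κ + 2 * (ε * L) := by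
    have e : spread 𝕜 α N v = T (spread 𝕜 α N u) - (T (spread 𝕜 α N u) - spread 𝕜 α N v) := by
      abel
    rw [e]
    refine (norm_sub_le _ _).trans (add_le_add h6 ?_)
    rw [spread_map, spread_sub]
    refine (norm_spread_le hα _).trans ?_
    calc _ ≤ ∑ k ∈ Finset.range (N + 1), ε * L * (1 / 2) ^ k :=
          Finset.sum_le_sum fun k _ => (hk k).2.2
      _ ≤ _ := by
          rw [← Finset.mul_sum]
          nlinarith [sum_geometric_two_le (N + 1), mul_pos hε0 hL]
  have h8 : κ' * (1 - 2 * ε) * L ≤ ((1 + ε) * κ + 2 * ε) * L := by nlinarith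
  have h9 := le_of_mul_le_mul_right h8 hL
  nlinarith

end ShiftBasis

/-! ### Estimates for the Tsirelson norm -/

theorem tsirelsonAux_mono_nat (a : ℕ → ℝ≥0∞) : Monotone fun m => tsirelsonAux m a :=
  monotone_nat_of_le_succ fun _ => le_max_left _ _

theorem tsirelsonAux_le_norm (m : ℕ) (a : ℕ → ℝ≥0∞) : tsirelsonAux m a ≤ tsirelsonNorm a :=
  le_iSup (fun m => tsirelsonAux m a) m

theorem half_sum_aux_le {k : ℕ} {E : Fin k → Finset ℕ} (hE : Admissible E) (m : ℕ)
    (a : ℕ → ℝ≥0∞) :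
    2⁻¹ * ∑ j, tsirelsonAux m ((E j : Set ℕ).indicator a) ≤ tsirelsonAux (m + 1) a :=
  le_max_of_le_right (le_iSup_of_le k (le_iSup₂ (f := fun (E : Fin k → Finset ℕ)
    (_ : Admissible E) => 2⁻¹ * ∑ j, tsirelsonAux m ((E j : Set ℕ).indicator a)) E hE))

/-- The iterates increase with `m`, so the supremum passes through finite sums. The defining
inequality thus holds for the limiting norm itself, which is all that lower estimates need. -/
theorem half_sum_norm_le {k : ℕ} {E : Fin k → Finset ℕ} (hE : Admissible E) (a : ℕ → ℝ≥0∞) :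
    2⁻¹ * ∑ j, tsirelsonNorm ((E j : Set ℕ).indicator a) ≤ tsirelsonNorm a := by
  simp only [tsirelsonNorm]
  rw [ENNReal.finsetSum_iSup_of_monotone fun j => tsirelsonAux_mono_nat _, ENNReal.mul_iSup]
  exact iSup_le fun m => (half_sum_aux_le hE m a).trans (le_iSup (fun m => tsirelsonAux m a) _)

theorem tsirelsonAux_zero (m : ℕ) : tsirelsonAux m 0 = 0 := by
  have h := tsirelsonAux_mul m 0 0
  rw [zero_mul] at h
  rw [← h]
  congr 1
  ext i
  simp

theorem tsirelsonAux_sum {κ : Type*} (m : ℕ) (s : Finset κ) (a : κ → ℕ → ℝ≥0∞) :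
    tsirelsonAux m (∑ l ∈ s, a l) ≤ ∑ l ∈ s, tsirelsonAux m (a l) := by
  classical
  induction s using Finset.induction_on with
  | empty => simp [tsirelsonAux_zero]
  | insert l s hl ih =>
    rw [Finset.sum_insert hl, Finset.sum_insert hl]
    exact (tsirelsonAux_add m _ _).trans (add_le_add le_rfl ih)

theorem tsirelsonNorm_sum {κ : Type*} (s : Finset κ) (a : κ → ℕ → ℝ≥0∞) :
    tsirelsonNorm (∑ l ∈ s, a l) ≤ ∑ l ∈ s, tsirelsonNorm (a l) :=
  iSup_le fun m => (tsirelsonAux_sum m s a).trans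
    (Finset.sum_le_sum fun _ _ => tsirelsonAux_le_norm _ _)

theorem tsirelsonNorm_indicator_le (s : Set ℕ) (a : ℕ → ℝ≥0∞) :
    tsirelsonNorm (s.indicator a) ≤ tsirelsonNorm a :=
  tsirelsonNorm_mono (Set.indicator_le_self s a)

/-! ### Comparison with the supremum norm and the `ℓ_1` norm. -/

theorem sum_indicator_le {k : ℕ} {E : Fin k → Finset ℕ} (hE : Admissible E) (a : ℕ → ℝ≥0∞)
    (i : ℕ) : ∑ j, (E j : Set ℕ).indicator a i ≤ a i := by
  by_cases h : ∃ j, i ∈ E j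
  · obtain ⟨j, hj⟩ := h
    rw [Finset.sum_eq_single j]
    · exact Set.indicator_le_self _ _ _
    · intro l _ hl
      refine Set.indicator_of_notMem (fun hil => ?_) _
      rcases lt_or_gt_of_ne hl with h | h
      · exact lt_irrefl _ (hE.2 l j h i hil i hj)
      · exact lt_irrefl _ (hE.2 j l h i hj i hil)
    · simp
  · push Not at h
    rw [Finset.sum_eq_zero]
    · exact zero_le
    · exact fun j _ => Set.indicator_of_notMem (h j) _

/-- The sets of an admissible family are disjoint and each piece is bounded by its `ℓ_1` norm, so
any splitting costs a factor `1 / 2` of the full `ℓ_1` norm. -/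
theorem tsirelsonAux_le_max (m : ℕ) (a : ℕ → ℝ≥0∞) :
    tsirelsonAux m a ≤ max (⨆ i, a i) (2⁻¹ * ∑' i, a i) := by
  induction m generalizing a with
  | zero => exact le_max_left _ _
  | succ m ih =>
    refine max_le (ih a) (le_max_of_le_right ?_)
    refine iSup_le fun k => iSup_le fun E => iSup_le fun hE => ?_
    gcongr
    calc ∑ j, tsirelsonAux m ((E j : Set ℕ).indicator a)
        ≤ ∑ j, ∑' i, (E j : Set ℕ).indicator a i := by
          refine Finset.sum_le_sum fun j _ => (ih _).trans (max_le ?_ ?_)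
          · exact iSup_le fun i => ENNReal.le_tsum i
          · refine mul_le_of_le_one_left zero_le ?_
            simp
      _ = ∑' i, ∑ j, (E j : Set ℕ).indicator a i :=
          (Summable.tsum_finsetSum fun _ _ => ENNReal.summable).symm
      _ ≤ ∑' i, a i := ENNReal.tsum_le_tsum (sum_indicator_le hE a)

theorem tsirelsonAux_le_tsum (m : ℕ) (a : ℕ → ℝ≥0∞) : tsirelsonAux m a ≤ ∑' i, a i := by
  refine (tsirelsonAux_le_max m a).trans (max_le (iSup_le fun i => ENNReal.le_tsum i) ?_)
  exact mul_le_of_le_one_left zero_le (by simp)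

/-- At most `l` points beyond `l` form an admissible family of singletons. With
`tsirelsonAux_le_max`, the norm of a sequence supported on such a set is exactly the larger of its
supremum and half its `ℓ_1` norm. -/
theorem half_sum_le_of_card_le (E : Finset ℕ) {l : ℕ} (hc : E.card ≤ l)
    (hl : ∀ i ∈ E, l ≤ i + 1) (a : ℕ → ℝ≥0∞) : 2⁻¹ * ∑ i ∈ E, a i ≤ tsirelsonNorm a := by
  let e := E.orderEmbOfFin rfl
  have hadm : Admissible fun j : Fin E.card => ({e j} : Finset ℕ) := by
    refine ⟨fun j i hi => ?_, fun j l hjl i hi i' hi' => ?_⟩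
    · rw [Finset.mem_singleton.1 hi]
      exact hc.trans (hl _ (E.orderEmbOfFin_mem rfl j))
    · rw [Finset.mem_singleton.1 hi, Finset.mem_singleton.1 hi']
      exact e.strictMono hjl
  refine le_trans ?_ (half_sum_norm_le hadm a)
  gcongr
  have h1 : ∑ i ∈ E, a i = ∑ j : Fin E.card, a (e j) := by
    conv_lhs => rw [← E.image_orderEmbOfFin_univ rfl]
    rw [Finset.sum_image fun x _ y _ h => e.injective h]
  rw [h1]
  refine Finset.sum_le_sum fun j _ => ?_
  refine le_trans ?_ (le_tsirelsonNorm _ (e j))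
  simp

/-- Suprema of continuous functions of finitely many earlier iterates. This yields the Fatou
property used for completeness. -/
theorem lowerSemicontinuous_tsirelsonAux (m : ℕ) : LowerSemicontinuous (tsirelsonAux m) := by
  induction m with
  | zero => exact lowerSemicontinuous_iSup fun i => (continuous_apply i).lowerSemicontinuous
  | succ m ih =>
    refine LowerSemicontinuous.sup ih ?_
    refine lowerSemicontinuous_iSup fun k => lowerSemicontinuous_iSup fun E =>
      lowerSemicontinuous_iSup fun _ => ?_
    have hmono : Monotone fun x : ℝ≥0∞ => 2⁻¹ * x := fun x y h => by
      change 2⁻¹ * x ≤ 2⁻¹ * y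
      gcongr
    refine (ENNReal.continuous_const_mul (by simp)).comp_lowerSemicontinuous ?_ hmono
    refine lowerSemicontinuous_sum fun j _ => ?_
    refine LowerSemicontinuous.comp ih (continuous_pi fun i => ?_)
    by_cases h : i ∈ (E j : Set ℕ)
    · simpa [h] using continuous_apply i
    · simpa [h] using continuous_const

theorem lowerSemicontinuous_tsirelsonNorm : LowerSemicontinuous tsirelsonNorm :=
  lowerSemicontinuous_iSup lowerSemicontinuous_tsirelsonAux

theorem tsirelsonNorm_le_of_tendsto {a : ℕ → ℕ → ℝ≥0∞} {b : ℕ → ℝ≥0∞}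
    (h : ∀ i, Tendsto (fun n => a n i) atTop (𝓝 (b i))) {C : ℝ≥0∞}
    (hC : ∀ᶠ n in atTop, tsirelsonNorm (a n) ≤ C) : tsirelsonNorm b ≤ C :=
  (lowerSemicontinuous_tsirelsonNorm.isClosed_preimage C).mem_of_tendsto (tendsto_pi_nhds.2 h) hC

/-! #### Averages of blocks -/

section Blocks

variable {n : ℕ → ℕ} {w : ℕ → ℕ → ℝ≥0∞}

/-- A block met by two sets of the family is assigned the earlier of these sets. Two blocks cannot
share it: the first of them is also met by a later set, so it would extend beyond a point of the
second. -/
theorem card_le_of_touching (hn : StrictMono n) (hw : ∀ k i, w k i ≠ 0 → n k ≤ i ∧ i < n (k + 1))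
    {k : ℕ} {E : Fin k → Finset ℕ} (hE : Admissible E) (s : Finset ℕ)
    (hs : ∀ l ∈ s, ∃ j j', j < j' ∧ (∃ i ∈ E j, w l i ≠ 0) ∧ ∃ i ∈ E j', w l i ≠ 0) :
    s.card ≤ k := by
  rcases s.eq_empty_or_nonempty with rfl | ⟨l₀, hl₀⟩
  · simp
  have : Nonempty (Fin k) := ⟨(hs l₀ hl₀).choose⟩
  choose! f g hfg h1 h2 using hs
  have hinj : ∀ l ∈ s, ∀ l' ∈ s, l < l' → f l ≠ f l' := by
    intro l hl l' hl' hll hf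
    obtain ⟨i, hi, hwi⟩ := h2 l hl
    obtain ⟨i', hi', hwi'⟩ := h1 l' hl'
    have h3 := hE.2 (f l) (g l) (hfg l hl) i' (hf ▸ hi') i hi
    have h4 := (hw _ _ hwi).2
    have h5 := (hw _ _ hwi').1
    have h6 := hn.monotone (Nat.succ_le_of_lt hll)
    have h7 : n (l + 1) ≤ n l' := h6
    omega
  have := Finset.card_le_card_of_injOn (s := s) (t := (Finset.univ : Finset (Fin k))) f
    (fun _ _ => Finset.mem_coe.2 (Finset.mem_univ _)) (fun l hl l' hl' h => by
      by_contra hne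
      rcases lt_or_gt_of_ne hne with h' | h'
      · exact hinj l hl l' hl' h' h
      · exact hinj l' hl' l hl h' h.symm)
  simpa using this

theorem tsirelsonNorm_average_le (hw : ∀ k, tsirelsonNorm (w k) ≤ 1) (N : ℕ) :
    tsirelsonNorm (fun i => (N : ℝ≥0∞)⁻¹ * ∑ k ∈ Finset.range N, w (k + 1) i) ≤ 1 := by
  rw [tsirelsonNorm_mul]
  have h1 : tsirelsonNorm (fun i => ∑ k ∈ Finset.range N, w (k + 1) i) ≤ N := by
    have := tsirelsonNorm_sum (Finset.range N) (fun k => w (k + 1))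
    have h2 : (∑ k ∈ Finset.range N, w (k + 1)) =
        fun i => ∑ k ∈ Finset.range N, w (k + 1) i := by ext i; simp
    rw [h2] at this
    refine this.trans ((Finset.sum_le_sum fun k _ => hw _).trans ?_)
    simp
  calc _ ≤ (N : ℝ≥0∞)⁻¹ * N := by gcongr
    _ ≤ 1 := ENNReal.inv_mul_le_one _

/-- An admissible family with more than `n 1` sets lies beyond the first block and sees only the
average, of norm at most 1. A family with at most `n 1 ≤ N / 2` sets splits at most half of the
averaged blocks. Split blocks contribute at most 1 and the others at most `1 / 2`, since only one
set meets them. So the average contributes at most `3 / 4`, and the first block at most 1. What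
matters is that `7 / 4 < 2`. -/
theorem tsirelsonNorm_spread_le (hn : StrictMono n)
    (hw : ∀ k i, w k i ≠ 0 → n k ≤ i ∧ i < n (k + 1)) (hw1 : ∀ k, tsirelsonNorm (w k) ≤ 1)
    {N : ℕ} (hN0 : 0 < N) (hN : 2 * n 1 ≤ N) :
    tsirelsonNorm (fun i => w 0 i + (N : ℝ≥0∞)⁻¹ * ∑ k ∈ Finset.range N, w (k + 1) i) ≤
      7 / 4 := by
  set y : ℕ → ℝ≥0∞ := fun i => (N : ℝ≥0∞)⁻¹ * ∑ k ∈ Finset.range N, w (k + 1) i with hy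
  set x : ℕ → ℝ≥0∞ := fun i => w 0 i + y i with hx
  have hy1 : tsirelsonNorm y ≤ 1 := tsirelsonNorm_average_le hw1 N
  have h74 : (1 : ℝ≥0∞) ≤ 7 / 4 := by
    rw [ENNReal.le_div_iff_mul_le (by simp) (by simp)]; norm_num
  have hNne : (N : ℝ≥0∞) ≠ 0 := by exact_mod_cast hN0.ne'
  have hNtop : (N : ℝ≥0∞) ≠ ∞ := ENNReal.natCast_ne_top N
  have hw0 : ∀ i, n 1 ≤ i → w 0 i = 0 := fun i hi => by
    by_contra h
    exact absurd (hw 0 i h).2 (not_lt.2 hi)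
  refine iSup_le fun m => ?_
  induction m with
  | zero =>
    refine iSup_le fun i => ?_
    rcases lt_or_ge i (n 1) with hi | hi
    · have hyi : y i = 0 := by
        rw [hy]
        simp only [mul_eq_zero]
        right
        refine Finset.sum_eq_zero fun k _ => ?_
        by_contra h
        have h1 := (hw _ i h).1
        have h2 := hn.monotone (Nat.succ_le_succ (Nat.zero_le k))
        have h3 : n 1 ≤ n (k + 1) := h2
        omega
      simp only [hx, hyi, add_zero]
      exact ((le_tsirelsonNorm _ i).trans (hw1 0)).trans h74
    · simp only [hx, hw0 i hi, zero_add]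
      exact ((le_tsirelsonNorm _ i).trans hy1).trans h74
  | succ m ih =>
    refine max_le ih (iSup_le fun k => iSup_le fun E => iSup_le fun hE => ?_)
    -- Index `i` stands for the integer `i + 1`, so `k > n 1` and `k ≤ i + 1` give `n 1 ≤ i`, where
    -- the first block vanishes.
    rcases lt_or_ge (n 1) k with hk | hk
    · have e : ∀ j, (E j : Set ℕ).indicator x = (E j : Set ℕ).indicator y := by
        intro j
        ext i
        by_cases hi : i ∈ E j
        · have := hE.1 j i hi
          simp [hi, hx, hw0 i (by omega)]
        · simp [hi]
      simp only [e]
      exact ((half_sum_aux_le hE m y).trans (tsirelsonAux_le_norm _ _)).trans (hy1.trans h74)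
    · have hsub : ∀ j, tsirelsonAux m ((E j : Set ℕ).indicator x) ≤
          tsirelsonAux m ((E j : Set ℕ).indicator (w 0)) + (N : ℝ≥0∞)⁻¹ *
            ∑ l ∈ Finset.range N, tsirelsonAux m ((E j : Set ℕ).indicator (w (l + 1))) := by
        intro j
        have e : (E j : Set ℕ).indicator x = (E j : Set ℕ).indicator (w 0) +
            fun i => (N : ℝ≥0∞)⁻¹ *
              (∑ l ∈ Finset.range N, (E j : Set ℕ).indicator (w (l + 1))) i := by
          ext i
          by_cases hi : i ∈ E j <;> simp [hi, hx, hy]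
        rw [e]
        refine (tsirelsonAux_add m _ _).trans ?_
        rw [tsirelsonAux_mul]
        gcongr
        exact tsirelsonAux_sum m _ _
      classical
      let bad : Finset ℕ := (Finset.range N).filter fun l =>
        ∃ j j', j < j' ∧ (∃ i ∈ E j, w (l + 1) i ≠ 0) ∧ ∃ i ∈ E j', w (l + 1) i ≠ 0
      have hbad : bad.card ≤ k := by
        have := card_le_of_touching hn hw hE (bad.image (· + 1)) (fun l hl => by
          obtain ⟨l', hl', rfl⟩ := Finset.mem_image.1 hl
          exact (Finset.mem_filter.1 hl').2)
        rwa [Finset.card_image_of_injective _ (add_left_injective 1)] at this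
      have hone : ∀ l, 2⁻¹ * ∑ j, tsirelsonAux m ((E j : Set ℕ).indicator (w l)) ≤ 1 := fun l =>
        ((half_sum_aux_le hE m _).trans (tsirelsonAux_le_norm _ _)).trans (hw1 l)
      have hgood : ∀ l ∈ Finset.range N, l ∉ bad →
          2⁻¹ * ∑ j, tsirelsonAux m ((E j : Set ℕ).indicator (w (l + 1))) ≤ 2⁻¹ := by
        intro l hl hlb
        have hz : ∀ j, (¬ ∃ i ∈ E j, w (l + 1) i ≠ 0) →
            tsirelsonAux m ((E j : Set ℕ).indicator (w (l + 1))) = 0 := by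
          intro j hj
          have : (E j : Set ℕ).indicator (w (l + 1)) = 0 := by
            ext i
            by_cases hi : i ∈ E j
            · by_contra h
              exact hj ⟨i, hi, by simpa [hi] using h⟩
            · simp [hi]
          rw [this, tsirelsonAux_zero]
        have hle : ∑ j, tsirelsonAux m ((E j : Set ℕ).indicator (w (l + 1))) ≤ 1 := by
          by_cases hex : ∃ j, ∃ i ∈ E j, w (l + 1) i ≠ 0
          · obtain ⟨j, hj⟩ := hex
            rw [Finset.sum_eq_single j]
            · exact (tsirelsonAux_le_norm _ _).trans
                ((tsirelsonNorm_indicator_le _ _).trans (hw1 _))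
            · intro j' _ hj'
              refine hz j' fun h => hlb (Finset.mem_filter.2 ⟨hl, ?_⟩)
              rcases lt_or_gt_of_ne hj' with h' | h'
              · exact ⟨j', j, h', h, hj⟩
              · exact ⟨j, j', h', hj, h⟩
            · simp
          · rw [Finset.sum_eq_zero]
            · exact zero_le
            · exact fun j _ => hz j fun h => hex ⟨j, h⟩
        calc _ ≤ (2⁻¹ : ℝ≥0∞) * 1 := by gcongr
          _ = _ := mul_one _
      have hsum : ∑ l ∈ Finset.range N,
          (2⁻¹ * ∑ j, tsirelsonAux m ((E j : Set ℕ).indicator (w (l + 1)))) ≤ 3 / 4 * N := by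
        calc _ ≤ ∑ l ∈ Finset.range N, ((2⁻¹ : ℝ≥0∞) + if l ∈ bad then 2⁻¹ else 0) := by
              refine Finset.sum_le_sum fun l hl => ?_
              by_cases hlb : l ∈ bad
              · rw [if_pos hlb, ENNReal.inv_two_add_inv_two]; exact hone _
              · rw [if_neg hlb, add_zero]; exact hgood l hl hlb
          _ = 2⁻¹ * N + 2⁻¹ * bad.card := by
              rw [Finset.sum_add_distrib, Finset.sum_const, ← Finset.sum_filter,
                Finset.filter_mem_eq_inter, Finset.inter_eq_right.2 (Finset.filter_subset _ _),
                Finset.sum_const, Finset.card_range, nsmul_eq_mul, nsmul_eq_mul, mul_comm,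
                mul_comm (bad.card : ℝ≥0∞)]
          -- `bad.card ≤ k ≤ n 1 ≤ N / 2`.
          _ ≤ 2⁻¹ * N + 2⁻¹ * (2⁻¹ * N) := by
              gcongr
              rw [← ENNReal.div_eq_inv_mul, ENNReal.le_div_iff_mul_le (by simp) (by simp)]
              have : bad.card * 2 ≤ N := by omega
              exact_mod_cast this
          _ = 3 / 4 * N := by
              rw [← mul_assoc, ← add_mul]
              congr 1
              have h4 : (2⁻¹ : ℝ≥0∞) * 2⁻¹ ≠ ∞ := ENNReal.mul_ne_top (by simp) (by simp)
              rw [← ENNReal.toReal_eq_toReal_iff' (ENNReal.add_ne_top.2 ⟨by simp, h4⟩)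
                (by finiteness), ENNReal.toReal_add (by simp) h4]
              simp
              norm_num
      calc 2⁻¹ * ∑ j, tsirelsonAux m ((E j : Set ℕ).indicator x)
          ≤ 2⁻¹ * ∑ j, (tsirelsonAux m ((E j : Set ℕ).indicator (w 0)) + (N : ℝ≥0∞)⁻¹ *
            ∑ l ∈ Finset.range N, tsirelsonAux m ((E j : Set ℕ).indicator (w (l + 1)))) := by
            gcongr with j
            exact hsub j
        _ = 2⁻¹ * ∑ j, tsirelsonAux m ((E j : Set ℕ).indicator (w 0)) + (N : ℝ≥0∞)⁻¹ *
            ∑ l ∈ Finset.range N,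
              (2⁻¹ * ∑ j, tsirelsonAux m ((E j : Set ℕ).indicator (w (l + 1)))) := by
            rw [Finset.sum_add_distrib, mul_add, ← Finset.mul_sum, ← Finset.mul_sum,
              Finset.sum_comm, mul_left_comm]
        _ ≤ 1 + (N : ℝ≥0∞)⁻¹ * (3 / 4 * N) := by
            gcongr
            exact hone 0
        _ = 1 + 3 / 4 := by
            rw [mul_left_comm, ENNReal.inv_mul_cancel hNne hNtop, mul_one]
        _ ≤ 7 / 4 := by
            rw [← ENNReal.toReal_le_toReal (by finiteness) (by finiteness),
              ENNReal.toReal_add (by simp) (by finiteness)]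
            simp
            norm_num

end Blocks

/-! #### The shifts and the Tsirelson norm -/

/-- The left shift decreases the Tsirelson norm. -/
theorem tsirelsonNorm_leftShift_le (a : ℕ → ℝ≥0∞) :
    tsirelsonNorm (fun i => a (i + 1)) ≤ tsirelsonNorm a := by
  suffices h : ∀ m (a : ℕ → ℝ≥0∞), tsirelsonAux m (fun i => a (i + 1)) ≤ tsirelsonAux m a from
    iSup_mono fun m => h m a
  intro m
  induction m with
  | zero => exact fun a => iSup_le fun i => le_iSup a (i + 1)
  | succ m ih =>
    intro a
    refine max_le ((ih a).trans (le_max_left _ _)) ?_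
    refine iSup_le fun k => iSup_le fun E => iSup_le fun hE => ?_
    have hE' : Admissible fun j => (E j).map (addRightEmbedding 1) := by
      refine ⟨fun j i hi => ?_, fun j l hjl i hi i' hi' => ?_⟩
      · obtain ⟨x, hx, rfl⟩ := Finset.mem_map.1 hi
        exact (hE.1 j x hx).trans (Nat.le_succ _)
      · obtain ⟨x, hx, rfl⟩ := Finset.mem_map.1 hi
        obtain ⟨x', hx', rfl⟩ := Finset.mem_map.1 hi'
        exact Nat.succ_lt_succ (hE.2 j l hjl x hx x' hx')
    refine le_trans ?_ (half_sum_aux_le hE' m a)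
    gcongr with j
    refine le_trans (le_of_eq ?_) (ih _)
    congr 1
    ext i
    by_cases hi : i ∈ E j <;> simp [hi]

/-- The right shift of a sequence. -/
def rightShift {M : Type*} [Zero M] (a : ℕ → M) : ℕ → M
  | 0 => 0
  | i + 1 => a i

theorem tsum_rightShift (a : ℕ → ℝ≥0∞) : ∑' i, rightShift a i = ∑' i, a i := by
  rw [tsum_eq_zero_add' ENNReal.summable]
  simp [rightShift]

theorem iSup_rightShift_le (a : ℕ → ℝ≥0∞) : ⨆ i, rightShift a i ≤ ⨆ i, a i := by
  refine iSup_le fun i => ?_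
  cases i with
  | zero => exact zero_le
  | succ i => exact le_iSup a i

theorem rightShift_add (a b : ℕ → ℝ≥0∞) : rightShift (a + b) = rightShift a + rightShift b := by
  ext i
  cases i <;> simp [rightShift]

/-- `E`, shifted to the left by one. -/
noncomputable def shiftSet (E : Finset ℕ) : Finset ℕ :=
  E.preimage (· + 1) (add_left_injective 1).injOn

theorem mem_shiftSet {E : Finset ℕ} {i : ℕ} : i ∈ shiftSet E ↔ i + 1 ∈ E := by
  simp [shiftSet]

theorem indicator_rightShift (E : Finset ℕ) (a : ℕ → ℝ≥0∞) :
    (E : Set ℕ).indicator (rightShift a) = rightShift ((shiftSet E : Set ℕ).indicator a) := by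
  ext i
  cases i with
  | zero => simp [rightShift, Set.indicator_apply]
  | succ i => simp [rightShift, Set.indicator_apply, mem_shiftSet]

/-- On few coordinates far out the norm is the larger of the supremum and half the `ℓ_1` norm, and
the shift changes neither. -/
theorem tsirelsonAux_rightShift_le_of_card (E : Finset ℕ) {l : ℕ} (hc : E.card ≤ l)
    (hl : ∀ i ∈ E, l ≤ i + 1) (a : ℕ → ℝ≥0∞) (m : ℕ) :
    tsirelsonAux m (rightShift ((E : Set ℕ).indicator a)) ≤
      tsirelsonNorm ((E : Set ℕ).indicator a) := by
  refine (tsirelsonAux_le_max m _).trans (max_le ?_ ?_)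
  · exact (iSup_rightShift_le _).trans (iSup_le fun i => le_tsirelsonNorm _ i)
  · rw [tsum_rightShift]
    refine le_trans (le_of_eq ?_) (half_sum_le_of_card_le E hc hl _)
    congr 1
    rw [tsum_eq_sum (s := E)]
    intro i hi
    simp [hi]

/-- Arithmetic of the induction for the right shift. Dropping any one of the `l + 1` pieces leaves a
sum of at most `2 * τ`; averaging over the dropped piece bounds the full sum by `2 * (1 + 1 / l) *
τ`. One exceptional piece loses a factor `1 + 8 / l` and the others only `1 + 4 / l`, which for `l ≥
4` leaves room for this excess. -/
theorem real_shift_estimate {l : ℕ} (hl : 4 ≤ l) (s t : Fin (l + 1) → ℝ) (τ : ℝ) (hτ : 0 ≤ τ)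
    (j₀ : Fin (l + 1)) (htτ : ∀ j, t j ≤ τ)
    (h1 : ∀ j : Fin (l + 1), ∑ i, t (j.succAbove i) ≤ 2 * τ)
    (h2 : ∀ j, j ≠ j₀ → s j ≤ (1 + 4 / l) * t j) (h3 : s j₀ ≤ (1 + 8 / l) * t j₀) :
    ∑ j, s j ≤ 2 * ((1 + 8 / l) * τ) := by
  have hl0 : (0 : ℝ) < l := by positivity
  have hl4 : (4 : ℝ) ≤ l := by exact_mod_cast hl
  set M := ∑ j, t j with hM
  have hMj : ∀ j, M ≤ t j + 2 * τ := fun j => by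
    rw [hM, Fin.sum_univ_succAbove _ j]; linarith [h1 j]
  have hM2 : (l : ℝ) * M ≤ 2 * (l + 1) * τ := by
    have h4 : ∑ j : Fin (l + 1), M ≤ ∑ j, (t j + 2 * τ) := Finset.sum_le_sum fun j _ => hMj j
    rw [Finset.sum_add_distrib, Finset.sum_const, Finset.sum_const, Finset.card_univ,
      Fintype.card_fin, nsmul_eq_mul, nsmul_eq_mul, ← hM] at h4
    push_cast at h4
    nlinarith
  have hs : ∑ j, s j ≤ (1 + 4 / l) * M + 4 / l * τ := by
    have h4 : ∀ j, s j ≤ (1 + 4 / l) * t j + if j = j₀ then 4 / l * τ else 0 := by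
      intro j
      by_cases hj : j = j₀
      · subst hj
        rw [if_pos rfl]
        have h5 : (4 : ℝ) / l * t j ≤ 4 / l * τ :=
          mul_le_mul_of_nonneg_left (htτ j) (by positivity)
        have h6 : (1 + 8 / (l : ℝ)) * t j = (1 + 4 / l) * t j + 4 / l * t j := by ring
        linarith
      · rw [if_neg hj, add_zero]; exact h2 j hj
    refine (Finset.sum_le_sum fun j _ => h4 j).trans ?_
    rw [Finset.sum_add_distrib, ← Finset.mul_sum, Finset.sum_ite_eq' Finset.univ j₀,
      if_pos (Finset.mem_univ _)]
  refine hs.trans ?_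
  have hM3 : M ≤ 2 * (1 + 1 / l) * τ := by
    have : 2 * (1 + 1 / (l : ℝ)) * τ = 2 * (l + 1) * τ / l := by field_simp
    rw [this, le_div_iff₀ hl0]; linarith
  have h5 : (1 + 4 / (l : ℝ)) * M ≤ (1 + 4 / l) * (2 * (1 + 1 / l) * τ) :=
    mul_le_mul_of_nonneg_left hM3 (by positivity)
  refine (add_le_add h5 le_rfl).trans ?_
  have h6 : 2 * ((1 + 8 / (l : ℝ)) * τ) - ((1 + 4 / l) * (2 * (1 + 1 / l) * τ) + 4 / l * τ) =
      2 * τ / l * (1 - 4 / l) := by field_simp; ring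
  have h7 : 4 / (l : ℝ) ≤ 1 := (div_le_one hl0).2 hl4
  have h8 : 0 ≤ 2 * τ / l * (1 - 4 / l) := mul_nonneg (by positivity) (by linarith)
  linarith

theorem ofReal_mul_le_ofReal_mul {x y : ℝ} (h : x ≤ y) (a : ℝ≥0∞) :
    ENNReal.ofReal x * a ≤ ENNReal.ofReal y * a := by
  gcongr

/-- The right shift of a sequence that is supported far to the right has almost the same
Tsirelson norm. -/
theorem tsirelsonAux_rightShift_le (m : ℕ) {n : ℕ} (hn : 4 ≤ n) (a : ℕ → ℝ≥0∞)
    (ha : ∀ i, a i ≠ 0 → n ≤ i + 1) :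
    tsirelsonAux m (rightShift a) ≤ ENNReal.ofReal (1 + 8 / n) * tsirelsonNorm a := by
  have hφ1 : ∀ n : ℕ, (1 : ℝ≥0∞) ≤ ENNReal.ofReal (1 + 8 / n) := fun n => by
    rw [← ENNReal.ofReal_one]
    exact ENNReal.ofReal_le_ofReal (le_add_of_nonneg_right (by positivity))
  induction m generalizing n a with
  | zero =>
    refine (iSup_rightShift_le a).trans (iSup_le fun i => ?_)
    exact (le_tsirelsonNorm a i).trans (le_mul_of_one_le_left zero_le (hφ1 n))
  | succ m ih =>
    refine max_le (ih hn a ha) (iSup_le fun k => iSup_le fun E => iSup_le fun hE => ?_)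
    have hord : ∀ j j', j < j' → ∀ i ∈ shiftSet (E j), ∀ i' ∈ shiftSet (E j'), i < i' :=
      fun j j' hjj i hi i' hi' => Nat.lt_of_succ_lt_succ
        (hE.2 j j' hjj _ (mem_shiftSet.1 hi) _ (mem_shiftSet.1 hi'))
    have hmin : ∀ j, ∀ i ∈ shiftSet (E j), k ≤ i + 2 := fun j i hi =>
      hE.1 j _ (mem_shiftSet.1 hi)
    have hsupp : ∀ (S : Finset ℕ) i, (S : Set ℕ).indicator a i ≠ 0 → i ∈ S ∧ a i ≠ 0 := by
      intro S i hi
      by_cases h : i ∈ S <;> simp_all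
    simp only [indicator_rightShift]
    -- With at most `n` sets, shifting the sets back keeps them admissible on the support of `a`,
    -- since that support already starts at `n`.
    rcases le_or_gt k n with hk | hk
    · have hadm : Admissible fun j => (shiftSet (E j)).filter fun i => n ≤ i + 1 :=
        ⟨fun j i hi => hk.trans (Finset.mem_filter.1 hi).2, fun j j' hjj i hi i' hi' =>
          hord j j' hjj i (Finset.mem_filter.1 hi).1 i' (Finset.mem_filter.1 hi').1⟩
      have e : ∀ j, (shiftSet (E j) : Set ℕ).indicator a =
          (((shiftSet (E j)).filter fun i => n ≤ i + 1 : Finset ℕ) : Set ℕ).indicator a := by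
        intro j
        ext i
        by_cases hi : a i = 0
        · simp [Set.indicator_apply, hi]
        · simp [Set.indicator_apply, ha i hi]
      calc _ ≤ 2⁻¹ * ∑ j, ENNReal.ofReal (1 + 8 / n) *
            tsirelsonNorm ((shiftSet (E j) : Set ℕ).indicator a) := by
            gcongr with j
            exact ih hn _ fun i hi => ha i (hsupp _ i hi).2
        _ = ENNReal.ofReal (1 + 8 / n) * (2⁻¹ * ∑ j, tsirelsonNorm
            ((((shiftSet (E j)).filter fun i => n ≤ i + 1 : Finset ℕ) : Set ℕ).indicator a)) := by
            rw [← Finset.mul_sum, mul_left_comm]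
            simp only [e]
        _ ≤ _ := by
            gcongr
            exact half_sum_norm_le hadm a
    -- With `l + 1 > n` sets, the sets shifted back start only at `l`: there is one set too many,
    -- but any `l` of them are admissible.
    · obtain ⟨l, rfl⟩ : ∃ l, k = l + 1 := ⟨k - 1, by omega⟩
      have hnl : n ≤ l := by omega
      have hl4 : 4 ≤ l := hn.trans hnl
      have hl0 : (0 : ℝ) < l := by positivity
      by_cases hτ : tsirelsonNorm a = ∞
      · rw [hτ, ENNReal.mul_top (zero_lt_one.trans_le (hφ1 n)).ne']
        exact le_top
      set F : Fin (l + 1) → Finset ℕ := fun j => shiftSet (E j) with hF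
      have hFl : ∀ j, ∀ i ∈ F j, l ≤ i + 1 := fun j i hi => by
        have := hmin j i hi
        omega
      set t : Fin (l + 1) → ℝ≥0∞ := fun j => tsirelsonNorm ((F j : Set ℕ).indicator a) with ht
      set s : Fin (l + 1) → ℝ≥0∞ := fun j =>
        tsirelsonAux m (rightShift ((F j : Set ℕ).indicator a)) with hs
      have htτ : ∀ j, t j ≤ tsirelsonNorm a := fun j => tsirelsonNorm_indicator_le _ _
      have httop : ∀ j, t j ≠ ∞ := fun j => ne_top_of_le_ne_top hτ (htτ j)
      have hst : ∀ j, s j ≤ ENNReal.ofReal (1 + 8 / l) * t j := fun j =>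
        ih hl4 _ fun i hi => hFl j i (hsupp _ i hi).1
      have hsfin : ∀ j, s j ≠ ∞ := fun j => ne_top_of_le_ne_top
        (ENNReal.mul_ne_top ENNReal.ofReal_ne_top (httop j)) (hst j)
      have hdrop : ∀ j : Fin (l + 1), 2⁻¹ * ∑ i : Fin l, t (j.succAbove i) ≤ tsirelsonNorm a :=
        fun j => half_sum_norm_le (E := fun i => F (j.succAbove i))
          ⟨fun i x hx => hFl _ x hx, fun i i' hii x hx x' hx' =>
            hord _ _ (Fin.succAbove_lt_succAbove_iff.2 hii) x hx x' hx'⟩ a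
      -- The exceptional set is the first one with more than `l` elements. Sets with at most `l`
      -- elements lose nothing, and larger sets after it lie beyond `2 * l`, where the inductive
      -- bound is `1 + 8 / (2 * l)`.
      have hj₀ : ∃ j₀ : Fin (l + 1), ∀ j, j ≠ j₀ → s j ≤ ENNReal.ofReal (1 + 4 / l) * t j := by
        have hsmall : ∀ j, (F j).card ≤ l → s j ≤ ENNReal.ofReal (1 + 4 / l) * t j := by
          intro j hj
          refine (tsirelsonAux_rightShift_le_of_card (F j) hj (hFl j) a m).trans ?_
          refine le_mul_of_one_le_left zero_le ?_
          rw [← ENNReal.ofReal_one]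
          exact ENNReal.ofReal_le_ofReal (le_add_of_nonneg_right (by positivity))
        by_cases hex : ∃ j, l < (F j).card
        · obtain ⟨j₀, hj₀, hmin'⟩ := WellFounded.has_min (wellFounded_lt (α := Fin (l + 1)))
            {j | l < (F j).card} hex
          refine ⟨j₀, fun j hj => ?_⟩
          by_cases hc : (F j).card ≤ l
          · exact hsmall j hc
          have hlt : j₀ < j := lt_of_le_of_ne (not_lt.1 (hmin' j (not_le.1 hc))) hj.symm
          -- More than `l` integers that are all at least `l` must reach `2 * l`.
          obtain ⟨i₀, hi₀, hi₀l⟩ : ∃ i ∈ F j₀, 2 * l ≤ i + 1 := by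
            by_contra! hcon
            have hsub : F j₀ ⊆ Finset.Ico (l - 1) (2 * l - 1) := fun i hi => by
              have h1 := hFl j₀ i hi
              have h2 := hcon i hi
              rw [Finset.mem_Ico]
              omega
            have := Finset.card_le_card hsub
            rw [Nat.card_Ico] at this
            have h3 : l < (F j₀).card := hj₀
            omega
          have h2l : ∀ i, (F j : Set ℕ).indicator a i ≠ 0 → 2 * l ≤ i + 1 := fun i hi => by
            have := hord j₀ j hlt i₀ hi₀ i (hsupp _ i hi).1
            omega
          have := ih (n := 2 * l) (by omega) _ h2l
          refine this.trans (le_of_eq ?_)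
          congr 3
          push_cast
          field_simp
          norm_num
        · push Not at hex
          exact ⟨0, fun j _ => hsmall j (hex j)⟩
      obtain ⟨j₀, hj₀⟩ := hj₀
      have hreal := real_shift_estimate hl4 (fun j => (s j).toReal) (fun j => (t j).toReal)
        (tsirelsonNorm a).toReal ENNReal.toReal_nonneg j₀
        (fun j => ENNReal.toReal_mono hτ (htτ j)) (fun j => by
          have h1 := ENNReal.toReal_mono hτ (hdrop j)
          rw [ENNReal.toReal_mul, ENNReal.toReal_sum fun i _ => httop _] at h1
          rw [ENNReal.toReal_inv, ENNReal.toReal_ofNat] at h1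
          linarith)
        (fun j hj => by
          have h1 := ENNReal.toReal_mono (ENNReal.mul_ne_top ENNReal.ofReal_ne_top (httop j))
            (hj₀ j hj)
          rwa [ENNReal.toReal_mul, ENNReal.toReal_ofReal (by positivity)] at h1)
        (by
          have h1 := ENNReal.toReal_mono (ENNReal.mul_ne_top ENNReal.ofReal_ne_top (httop j₀))
            (hst j₀)
          rwa [ENNReal.toReal_mul, ENNReal.toReal_ofReal (by positivity)] at h1)
      have hfin : 2⁻¹ * ∑ j, s j ≤ ENNReal.ofReal (1 + 8 / l) * tsirelsonNorm a := by
        rw [← ENNReal.toReal_le_toReal (ENNReal.mul_ne_top (by simp)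
          (ENNReal.sum_ne_top.2 fun j _ => hsfin j))
          (ENNReal.mul_ne_top ENNReal.ofReal_ne_top hτ), ENNReal.toReal_mul, ENNReal.toReal_mul,
          ENNReal.toReal_sum fun j _ => hsfin j, ENNReal.toReal_ofReal (by positivity),
          ENNReal.toReal_inv, ENNReal.toReal_ofNat]
        linarith
      refine hfin.trans (ofReal_mul_le_ofReal_mul ?_ _)
      have : (n : ℝ) ≤ l := by exact_mod_cast hnl
      have hn0 : (0 : ℝ) < n := by positivity
      gcongr

/-- The right shift is bounded in the Tsirelson norm. -/
theorem tsirelsonNorm_rightShift_le (a : ℕ → ℝ≥0∞) :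
    tsirelsonNorm (rightShift a) ≤ 6 * tsirelsonNorm a := by
  refine iSup_le fun m => ?_
  -- The first three coordinates are estimated by the `ℓ_1` norm, with constant 3. The rest starts
  -- at the integer 4, where the constant is `1 + 8 / 4 = 3`.
  set H := Finset.range 3
  have e : a = (H : Set ℕ).indicator a + ((H : Set ℕ)ᶜ).indicator a :=
    (Set.indicator_self_add_compl _ _).symm
  have h1 : tsirelsonAux m (rightShift ((H : Set ℕ).indicator a)) ≤ 3 * tsirelsonNorm a := by
    refine (tsirelsonAux_le_tsum m _).trans ?_
    rw [tsum_rightShift, tsum_eq_sum (s := H)]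
    · calc _ ≤ ∑ i ∈ H, tsirelsonNorm a := Finset.sum_le_sum fun i _ =>
            (Set.indicator_le_self _ _ _).trans (le_tsirelsonNorm a i)
        _ = _ := by simp [H]
    · intro i hi
      exact Set.indicator_of_notMem (by simpa using hi) _
  have h2 : tsirelsonAux m (rightShift (((H : Set ℕ)ᶜ).indicator a)) ≤ 3 * tsirelsonNorm a := by
    refine (tsirelsonAux_rightShift_le m le_rfl _ fun i hi => ?_).trans ?_
    · by_contra hcon
      refine hi (Set.indicator_of_notMem ?_ _)
      simp only [H, Finset.coe_range, Set.mem_compl_iff, Set.mem_Iio, not_not]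
      omega
    · have : (1 + 8 / ((4 : ℕ) : ℝ)) = 3 := by norm_num
      rw [this, show ENNReal.ofReal 3 = 3 by simp]
      gcongr
      exact tsirelsonNorm_indicator_le _ _
  calc tsirelsonAux m (rightShift a) ≤ tsirelsonAux m (rightShift ((H : Set ℕ).indicator a)) +
        tsirelsonAux m (rightShift (((H : Set ℕ)ᶜ).indicator a)) := by
        conv_lhs => rw [e, rightShift_add]
        exact tsirelsonAux_add m _ _
    _ ≤ 3 * tsirelsonNorm a + 3 * tsirelsonNorm a := add_le_add h1 h2
    _ = 6 * tsirelsonNorm a := by rw [← add_mul]; norm_num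

namespace ShiftBasis

variable {𝕜 : Type*} [RCLike 𝕜] {X : Type*} [NormedAddCommGroup X] [NormedSpace 𝕜 X]
  (E : ShiftBasis 𝕜 X)

/-! #### Spaces with upper and lower `r`-estimates -/

/-- Upper `r`-estimate for pairs of successive blocks. -/
def IsUpper (r : ℝ) : Prop :=
  ∀ n x y, E.tail n x = 0 → E.tail n y = y → ‖x + y‖ ^ r ≤ ‖x‖ ^ r + ‖y‖ ^ r

/-- Lower `r`-estimate for pairs of successive blocks. -/
def IsLower (r : ℝ) : Prop :=
  ∀ n x y, E.tail n x = 0 → E.tail n y = y → ‖x‖ ^ r + ‖y‖ ^ r ≤ ‖x + y‖ ^ r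

/-- The norm of the sum of two successive blocks is at most the maximum of the norms. -/
def IsUpperSup : Prop :=
  ∀ n x y, E.tail n x = 0 → E.tail n y = y → ‖x + y‖ ≤ max ‖x‖ ‖y‖

/-- Lower `r`-estimate, with constant `2`, for the projections of a vector onto `N` successive
blocks supported beyond `N`. -/
def IsAsymptoticLower (r : ℝ) : Prop :=
  ∀ (n : ℕ → ℕ), StrictMono n → ∀ (N : ℕ) (x : X),
    ∑ k ∈ Finset.range N, ‖E.tail (n (N + k)) x - E.tail (n (N + k + 1)) x‖ ^ r ≤ 2 * ‖x‖ ^ r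

variable {E} {n : ℕ → ℕ} {u : ℕ → X}

theorem IsBlockSeq.shift (hu : E.IsBlockSeq n u) (j : ℕ) :
    E.IsBlockSeq (fun k => n (k + j)) (fun k => u (k + j)) :=
  ⟨fun a b h => hu.1 (by omega), fun k => by
    have := hu.2 (k + j)
    rwa [show k + j + 1 = k + 1 + j by omega] at this⟩

theorem IsBlockSeq.tail_sum (hu : E.IsBlockSeq n u) (N : ℕ) :
    E.tail (n N) (∑ k ∈ Finset.range N, u k) = 0 := by
  rw [map_sum]
  refine Finset.sum_eq_zero fun k hk => ?_
  exact E.tail_eq_zero_of_le (hu.1.monotone (Nat.succ_le_of_lt (Finset.mem_range.1 hk))) (hu.2 k).2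

theorem IsBlockSeq.tail_sum_shift (hu : E.IsBlockSeq n u) (j : ℕ) (s : Finset ℕ) :
    E.tail (n j) (∑ k ∈ s, u (k + j)) = ∑ k ∈ s, u (k + j) := by
  rw [map_sum]
  refine Finset.sum_congr rfl fun k _ => ?_
  exact E.tail_eq_self_of_le (hu.1.monotone (Nat.le_add_left _ _)) (hu.2 _).1

theorem IsUpper.norm_sum_le {r : ℝ} (hr : 0 < r) (h : E.IsUpper r) (hu : E.IsBlockSeq n u)
    (N : ℕ) : ‖∑ k ∈ Finset.range N, u k‖ ^ r ≤ ∑ k ∈ Finset.range N, ‖u k‖ ^ r := by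
  induction N with
  | zero => simp [Real.zero_rpow hr.ne']
  | succ N ih =>
    rw [Finset.sum_range_succ, Finset.sum_range_succ]
    exact (h (n N) _ _ (hu.tail_sum N) (hu.2 N).1).trans (add_le_add ih le_rfl)

theorem IsLower.le_norm_sum {r : ℝ} (hr : 0 < r) (h : E.IsLower r) (hu : E.IsBlockSeq n u)
    (N : ℕ) : ∑ k ∈ Finset.range N, ‖u k‖ ^ r ≤ ‖∑ k ∈ Finset.range N, u k‖ ^ r := by
  induction N with
  | zero => simp [Real.zero_rpow hr.ne']
  | succ N ih =>
    rw [Finset.sum_range_succ, Finset.sum_range_succ]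
    exact (add_le_add ih le_rfl).trans (h (n N) _ _ (hu.tail_sum N) (hu.2 N).1)

theorem IsUpper.norm_sum_le_rpow {r : ℝ} (hr : 0 < r) (h : E.IsUpper r) (hu : E.IsBlockSeq n u)
    (hu1 : ∀ k, ‖u k‖ ≤ 1) (N : ℕ) : ‖∑ k ∈ Finset.range N, u k‖ ^ r ≤ N := by
  refine (h.norm_sum_le hr hu N).trans ?_
  calc _ ≤ ∑ k ∈ Finset.range N, (1 : ℝ) :=
        Finset.sum_le_sum fun k _ => Real.rpow_le_one (norm_nonneg _) (hu1 k) hr.le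
    _ = N := by simp

theorem IsLower.rpow_le_norm_sum {r : ℝ} (hr : 0 < r) (h : E.IsLower r) (hu : E.IsBlockSeq n u)
    (hu1 : ∀ k, 1 ≤ ‖u k‖) (N : ℕ) : (N : ℝ) ≤ ‖∑ k ∈ Finset.range N, u k‖ ^ r := by
  refine le_trans ?_ (h.le_norm_sum hr hu N)
  calc (N : ℝ) = ∑ k ∈ Finset.range N, (1 : ℝ) := by simp
    _ ≤ _ := Finset.sum_le_sum fun k _ => Real.one_le_rpow (hu1 k) hr.le

theorem IsUpper.upperEstimate {r : ℝ} (hr : 0 < r) (h : E.IsUpper r) :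
    E.UpperEstimate r⁻¹ 1 := by
  intro n u hu hu1 N
  rw [one_mul]
  refine (Real.le_rpow_inv_iff_of_pos (norm_nonneg _) (Nat.cast_nonneg _) hr).2 ?_
  have := h.norm_sum_le_rpow hr (hu.shift N) (fun k => hu1 _) N
  simpa only [add_comm N] using this

theorem IsLower.lowerEstimate {r : ℝ} (hr : 0 < r) (h : E.IsLower r) :
    E.LowerEstimate r⁻¹ 1 := by
  intro n u hu hu1 N
  rw [one_mul]
  refine (Real.rpow_inv_le_iff_of_pos (Nat.cast_nonneg _) (norm_nonneg _) hr).2 ?_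
  have := h.rpow_le_norm_sum hr (hu.shift N) (fun k => hu1 _) N
  simpa only [add_comm N] using this

theorem norm_ofReal_rpow_neg_inv {r : ℝ} (hr : 0 < r) (N : ℕ) :
    ‖(((N : ℝ) ^ (-r⁻¹) : ℝ) : 𝕜)‖ ^ r = (N : ℝ)⁻¹ := by
  rw [RCLike.norm_ofReal, abs_of_nonneg (by positivity), ← Real.rpow_mul (by positivity),
    neg_mul, inv_mul_cancel₀ hr.ne', Real.rpow_neg_one]

/-- In `r`-th powers the first block contributes at most 1, and the weighted sum at most `N⁻¹ * N =
1`. -/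
theorem IsUpper.upperSpread {r : ℝ} (hr : 0 < r) (h : E.IsUpper r) :
    E.UpperSpread r⁻¹ (2 ^ r⁻¹) := by
  intro n u hu hu1
  refine ⟨1, fun N hN => ?_⟩
  refine (Real.le_rpow_inv_iff_of_pos (norm_nonneg _) zero_le_two hr).2 ?_
  have hN0 : (0 : ℝ) < N := by exact_mod_cast hN
  have h1 := h (n 1) (u 0) ((((N : ℝ) ^ (-r⁻¹) : ℝ) : 𝕜) • ∑ k ∈ Finset.range N, u (k + 1))
    (hu.2 0).2 (by rw [map_smul, hu.tail_sum_shift 1])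
  refine h1.trans ?_
  rw [norm_smul, Real.mul_rpow (norm_nonneg _) (norm_nonneg _), norm_ofReal_rpow_neg_inv hr]
  have h2 := h.norm_sum_le_rpow hr (hu.shift 1) (fun k => hu1 _) N
  have h3 : (N : ℝ)⁻¹ * ‖∑ k ∈ Finset.range N, u (k + 1)‖ ^ r ≤ 1 := by
    rw [inv_mul_eq_div, div_le_one hN0]; exact h2
  have h4 := Real.rpow_le_one (norm_nonneg _) (hu1 0) hr.le
  linarith

theorem IsLower.lowerSpread {r : ℝ} (hr : 0 < r) (h : E.IsLower r) :
    E.LowerSpread r⁻¹ (2 ^ r⁻¹) := by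
  intro n u hu hu1
  refine ⟨1, fun N hN => ?_⟩
  refine (Real.rpow_inv_le_iff_of_pos zero_le_two (norm_nonneg _) hr).2 ?_
  have hN0 : (0 : ℝ) < N := by exact_mod_cast hN
  have h1 := h (n 1) (u 0) ((((N : ℝ) ^ (-r⁻¹) : ℝ) : 𝕜) • ∑ k ∈ Finset.range N, u (k + 1))
    (hu.2 0).2 (by rw [map_smul, hu.tail_sum_shift 1])
  refine le_trans ?_ h1
  rw [norm_smul, Real.mul_rpow (norm_nonneg _) (norm_nonneg _), norm_ofReal_rpow_neg_inv hr]
  have h2 := h.rpow_le_norm_sum hr (hu.shift 1) (fun k => hu1 _) N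
  have h3 : 1 ≤ (N : ℝ)⁻¹ * ‖∑ k ∈ Finset.range N, u (k + 1)‖ ^ r := by
    rw [inv_mul_eq_div, one_le_div hN0]; exact h2
  have h4 := Real.one_le_rpow (hu1 0) hr.le
  linarith

theorem IsUpperSup.norm_sum_le (h : E.IsUpperSup) (hu : E.IsBlockSeq n u)
    (hu1 : ∀ k, ‖u k‖ ≤ 1) (N : ℕ) : ‖∑ k ∈ Finset.range N, u k‖ ≤ 1 := by
  induction N with
  | zero => simp
  | succ N ih =>
    rw [Finset.sum_range_succ]
    exact (h (n N) _ _ (hu.tail_sum N) (hu.2 N).1).trans (max_le ih (hu1 N))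

theorem IsUpperSup.upperEstimate (h : E.IsUpperSup) : E.UpperEstimate 0 1 := by
  intro n u hu hu1 N
  rw [Real.rpow_zero, mul_one]
  have := h.norm_sum_le (hu.shift N) (fun k => hu1 _) N
  simpa only [add_comm N] using this

theorem IsUpperSup.upperSpread (h : E.IsUpperSup) : E.UpperSpread 0 1 := by
  intro n u hu hu1
  refine ⟨0, fun N _ => ?_⟩
  rw [spread, neg_zero, Real.rpow_zero, RCLike.ofReal_one, one_smul]
  exact (h (n 1) _ _ (hu.2 0).2 (hu.tail_sum_shift 1 _)).trans
    (max_le (hu1 0) (h.norm_sum_le (hu.shift 1) (fun k => hu1 _) N))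

theorem IsAsymptoticLower.lowerEstimate {r : ℝ} (hr : 0 < r) (h : E.IsAsymptoticLower r) :
    E.LowerEstimate r⁻¹ (2⁻¹ ^ r⁻¹) := by
  intro n u hu hu1 N
  rw [← Real.mul_rpow (by norm_num) (Nat.cast_nonneg _)]
  refine (Real.rpow_inv_le_iff_of_pos (by positivity) (norm_nonneg _) hr).2 ?_
  have h1 := h n hu.1 N (∑ k ∈ Finset.range N, u (N + k))
  have h2 : ∀ k ∈ Finset.range N, E.tail (n (N + k)) (∑ k ∈ Finset.range N, u (N + k)) -
      E.tail (n (N + k + 1)) (∑ k ∈ Finset.range N, u (N + k)) = u (N + k) := by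
    intro k hk
    rw [map_sum, map_sum, ← Finset.sum_sub_distrib, Finset.sum_eq_single k]
    · rw [(hu.2 _).1, (hu.2 _).2, sub_zero]
    · intro l _ hl
      rcases lt_or_gt_of_ne hl with hlk | hlk
      · have h3 := (hu.2 (N + l)).2
        rw [E.tail_eq_zero_of_le (hu.1.monotone (by omega)) h3,
          E.tail_eq_zero_of_le (hu.1.monotone (by omega)) h3, sub_zero]
      · have h3 := (hu.2 (N + l)).1
        rw [E.tail_eq_self_of_le (hu.1.monotone (by omega)) h3,
          E.tail_eq_self_of_le (hu.1.monotone (by omega)) h3, sub_self]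
    · exact fun h => absurd hk h
  have h3 : (N : ℝ) ≤ ∑ k ∈ Finset.range N, ‖E.tail (n (N + k))
      (∑ k ∈ Finset.range N, u (N + k)) -
      E.tail (n (N + k + 1)) (∑ k ∈ Finset.range N, u (N + k))‖ ^ r := by
    calc (N : ℝ) = ∑ k ∈ Finset.range N, (1 : ℝ) := by simp
      _ ≤ _ := Finset.sum_le_sum fun k hk => by
        rw [h2 k hk]; exact Real.one_le_rpow (hu1 _) hr.le
  linarith

/-! #### The dual basis -/

variable (E) in
/-- The dual basis of a shrinking basis. -/
noncomputable def dual (hE : E.Shrinking) : ShiftBasis 𝕜 (StrongDual 𝕜 X) where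
  vec := E.coord
  coord k := NormedSpace.inclusionInDoubleDual 𝕜 X (E.vec k)
  coord_vec i j := by
    rw [NormedSpace.dual_def, E.coord_vec]
    simp only [eq_comm]
  right := (ContinuousLinearMap.compL 𝕜 X X 𝕜).flip E.left
  left := (ContinuousLinearMap.compL 𝕜 X X 𝕜).flip E.right
  left_right f := by
    ext x
    simp [E.left_right]
  right_left f := by
    ext x
    simp [E.right_left, mul_comm]
  right_vec k := by
    ext x
    simp [E.coord_left]
  coord_left k f := by
    simp [E.right_vec]
  norm_partialSum_le n f := by
    refine ContinuousLinearMap.opNorm_le_bound _ (norm_nonneg _) fun x => ?_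
    have h : (∑ k ∈ Finset.range n,
        NormedSpace.inclusionInDoubleDual 𝕜 X (E.vec k) f • E.coord k) x = f (E.head n x) := by
      simp [head_apply, mul_comm]
    rw [h]
    exact (f.le_opNorm _).trans (by gcongr; exact E.norm_head_apply_le n x)
  norm_remainder_le n f := by
    refine ContinuousLinearMap.opNorm_le_bound _ (norm_nonneg _) fun x => ?_
    have h : (f - ∑ k ∈ Finset.range n,
        NormedSpace.inclusionInDoubleDual 𝕜 X (E.vec k) f • E.coord k) x = f (E.tail n x) := by
      simp [tail_apply, mul_comm]
    rw [h]
    exact (f.le_opNorm _).trans (by gcongr; exact E.norm_tail_apply_le n x)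
  tendsto_remainder f := by
    rw [tendsto_zero_iff_norm_tendsto_zero]
    refine (hE f).congr fun n => ?_
    congr 1
    ext x
    simp [tail_apply, mul_comm]

theorem dual_tail (hE : E.Shrinking) (n : ℕ) (f : StrongDual 𝕜 X) (x : X) :
    (E.dual hE).tail n f x = f (E.tail n x) := by
  simp [tail_apply, dual, mul_comm]

/-- A nearly norming vector is cut down to `[m, n)`. This does not change the value of `f`, which is
supported there, and does not increase the norm, since head and tail projections are contractions. A
unimodular factor makes the value real. -/
theorem exists_norming_block (hE : E.Shrinking) {f : StrongDual 𝕜 X} {m n : ℕ} (hmn : m ≤ n)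
    (h1 : (E.dual hE).tail m f = f) (h2 : (E.dual hE).tail n f = 0) {θ : ℝ} (hθ0 : 0 ≤ θ)
    (hθ : θ < ‖f‖) :
    ∃ x, ‖x‖ ≤ 1 ∧ E.tail m x = x ∧ E.tail n x = 0 ∧ ∃ t : ℝ, θ ≤ t ∧ f x = t := by
  obtain ⟨x₀, hx₀, hfx₀⟩ := ContinuousLinearMap.exists_lt_apply_of_lt_opNorm _ hθ
  have hne : f x₀ ≠ 0 := fun h => by rw [h, norm_zero] at hfx₀; linarith
  set c : 𝕜 := (‖f x₀‖ : 𝕜) / f x₀ with hc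
  have hcn : ‖c‖ = 1 := by
    simp only [c, norm_div, RCLike.norm_ofReal, abs_norm]
    exact div_self (norm_ne_zero_iff.2 hne)
  have hxe : E.head n (E.tail m x₀) = E.tail m x₀ - E.tail n x₀ := by
    rw [eq_sub_of_add_eq (E.head_add_tail n (E.tail m x₀)), E.tail_tail, max_eq_left hmn]
  refine ⟨c • E.head n (E.tail m x₀), ?_, ?_, ?_, ‖f x₀‖, hfx₀.le, ?_⟩
  · rw [norm_smul, hcn, one_mul]
    exact ((E.norm_head_apply_le _ _).trans (E.norm_tail_apply_le _ _)).trans hx₀.le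
  · rw [map_smul, hxe, map_sub, E.tail_tail, E.tail_tail, max_self, max_eq_right hmn]
  · rw [map_smul, hxe, map_sub, E.tail_tail, E.tail_tail, max_self, max_eq_left hmn, sub_self,
      smul_zero]
  · have h3 : f (E.tail m x₀) = f x₀ := by rw [← dual_tail hE, h1]
    have h4 : f (E.tail n x₀) = 0 := by rw [← dual_tail hE, h2]; rfl
    rw [map_smul, hxe, map_sub, h3, h4, sub_zero, smul_eq_mul]
    exact div_mul_cancel₀ _ hne

theorem exists_norming_blockSeq (hE : E.Shrinking) {f : ℕ → StrongDual 𝕜 X} {n : ℕ → ℕ}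
    (hf : (E.dual hE).IsBlockSeq n f) (hf1 : ∀ k, 1 ≤ ‖f k‖) {θ : ℝ} (hθ0 : 0 ≤ θ) (hθ : θ < 1) :
    ∃ (u : ℕ → X) (t : ℕ → ℝ), E.IsBlockSeq n u ∧ (∀ k, ‖u k‖ ≤ 1) ∧ (∀ k, θ ≤ t k) ∧
      (∀ k, f k (u k) = t k) ∧ ∀ k l, k ≠ l → f k (u l) = 0 := by
  choose u hu1 hu2 hu3 t ht hft using fun k => exists_norming_block hE
    (hf.1.monotone (Nat.le_succ k)) (hf.2 k).1 (hf.2 k).2 hθ0 (hθ.trans_le (hf1 k))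
  refine ⟨u, t, ⟨hf.1, fun k => ⟨hu2 k, hu3 k⟩⟩, hu1, ht, hft, fun k l hkl => ?_⟩
  rcases lt_or_gt_of_ne hkl with h | h
  · have h1 : E.tail (n (k + 1)) (u l) = u l :=
      E.tail_eq_self_of_le (hf.1.monotone (Nat.succ_le_of_lt h)) (hu2 l)
    rw [← h1, ← dual_tail hE, (hf.2 k).2]
    rfl
  · have h1 : E.tail (n k) (u l) = 0 :=
      E.tail_eq_zero_of_le (hf.1.monotone (Nat.succ_le_of_lt h)) (hu3 l)
    rw [← (hf.2 k).1, dual_tail, h1, map_zero]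

/-- The sum of the functionals is tested on the sum of biorthogonal blocks that norm them up to the
factor `1 / 2`, which accounts for the 2 in the constant. -/
theorem UpperEstimate.dual_lowerEstimate (hE : E.Shrinking) {α C : ℝ} (hα : α < 1) (hC : 0 < C)
    (h : E.UpperEstimate α C) : (E.dual hE).LowerEstimate (1 - α) (2 * C)⁻¹ := by
  intro n f hf hf1 N
  obtain ⟨u, t, hu, hu1, ht, hft, hort⟩ :=
    exists_norming_blockSeq hE hf hf1 (θ := 1 / 2) (by norm_num) (by norm_num)
  rcases Nat.eq_zero_or_pos N with rfl | hN
  · rw [Nat.cast_zero, Real.zero_rpow (by linarith)]; simp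
  have hN0 : (0 : ℝ) < N := by exact_mod_cast hN
  have h1 := h n u hu hu1 N
  have h2 : (∑ k ∈ Finset.range N, f (N + k)) (∑ k ∈ Finset.range N, u (N + k)) =
      ((∑ k ∈ Finset.range N, t (N + k) : ℝ) : 𝕜) := by
    rw [sum_apply]
    push_cast
    refine Finset.sum_congr rfl fun k hk => ?_
    rw [map_sum, Finset.sum_eq_single k, hft]
    · exact fun l _ hl => hort _ _ (by omega)
    · exact fun h => absurd hk h
  have h3 : N / 2 ≤ ∑ k ∈ Finset.range N, t (N + k) := by
    calc (N : ℝ) / 2 = ∑ k ∈ Finset.range N, (1 / 2 : ℝ) := by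
          rw [Finset.sum_const, Finset.card_range, nsmul_eq_mul]; ring
      _ ≤ _ := Finset.sum_le_sum fun k _ => ht _
  have h4 : (N : ℝ) / 2 ≤ ‖∑ k ∈ Finset.range N, f (N + k)‖ * (C * (N : ℝ) ^ α) := by
    refine h3.trans ((le_abs_self _).trans ?_)
    rw [← RCLike.norm_ofReal (K := 𝕜), ← h2]
    exact (ContinuousLinearMap.le_opNorm _ _).trans (by gcongr)
  have h5 : (N : ℝ) ^ (1 - α) * (N : ℝ) ^ α = N := by
    rw [← Real.rpow_add hN0]; simp
  have h6 : 0 < (N : ℝ) ^ α := Real.rpow_pos_of_pos hN0 _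
  rw [inv_mul_le_iff₀ (by positivity)]
  refine le_of_mul_le_mul_right ?_ h6
  rw [h5]
  linarith

/-- The weights `N ^ (-(1 - α))` and `N ^ (-α)` multiply to `N⁻¹`. Pairing the two spreads therefore
gives the first value plus an average of the others, at least twice the norming factor `κ' * κ / 2`.
-/
theorem UpperSpread.dual_lowerSpread (hE : E.Shrinking) {α κ κ' : ℝ} (hκ : 0 < κ)
    (hκ' : 0 ≤ κ') (hκκ : κ' * κ < 2) (h : E.UpperSpread α κ) :
    (E.dual hE).LowerSpread (1 - α) κ' := by
  intro n f hf hf1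
  obtain ⟨u, t, hu, hu1, ht, hft, hort⟩ := exists_norming_blockSeq hE hf hf1
    (θ := κ' * κ / 2) (by positivity) (by linarith)
  obtain ⟨N₀, hN₀⟩ := h n u hu hu1
  refine ⟨N₀ + 1, fun N hN => ?_⟩
  have hN0 : (0 : ℝ) < N := by exact_mod_cast (by omega : 0 < N)
  have h1 := hN₀ N (by omega)
  set a : 𝕜 := (((N : ℝ) ^ (-(1 - α)) : ℝ) : 𝕜) with ha
  set c : 𝕜 := (((N : ℝ) ^ (-α) : ℝ) : 𝕜) with hc
  have h2 : (spread 𝕜 (1 - α) N f) (spread 𝕜 α N u) =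
      ((t 0 + (N : ℝ)⁻¹ * ∑ k ∈ Finset.range N, t (k + 1) : ℝ) : 𝕜) := by
    have e1 : f 0 (∑ k ∈ Finset.range N, u (k + 1)) = 0 := by
      rw [map_sum]
      exact Finset.sum_eq_zero fun k _ => hort _ _ (by omega)
    have e2 : (∑ k ∈ Finset.range N, f (k + 1)) (u 0) = 0 := by
      rw [sum_apply]
      exact Finset.sum_eq_zero fun k _ => hort _ _ (by omega)
    have e3 : (∑ k ∈ Finset.range N, f (k + 1)) (∑ k ∈ Finset.range N, u (k + 1)) =
        ((∑ k ∈ Finset.range N, t (k + 1) : ℝ) : 𝕜) := by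
      rw [sum_apply]
      push_cast
      refine Finset.sum_congr rfl fun k hk => ?_
      rw [map_sum, Finset.sum_eq_single k, hft]
      · exact fun l _ hl => hort _ _ (by omega)
      · exact fun h => absurd hk h
    have e4 : a * c = (((N : ℝ)⁻¹ : ℝ) : 𝕜) := by
      rw [ha, hc, ← RCLike.ofReal_mul, ← Real.rpow_add hN0]
      congr 1
      rw [← Real.rpow_neg_one]
      congr 1
      ring
    rw [spread, spread, add_apply, map_add, map_add, smul_apply, smul_apply, map_smul, map_smul,
      e1, e2, e3, hft]
    simp only [smul_eq_mul, mul_zero, add_zero, zero_add]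
    rw [← ha, ← hc, ← mul_assoc, e4]
    push_cast
    ring
  have h3 : (κ' * κ / 2) * N ≤ ∑ k ∈ Finset.range N, t (k + 1) := by
    calc (κ' * κ / 2) * N = ∑ k ∈ Finset.range N, (κ' * κ / 2) := by
          rw [Finset.sum_const, Finset.card_range, nsmul_eq_mul]; ring
      _ ≤ _ := Finset.sum_le_sum fun k _ => ht _
  have h4 : κ' * κ ≤ ‖spread 𝕜 (1 - α) N f‖ * κ := by
    have h5 : κ' * κ / 2 ≤ (N : ℝ)⁻¹ * ∑ k ∈ Finset.range N, t (k + 1) := by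
      rw [inv_mul_eq_div, le_div_iff₀ hN0]; exact h3
    calc κ' * κ ≤ t 0 + (N : ℝ)⁻¹ * ∑ k ∈ Finset.range N, t (k + 1) := by linarith [ht 0]
      _ ≤ ‖(spread 𝕜 (1 - α) N f) (spread 𝕜 α N u)‖ := by
        rw [h2, RCLike.norm_ofReal]; exact le_abs_self _
      _ ≤ _ := (ContinuousLinearMap.le_opNorm _ _).trans (by gcongr)
  exact le_of_mul_le_mul_right h4 hκ

/-- Each functional sees only its own piece of `x`. The norms of the `N` pieces are summed by the
power mean inequality, which gives the factor `N ^ (1 - r⁻¹)`. -/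
theorem IsAsymptoticLower.dual_upperEstimate (hE : E.Shrinking) {r : ℝ} (hr : 1 ≤ r)
    (h : E.IsAsymptoticLower r) : (E.dual hE).UpperEstimate (1 - r⁻¹) (2 ^ r⁻¹) := by
  intro n f hf hf1 N
  have hr0 : 0 < r := zero_lt_one.trans_le hr
  refine ContinuousLinearMap.opNorm_le_bound _ (by positivity) fun x => ?_
  set y : ℕ → X := fun k => E.tail (n (N + k)) x - E.tail (n (N + k + 1)) x with hy
  have h1 : ‖(∑ k ∈ Finset.range N, f (N + k)) x‖ ≤ ∑ k ∈ Finset.range N, ‖y k‖ := by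
    rw [sum_apply]
    refine (_root_.norm_sum_le _ _).trans (Finset.sum_le_sum fun k _ => ?_)
    have h2 : f (N + k) x = f (N + k) (y k) := by
      rw [hy, map_sub, ← dual_tail hE, ← dual_tail hE, (hf.2 _).1, (hf.2 _).2]
      simp
    rw [h2]
    exact ((f (N + k)).le_of_opNorm_le (hf1 _) _).trans (by rw [one_mul])
  refine h1.trans ?_
  have h3 := Real.rpow_sum_le_const_mul_sum_rpow (Finset.range N) (fun k => ‖y k‖) hr
  simp only [abs_norm, Finset.card_range] at h3
  have h4 : (∑ k ∈ Finset.range N, ‖y k‖) ^ r ≤ (N : ℝ) ^ (r - 1) * (2 * ‖x‖ ^ r) :=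
    h3.trans (mul_le_mul_of_nonneg_left (h n hf.1 N x) (by positivity))
  have h5 := (Real.le_rpow_inv_iff_of_pos (by positivity) (by positivity) hr0).2 h4
  refine h5.trans (le_of_eq ?_)
  rw [Real.mul_rpow (by positivity) (by positivity), Real.mul_rpow (by positivity) (by positivity),
    Real.rpow_rpow_inv (norm_nonneg _) hr0.ne', ← Real.rpow_mul (Nat.cast_nonneg _)]
  have h6 : (r - 1) * r⁻¹ = 1 - r⁻¹ := by
    rw [sub_mul, mul_inv_cancel₀ hr0.ne', one_mul]
  rw [h6]
  ring

end ShiftBasis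

/-! ### Operators given by linear maps of sequences. -/

/-- The right shift as a linear map. -/
def rightShiftLinear (𝕜 : Type*) [RCLike 𝕜] : (ℕ → 𝕜) →ₗ[𝕜] (ℕ → 𝕜) where
  toFun := rightShift
  map_add' x y := by ext i; cases i <;> simp [rightShift]
  map_smul' c x := by ext i; cases i <;> simp [rightShift]

section liftOfSeq

variable {𝕜 : Type*} [RCLike 𝕜] {X : Type*} [NormedAddCommGroup X] [NormedSpace 𝕜 X]
  {seq : X →ₗ[𝕜] (ℕ → 𝕜)} (hinj : Function.Injective seq) (S : (ℕ → 𝕜) →ₗ[𝕜] (ℕ → 𝕜)) (C : ℝ)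
  (h : ∀ x, ∃ z, seq z = S (seq x) ∧ ‖z‖ ≤ C * ‖x‖)

/-- The bounded operator on a space of sequences which is given by a linear map of sequences. -/
noncomputable def liftOfSeq : X →L[𝕜] X :=
  have hs : ∀ x, seq (h x).choose = S (seq x) := fun x => (h x).choose_spec.1
  LinearMap.mkContinuous
    { toFun := fun x => (h x).choose
      map_add' := fun x y => hinj <| (hs _).trans <| by
        rw [map_add seq x y, map_add S, map_add seq, hs, hs]
      map_smul' := fun c x => hinj <| (hs _).trans <| by
        rw [RingHom.id_apply, map_smul seq c x, map_smul S, map_smul seq, hs] } C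
    fun x => (h x).choose_spec.2

theorem seq_liftOfSeq (x : X) : seq (liftOfSeq hinj S C h x) = S (seq x) := (h x).choose_spec.1

end liftOfSeq

namespace ShiftBasis

/-! #### Sequence spaces -/

section ofSeq

variable {𝕜 : Type*} [RCLike 𝕜] {X : Type*} [NormedAddCommGroup X] [NormedSpace 𝕜 X]

/-- The unit vector basis of a Banach lattice `X` of sequences with bounded shifts, in which the
finitely supported sequences are dense. -/
noncomputable def ofSeq (seq : X →ₗ[𝕜] (ℕ → 𝕜))
    (hmono : ∀ x y, (∀ i, ‖seq x i‖ ≤ ‖seq y i‖) → ‖x‖ ≤ ‖y‖)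
    (hcoord : ∀ i x, ‖seq x i‖ ≤ ‖x‖) (vec : ℕ → X) (hvec : ∀ k, seq (vec k) = Pi.single k 1)
    (right left : X →L[𝕜] X) (hright : ∀ x, seq (right x) = rightShift (seq x))
    (hleft : ∀ x i, seq (left x) i = seq x (i + 1))
    (hdense : ∀ x, ∀ ε > 0, ∃ y n, (∀ i ≥ n, seq y i = 0) ∧ ‖x - y‖ < ε) : ShiftBasis 𝕜 X :=
  have hinj : ∀ x y, seq x = seq y → x = y := fun x y h => by
    have := hmono (x - y) 0 fun i => by simp [h]
    rw [norm_zero, norm_le_zero_iff] at this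
    exact sub_eq_zero.1 this
  have hhead : ∀ n x i, seq (∑ k ∈ Finset.range n, seq x k • vec k) i =
      if i < n then seq x i else 0 := fun n x i => by
    simp [hvec, Pi.single_apply]
  { vec := vec
    coord := fun i => LinearMap.mkContinuous ((LinearMap.proj i : (ℕ → 𝕜) →ₗ[𝕜] 𝕜) ∘ₗ seq) 1
      fun x => by simpa using hcoord i x
    coord_vec := fun i j => by simp [hvec, Pi.single_apply]
    right := right
    left := left
    left_right := fun x => hinj _ _ <| by
      ext i
      rw [hleft, hright]
      rfl
    right_left := fun x => hinj _ _ <| by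
      ext i
      rw [hright]
      cases i with
      | zero => simp [rightShift, hvec]
      | succ i => simp [rightShift, hvec, hleft]
    right_vec := fun k => hinj _ _ <| by
      ext i
      rw [hright]
      cases i with
      | zero => simp [rightShift, hvec]
      | succ i => simp [rightShift, hvec, Pi.single_apply]
    coord_left := fun k x => by simp [hleft]
    norm_partialSum_le := fun n x => hmono _ _ fun i => by
      change ‖seq (∑ k ∈ Finset.range n, seq x k • vec k) i‖ ≤ _
      rw [hhead]
      split_ifs <;> simp
    norm_remainder_le := fun n x => hmono _ _ fun i => by
      change ‖seq (x - ∑ k ∈ Finset.range n, seq x k • vec k) i‖ ≤ _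
      rw [map_sub, Pi.sub_apply, hhead]
      split_ifs <;> simp
    tendsto_remainder := fun x => by
      rw [Metric.tendsto_atTop]
      intro ε hε
      obtain ⟨y, n, hy, hxy⟩ := hdense x ε hε
      refine ⟨n, fun m hm => ?_⟩
      rw [dist_zero_right]
      refine (hmono _ _ fun i => ?_).trans_lt hxy
      change ‖seq (x - ∑ k ∈ Finset.range m, seq x k • vec k) i‖ ≤ _
      rw [map_sub, map_sub, Pi.sub_apply, Pi.sub_apply, hhead]
      split_ifs with h
      · simp
      · simp [hy i (hm.trans (not_lt.1 h))] }

variable {seq : X →ₗ[𝕜] (ℕ → 𝕜)} {hmono : ∀ x y, (∀ i, ‖seq x i‖ ≤ ‖seq y i‖) → ‖x‖ ≤ ‖y‖}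
    {hcoord : ∀ i x, ‖seq x i‖ ≤ ‖x‖} {vec : ℕ → X} {hvec : ∀ k, seq (vec k) = Pi.single k 1}
    {right left : X →L[𝕜] X} {hright : ∀ x, seq (right x) = rightShift (seq x)}
    {hleft : ∀ x i, seq (left x) i = seq x (i + 1)}
    {hdense : ∀ x, ∀ ε > 0, ∃ y n, (∀ i ≥ n, seq y i = 0) ∧ ‖x - y‖ < ε}

theorem seq_tail_ofSeq (n : ℕ) (x : X) (i : ℕ) :
    seq ((ofSeq seq hmono hcoord vec hvec right left hright hleft hdense).tail n x) i =
      if i < n then 0 else seq x i :=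
  coord_tail (ofSeq seq hmono hcoord vec hvec right left hright hleft hdense) i n x

end ofSeq

end ShiftBasis

/-! ### The spaces `ℓ_p` and `c₀` -/

section Ell

variable {𝕜 : Type*} [RCLike 𝕜] {p : Set.Ici (1 : ℝ≥0∞)}

theorem toReal_pos_of_ne_top (hp : (p : ℝ≥0∞) ≠ ∞) : 0 < (p : ℝ≥0∞).toReal :=
  ENNReal.toReal_pos (zero_lt_one.trans_le p.2).ne' hp

/-- A single comparison covers monotonicity of the norm and both shifts. Injectivity of `g` is
required only on the support of `y`, because for the right shift `g i = i - 1` is not injective at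
0. -/
theorem exists_lp_norm_le (x : lp (fun _ : ℕ => 𝕜) (p : ℝ≥0∞)) (y : ℕ → 𝕜) (g : ℕ → ℕ)
    (hg : Set.InjOn g {i | y i ≠ 0}) (h : ∀ i, ‖y i‖ ≤ ‖x (g i)‖) :
    ∃ z : lp (fun _ : ℕ => 𝕜) (p : ℝ≥0∞), ⇑z = y ∧ ‖z‖ ≤ ‖x‖ := by
  have hp0 : (p : ℝ≥0∞) ≠ 0 := (zero_lt_one.trans_le p.2).ne'
  by_cases hp : (p : ℝ≥0∞) = ∞
  · have hle : ∀ i, ‖y i‖ ≤ ‖x‖ := fun i => (h i).trans (lp.norm_apply_le_norm hp0 x _)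
    have hy : Memℓp y (p : ℝ≥0∞) := by
      rw [hp]
      exact memℓp_infty ⟨‖x‖, by rintro _ ⟨i, rfl⟩; exact hle i⟩
    refine ⟨⟨y, hy⟩, rfl, ?_⟩
    -- Data depending on `p` are abstracted so that `p` can be replaced by `∞`, where the norm is a
    -- supremum.
    generalize hz : (⟨y, hy⟩ : lp (fun _ : ℕ => 𝕜) (p : ℝ≥0∞)) = z
    have hz' : ∀ i, ‖z i‖ ≤ ‖x‖ := fun i => by subst hz; exact hle i
    generalize ‖x‖ = C at hz' hle
    have hC : 0 ≤ C := (norm_nonneg _).trans (hle 0)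
    clear hz hy h
    obtain ⟨p, hp1⟩ := p
    subst hp
    exact lp.norm_le_of_forall_le hC hz'
  · have hp1 := toReal_pos_of_ne_top hp
    have hle : ∀ s : Finset ℕ, ∑ i ∈ s, ‖y i‖ ^ (p : ℝ≥0∞).toReal ≤
        ‖x‖ ^ (p : ℝ≥0∞).toReal := by
      classical
      intro s
      calc ∑ i ∈ s, ‖y i‖ ^ (p : ℝ≥0∞).toReal
          = ∑ i ∈ s with y i ≠ 0, ‖y i‖ ^ (p : ℝ≥0∞).toReal := by
            rw [Finset.sum_filter_of_ne]
            intro i _ hi h0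
            exact hi (by rw [h0, norm_zero, Real.zero_rpow hp1.ne'])
        _ ≤ ∑ i ∈ s with y i ≠ 0, ‖x (g i)‖ ^ (p : ℝ≥0∞).toReal :=
            Finset.sum_le_sum fun i _ => Real.rpow_le_rpow (norm_nonneg _) (h i) hp1.le
        _ = ∑ j ∈ Finset.image g {i ∈ s | y i ≠ 0}, ‖x j‖ ^ (p : ℝ≥0∞).toReal := by
            rw [Finset.sum_image]
            intro i hi j hj hij
            exact hg (Finset.mem_filter.1 hi).2 (Finset.mem_filter.1 hj).2 hij
        _ ≤ _ := lp.sum_rpow_le_norm_rpow hp1 x _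
    exact ⟨⟨y, memℓp_gen' hle⟩, rfl, lp.norm_le_of_forall_sum_le hp1 (norm_nonneg _) hle⟩

variable (𝕜 p) in
/-- The sequence of coordinates of an element of `ℓ_p`. -/
noncomputable def Ell.seq : Ell 𝕜 p →ₗ[𝕜] (ℕ → 𝕜) where
  toFun x := ⇑(x : lp (fun _ : ℕ => 𝕜) (p : ℝ≥0∞))
  map_add' _ _ := rfl
  map_smul' _ _ := rfl

theorem Ell.tendsto_seq (x : Ell 𝕜 p) : Tendsto (Ell.seq 𝕜 p x) atTop (𝓝 0) := x.2

theorem Ell.seq_injective : Function.Injective (Ell.seq 𝕜 p) := fun _ _ h =>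
  Subtype.ext (lp.ext h)

/-- Divergence of `g` keeps `y` a null sequence, which matters for `c₀`. -/
theorem Ell.exists_norm_le (x : Ell 𝕜 p) (y : ℕ → 𝕜) (g : ℕ → ℕ)
    (hg : Set.InjOn g {i | y i ≠ 0}) (hg' : Tendsto g atTop atTop)
    (h : ∀ i, ‖y i‖ ≤ ‖Ell.seq 𝕜 p x (g i)‖) :
    ∃ z : Ell 𝕜 p, Ell.seq 𝕜 p z = y ∧ ‖z‖ ≤ ‖x‖ := by
  obtain ⟨z, hz, hzx⟩ := exists_lp_norm_le (x : lp (fun _ : ℕ => 𝕜) (p : ℝ≥0∞)) y g hg h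
  refine ⟨⟨z, ?_⟩, hz, hzx⟩
  change Tendsto ⇑z atTop (𝓝 0)
  rw [hz]
  refine squeeze_zero_norm h ?_
  simpa using ((Ell.tendsto_seq x).comp hg').norm

theorem Ell.norm_mono (x y : Ell 𝕜 p) (h : ∀ i, ‖Ell.seq 𝕜 p x i‖ ≤ ‖Ell.seq 𝕜 p y i‖) :
    ‖x‖ ≤ ‖y‖ := by
  obtain ⟨z, hz, hzy⟩ := Ell.exists_norm_le y (Ell.seq 𝕜 p x) id Function.injective_id.injOn
    tendsto_id h
  rwa [← Ell.seq_injective hz]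

theorem Ell.norm_seq_le (i : ℕ) (x : Ell 𝕜 p) : ‖Ell.seq 𝕜 p x i‖ ≤ ‖x‖ :=
  lp.norm_apply_le_norm (zero_lt_one.trans_le p.2).ne' (x : lp (fun _ : ℕ => 𝕜) (p : ℝ≥0∞)) i

theorem Ell.exists_right (x : Ell 𝕜 p) :
    ∃ z : Ell 𝕜 p, Ell.seq 𝕜 p z = rightShift (Ell.seq 𝕜 p x) ∧ ‖z‖ ≤ ‖x‖ := by
  refine Ell.exists_norm_le x _ (fun i => i - 1) ?_ (tendsto_sub_atTop_nat 1) fun i => ?_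
  · have h0 : ∀ i, i ∈ {i | rightShift (Ell.seq 𝕜 p x) i ≠ 0} → i ≠ 0 := by
      rintro i hi rfl
      exact hi rfl
    intro i hi j hj hij
    have := h0 i hi
    have := h0 j hj
    simp only at hij
    omega
  · cases i <;> simp [rightShift]

theorem Ell.exists_left (x : Ell 𝕜 p) :
    ∃ z : Ell 𝕜 p, Ell.seq 𝕜 p z = (fun i => Ell.seq 𝕜 p x (i + 1)) ∧ ‖z‖ ≤ ‖x‖ :=
  Ell.exists_norm_le x _ (· + 1) (add_left_injective 1).injOn (tendsto_add_atTop_nat 1)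
    fun _ => le_rfl

variable (𝕜 p) in
/-- The right shift on `ℓ_p`. -/
noncomputable def Ell.right : Ell 𝕜 p →L[𝕜] Ell 𝕜 p :=
  liftOfSeq Ell.seq_injective (rightShiftLinear 𝕜) 1 fun x => by
    rw [one_mul]; exact Ell.exists_right x

variable (𝕜 p) in
/-- The left shift on `ℓ_p`. -/
noncomputable def Ell.left : Ell 𝕜 p →L[𝕜] Ell 𝕜 p :=
  liftOfSeq Ell.seq_injective (LinearMap.funLeft 𝕜 𝕜 (· + 1)) 1 fun x => by
    rw [one_mul]; exact Ell.exists_left x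

theorem Ell.exists_vec (k : ℕ) : ∃ x : Ell 𝕜 p, Ell.seq 𝕜 p x = Pi.single k 1 := by
  refine ⟨⟨lp.single (p : ℝ≥0∞) k 1, ?_⟩, ?_⟩
  · refine tendsto_const_nhds.congr' (eventually_atTop.2 ⟨k + 1, fun i hi => ?_⟩)
    exact (lp.single_apply_ne (E := fun _ : ℕ => 𝕜) (p : ℝ≥0∞) k 1 (by omega)).symm
  · ext i
    rw [← lp.coeFn_single (E := fun _ : ℕ => 𝕜) (p : ℝ≥0∞) k 1]
    rfl

theorem Ell.exists_norm_sub_lt (x : Ell 𝕜 p) (ε : ℝ) (hε : 0 < ε) :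
    ∃ (y : Ell 𝕜 p) (n : ℕ), (∀ i ≥ n, Ell.seq 𝕜 p y i = 0) ∧ ‖x - y‖ < ε := by
  choose e he using Ell.exists_vec (𝕜 := 𝕜) (p := p)
  have hsum : ∀ n i, Ell.seq 𝕜 p (∑ k ∈ Finset.range n, Ell.seq 𝕜 p x k • e k) i =
      if i < n then Ell.seq 𝕜 p x i else 0 := fun n i => by
    simp [he, Pi.single_apply]
  suffices ∃ n, ‖x - ∑ k ∈ Finset.range n, Ell.seq 𝕜 p x k • e k‖ < ε by
    obtain ⟨n, hn⟩ := this
    exact ⟨_, n, fun i hi => by rw [hsum, if_neg (not_lt.2 hi)], hn⟩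
  by_cases hp : (p : ℝ≥0∞) = ∞
  · obtain ⟨n, hn⟩ := Metric.tendsto_atTop.1 (Ell.tendsto_seq x) (ε / 2) (half_pos hε)
    refine ⟨n, lt_of_le_of_lt ?_ (half_lt_self hε)⟩
    have h : ∀ i, ‖Ell.seq 𝕜 p (x - ∑ k ∈ Finset.range n, Ell.seq 𝕜 p x k • e k) i‖ ≤
        ε / 2 := fun i => by
      rw [map_sub, Pi.sub_apply, hsum]
      split_ifs with hi
      · simpa using (half_pos hε).le
      · simpa using (hn i (not_lt.1 hi)).le
    generalize x - ∑ k ∈ Finset.range n, Ell.seq 𝕜 p x k • e k = z at h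
    clear hsum hn he e x
    obtain ⟨p, hp1⟩ := p
    subst hp
    exact lp.norm_le_of_forall_le (half_pos hε).le h
  · have h := (lp.hasSum_single hp (x : lp (fun _ : ℕ => 𝕜) (p : ℝ≥0∞))).tendsto_sum_nat
    obtain ⟨n, hn⟩ := Metric.tendsto_atTop.1 h ε hε
    refine ⟨n, ?_⟩
    have := hn n le_rfl
    rw [dist_comm, dist_eq_norm] at this
    refine lt_of_eq_of_lt ?_ this
    refine congrArg norm (lp.ext (funext fun i => ?_))
    have h1 := hsum n i
    have h2 : (∑ k ∈ Finset.range n, lp.single (E := fun _ : ℕ => 𝕜) (p : ℝ≥0∞) k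
        (Ell.seq 𝕜 p x k)) i = if i < n then Ell.seq 𝕜 p x i else 0 := by
      refine (congrFun (lp.coeFn_sum _ _) i).trans ?_
      refine (Finset.sum_apply (M := fun _ => 𝕜) i _ _).trans ?_
      simp [Pi.single_apply]
    exact congrArg (Ell.seq 𝕜 p x i - ·) (h1.trans h2.symm)

variable (𝕜 p) in
/-- The unit vector basis of `ℓ_p`. -/
noncomputable def Ell.basis : ShiftBasis 𝕜 (Ell 𝕜 p) :=
  ShiftBasis.ofSeq (Ell.seq 𝕜 p) Ell.norm_mono Ell.norm_seq_le
    (fun k => (Ell.exists_vec k).choose) (fun k => (Ell.exists_vec k).choose_spec)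
    (Ell.right 𝕜 p) (Ell.left 𝕜 p) (fun x => seq_liftOfSeq _ _ _ _ x)
    (fun x i => congrFun (seq_liftOfSeq _ _ _ _ x) i) Ell.exists_norm_sub_lt

theorem Ell.seq_tail (n : ℕ) (x : Ell 𝕜 p) (i : ℕ) :
    Ell.seq 𝕜 p ((Ell.basis 𝕜 p).tail n x) i = if i < n then 0 else Ell.seq 𝕜 p x i :=
  ShiftBasis.seq_tail_ofSeq n x i

theorem Ell.isClosed : IsClosed (ellSubmodule 𝕜 p : Set (lp (fun _ : ℕ => 𝕜) (p : ℝ≥0∞))) := by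
  refine isClosed_of_closure_subset fun x hx => ?_
  change Tendsto ⇑x atTop (𝓝 0)
  rw [Metric.tendsto_atTop]
  intro ε hε
  obtain ⟨y, hy, hxy⟩ := Metric.mem_closure_iff.1 hx (ε / 2) (half_pos hε)
  obtain ⟨n, hn⟩ := Metric.tendsto_atTop.1 (show Tendsto ⇑y atTop (𝓝 0) from hy) _ (half_pos hε)
  refine ⟨n, fun i hi => ?_⟩
  have h1 := lp.norm_apply_le_norm (zero_lt_one.trans_le p.2).ne' (x - y) i
  have h2 := hn i hi
  rw [dist_zero_right] at h2 ⊢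
  rw [dist_eq_norm] at hxy
  calc ‖x i‖ = ‖(x - y) i + y i‖ := by simp
    _ ≤ ‖(x - y) i‖ + ‖y i‖ := norm_add_le _ _
    _ < ε := by linarith

instance : CompleteSpace (Ell 𝕜 p) := Ell.isClosed.completeSpace_coe

theorem Ell.seq_of_blocks {n : ℕ} {x y : Ell 𝕜 p} (hx : (Ell.basis 𝕜 p).tail n x = 0)
    (hy : (Ell.basis 𝕜 p).tail n y = y) (i : ℕ) : Ell.seq 𝕜 p x i = 0 ∨ Ell.seq 𝕜 p y i = 0 := by
  by_cases hi : i < n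
  · right
    rw [← hy, Ell.seq_tail, if_pos hi]
  · left
    have := Ell.seq_tail n x i
    rwa [hx, map_zero, if_neg hi, Pi.zero_apply, eq_comm] at this

theorem Ell.norm_add_rpow (hp : (p : ℝ≥0∞) ≠ ∞) {n : ℕ} {x y : Ell 𝕜 p}
    (hx : (Ell.basis 𝕜 p).tail n x = 0) (hy : (Ell.basis 𝕜 p).tail n y = y) :
    ‖x + y‖ ^ (p : ℝ≥0∞).toReal = ‖x‖ ^ (p : ℝ≥0∞).toReal + ‖y‖ ^ (p : ℝ≥0∞).toReal := by
  have hp1 := toReal_pos_of_ne_top hp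
  have h : HasSum _ (‖x‖ ^ (p : ℝ≥0∞).toReal + ‖y‖ ^ (p : ℝ≥0∞).toReal) :=
    (lp.hasSum_norm hp1 (x : lp (fun _ : ℕ => 𝕜) (p : ℝ≥0∞))).add
      (lp.hasSum_norm hp1 (y : lp (fun _ : ℕ => 𝕜) (p : ℝ≥0∞)))
  refine (lp.hasSum_norm hp1 ((x + y : Ell 𝕜 p) : lp (fun _ : ℕ => 𝕜) (p : ℝ≥0∞))).unique ?_
  convert h using 1
  ext i
  change ‖Ell.seq 𝕜 p (x + y) i‖ ^ _ = ‖Ell.seq 𝕜 p x i‖ ^ _ + ‖Ell.seq 𝕜 p y i‖ ^ _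
  rw [map_add, Pi.add_apply]
  rcases Ell.seq_of_blocks hx hy i with h | h <;> simp [h, Real.zero_rpow hp1.ne']

theorem Ell.isUpper (hp : (p : ℝ≥0∞) ≠ ∞) : (Ell.basis 𝕜 p).IsUpper (p : ℝ≥0∞).toReal :=
  fun _ _ _ hx hy => (Ell.norm_add_rpow hp hx hy).le

theorem Ell.isLower (hp : (p : ℝ≥0∞) ≠ ∞) : (Ell.basis 𝕜 p).IsLower (p : ℝ≥0∞).toReal :=
  fun _ _ _ hx hy => (Ell.norm_add_rpow hp hx hy).ge

theorem Ell.isUpperSup (hp : (p : ℝ≥0∞) = ∞) : (Ell.basis 𝕜 p).IsUpperSup := by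
  intro n x y hx hy
  have h : ∀ i, ‖Ell.seq 𝕜 p (x + y) i‖ ≤ max ‖x‖ ‖y‖ := fun i => by
    rw [map_add, Pi.add_apply]
    rcases Ell.seq_of_blocks hx hy i with h | h
    · rw [h, zero_add]
      exact (Ell.norm_seq_le i y).trans (le_max_right _ _)
    · rw [h, add_zero]
      exact (Ell.norm_seq_le i x).trans (le_max_left _ _)
  have h0 : 0 ≤ max ‖x‖ ‖y‖ := (norm_nonneg x).trans (le_max_left _ _)
  generalize max ‖x‖ ‖y‖ = C at h h0
  generalize x + y = z at h ⊢
  clear hx hy x y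
  obtain ⟨p, hp1⟩ := p
  subst hp
  exact lp.norm_le_of_forall_le h0 h

end Ell

/-! ### The convexified Tsirelson spaces -/

section Tsirelson

variable {𝕜 : Type*} [RCLike 𝕜] {r : Set.Ici (1 : ℝ)}

theorem Ici_pos (r : Set.Ici (1 : ℝ)) : 0 < (r : ℝ) := zero_lt_one.trans_le r.2

theorem convexNorm_rpow (r : Set.Ici (1 : ℝ)) (a : ℕ → 𝕜) :
    convexNorm (r : ℝ) a ^ (r : ℝ) = tsirelsonNorm fun i => ‖a i‖ₑ ^ (r : ℝ) :=
  ENNReal.rpow_inv_rpow (Ici_pos r).ne' _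

theorem convexNorm_le_iff (r : Set.Ici (1 : ℝ)) (a : ℕ → 𝕜) (C : ℝ≥0∞) :
    convexNorm (r : ℝ) a ≤ C ↔ (tsirelsonNorm fun i => ‖a i‖ₑ ^ (r : ℝ)) ≤ C ^ (r : ℝ) :=
  ENNReal.rpow_inv_le_iff (Ici_pos r)

theorem convexNorm_mono {a b : ℕ → 𝕜} (h : ∀ i, ‖a i‖ ≤ ‖b i‖) :
    convexNorm (r : ℝ) a ≤ convexNorm (r : ℝ) b := by
  rw [convexNorm_le_iff, convexNorm_rpow]
  exact tsirelsonNorm_mono fun i =>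
    ENNReal.rpow_le_rpow (enorm_le_iff_norm_le.2 (h i)) (Ici_pos r).le

/-- Fatou property, inherited from lower semicontinuity of the Tsirelson norm. -/
theorem convexNorm_le_of_tendsto {a : ℕ → ℕ → 𝕜} {b : ℕ → 𝕜} {C : ℝ≥0∞}
    (h : ∀ i, Tendsto (fun n => a n i) atTop (𝓝 (b i)))
    (hC : ∀ᶠ n in atTop, convexNorm (r : ℝ) (a n) ≤ C) : convexNorm (r : ℝ) b ≤ C := by
  simp only [convexNorm_le_iff] at hC ⊢
  refine tsirelsonNorm_le_of_tendsto (fun i => ?_) hC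
  exact ((ENNReal.continuous_rpow_const (y := (r : ℝ))).tendsto _).comp
    ((continuous_enorm.tendsto _).comp (h i))

theorem convexNorm_leftShift_le (a : ℕ → 𝕜) :
    convexNorm (r : ℝ) (fun i => a (i + 1)) ≤ convexNorm (r : ℝ) a := by
  rw [convexNorm_le_iff, convexNorm_rpow]
  exact tsirelsonNorm_leftShift_le fun i => ‖a i‖ₑ ^ (r : ℝ)

theorem convexNorm_rightShift_le (a : ℕ → 𝕜) :
    convexNorm (r : ℝ) (rightShift a) ≤ 6 ^ (r : ℝ)⁻¹ * convexNorm (r : ℝ) a := by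
  rw [convexNorm_le_iff, ENNReal.mul_rpow_of_nonneg _ _ (Ici_pos r).le, convexNorm_rpow,
    ENNReal.rpow_inv_rpow (Ici_pos r).ne']
  refine (le_of_eq ?_).trans (tsirelsonNorm_rightShift_le _)
  congr 1
  ext i
  cases i <;> simp [rightShift, Ici_pos r]

theorem convexNorm_single_ne_top (k : ℕ) : convexNorm (r : ℝ) (Pi.single k 1 : ℕ → 𝕜) ≠ ∞ := by
  refine ne_top_of_le_ne_top ENNReal.one_ne_top ((convexNorm_le_iff _ _ _).2 ?_)
  rw [ENNReal.one_rpow]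
  refine iSup_le fun m => (tsirelsonAux_le_tsum _ _).trans ?_
  rw [tsum_eq_single k]
  · simp
  · intro i hi
    simp [hi, Ici_pos r]

namespace FiniteNorm

theorem toSeq_injective : Function.Injective (toSeq 𝕜 r) := Subtype.val_injective

theorem convexNorm_ne_top (x : FiniteNorm 𝕜 r) : convexNorm (r : ℝ) (toSeq 𝕜 r x) ≠ ∞ :=
  Subtype.property x

theorem enorm_eq (x : FiniteNorm 𝕜 r) : ‖x‖ₑ = convexNorm (r : ℝ) (toSeq 𝕜 r x) := by
  rw [← ofReal_norm]
  exact ENNReal.ofReal_toReal (convexNorm_ne_top x)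

theorem exists_toSeq {a : ℕ → 𝕜} (h : convexNorm (r : ℝ) a ≠ ∞) :
    ∃ x : FiniteNorm 𝕜 r, toSeq 𝕜 r x = a := ⟨⟨a, h⟩, rfl⟩

theorem norm_toSeq_le (i : ℕ) (x : FiniteNorm 𝕜 r) : ‖toSeq 𝕜 r x i‖ ≤ ‖x‖ := by
  rw [← enorm_le_iff_norm_le, enorm_eq]
  exact enorm_le_convexNorm r.2 _ _

/-- A Cauchy sequence converges coordinatewise, and the Fatou property upgrades this to convergence
in norm. -/
instance : CompleteSpace (FiniteNorm 𝕜 r) := by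
  refine Metric.complete_of_cauchySeq_tendsto fun u hu => ?_
  have hlim : ∀ i, ∃ c, Tendsto (fun n => toSeq 𝕜 r (u n) i) atTop (𝓝 c) := fun i =>
    cauchySeq_tendsto_of_complete <| by
      rw [Metric.cauchySeq_iff] at hu ⊢
      intro ε hε
      obtain ⟨N, hN⟩ := hu ε hε
      refine ⟨N, fun m hm n hn => lt_of_le_of_lt ?_ (hN m hm n hn)⟩
      rw [dist_eq_norm, dist_eq_norm]
      simpa using norm_toSeq_le i (u m - u n)
  choose b hb using hlim
  have key : ∀ ε > 0, ∃ N, ∀ n ≥ N,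
      convexNorm (r : ℝ) (b - toSeq 𝕜 r (u n)) ≤ ENNReal.ofReal ε := by
    intro ε hε
    obtain ⟨N, hN⟩ := Metric.cauchySeq_iff.1 hu ε hε
    refine ⟨N, fun n hn => convexNorm_le_of_tendsto
      (a := fun m => toSeq 𝕜 r (u m) - toSeq 𝕜 r (u n))
      (fun i => (hb i).sub tendsto_const_nhds) (eventually_atTop.2 ⟨N, fun m hm => ?_⟩)⟩
    rw [← map_sub, ← enorm_eq, ← ofReal_norm]
    have := hN m hm n hn
    rw [dist_eq_norm] at this
    exact ENNReal.ofReal_le_ofReal this.le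
  obtain ⟨N, hN⟩ := key 1 one_pos
  have hbN : convexNorm (r : ℝ) b ≠ ∞ := by
    have h := convexNorm_add r.2 (b - toSeq 𝕜 r (u N)) (toSeq 𝕜 r (u N))
    rw [sub_add_cancel] at h
    exact ne_top_of_le_ne_top (ENNReal.add_ne_top.2
      ⟨ne_top_of_le_ne_top ENNReal.ofReal_ne_top (hN N le_rfl), convexNorm_ne_top _⟩) h
  obtain ⟨x, hx⟩ := exists_toSeq hbN
  refine ⟨x, Metric.tendsto_atTop.2 fun ε hε => ?_⟩
  obtain ⟨N, hN⟩ := key (ε / 2) (half_pos hε)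
  refine ⟨N, fun n hn => lt_of_le_of_lt ?_ (half_lt_self hε)⟩
  have h := hN n hn
  rw [← hx, ← map_sub, ← enorm_eq, ← ofReal_norm,
    ENNReal.ofReal_le_ofReal_iff (half_pos hε).le] at h
  rwa [dist_comm, dist_eq_norm]

end FiniteNorm

namespace Tsirelson

instance : CompleteSpace (Tsirelson 𝕜 r) :=
  (Submodule.isClosed_topologicalClosure _).completeSpace_coe

variable (𝕜 r) in
/-- The sequence of coordinates of an element of `T^{(r)}`. -/
noncomputable def seq : Tsirelson 𝕜 r →ₗ[𝕜] (ℕ → 𝕜) :=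
  FiniteNorm.toSeq 𝕜 r ∘ₗ Submodule.subtype _

theorem enorm_eq (x : Tsirelson 𝕜 r) : ‖x‖ₑ = convexNorm (r : ℝ) (seq 𝕜 r x) :=
  FiniteNorm.enorm_eq (x : FiniteNorm 𝕜 r)

theorem ofReal_norm_rpow (x : Tsirelson 𝕜 r) :
    ENNReal.ofReal (‖x‖ ^ (r : ℝ)) = tsirelsonNorm fun i => ‖seq 𝕜 r x i‖ₑ ^ (r : ℝ) := by
  rw [← ENNReal.ofReal_rpow_of_nonneg (norm_nonneg _) (Ici_pos r).le, ofReal_norm, enorm_eq,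
    convexNorm_rpow]

theorem norm_mono (x y : Tsirelson 𝕜 r) (h : ∀ i, ‖seq 𝕜 r x i‖ ≤ ‖seq 𝕜 r y i‖) :
    ‖x‖ ≤ ‖y‖ := by
  rw [← enorm_le_iff_norm_le, enorm_eq, enorm_eq]
  exact convexNorm_mono h

theorem norm_seq_le (i : ℕ) (x : Tsirelson 𝕜 r) : ‖seq 𝕜 r x i‖ ≤ ‖x‖ :=
  FiniteNorm.norm_toSeq_le i (x : FiniteNorm 𝕜 r)

theorem seq_injective : Function.Injective (seq 𝕜 r) :=
  FiniteNorm.toSeq_injective.comp Subtype.val_injective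

/-- The operator is first defined on all sequences of finite norm. Since it preserves finite
supports, continuity keeps it within their closure. -/
theorem exists_map {S : (ℕ → 𝕜) →ₗ[𝕜] (ℕ → 𝕜)} {C : ℝ} (hC : 0 ≤ C)
    (hS : ∀ a, convexNorm (r : ℝ) (S a) ≤ ENNReal.ofReal C * convexNorm (r : ℝ) a)
    (hfin : ∀ a, (Function.support a).Finite → (Function.support (S a)).Finite)
    (x : Tsirelson 𝕜 r) : ∃ z : Tsirelson 𝕜 r, seq 𝕜 r z = S (seq 𝕜 r x) ∧ ‖z‖ ≤ C * ‖x‖ := by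
  have h : ∀ x : FiniteNorm 𝕜 r, ∃ z, FiniteNorm.toSeq 𝕜 r z = S (FiniteNorm.toSeq 𝕜 r x) ∧
      ‖z‖ ≤ C * ‖x‖ := fun x => by
    obtain ⟨z, hz⟩ := FiniteNorm.exists_toSeq (ne_top_of_le_ne_top
      (ENNReal.mul_ne_top ENNReal.ofReal_ne_top (FiniteNorm.convexNorm_ne_top x)) (hS _))
    refine ⟨z, hz, ?_⟩
    rw [← ENNReal.ofReal_le_ofReal_iff (by positivity), ENNReal.ofReal_mul hC, ofReal_norm,
      ofReal_norm, FiniteNorm.enorm_eq, FiniteNorm.enorm_eq, hz]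
    exact hS _
  have hG := seq_liftOfSeq FiniteNorm.toSeq_injective S C h
  refine ⟨⟨liftOfSeq FiniteNorm.toSeq_injective S C h x, ?_⟩, hG x, (h x).choose_spec.2⟩
  refine map_mem_closure (liftOfSeq FiniteNorm.toSeq_injective S C h).continuous x.2
    fun y hy => ?_
  change (Function.support (FiniteNorm.toSeq 𝕜 r _)).Finite
  rw [hG]
  exact hfin _ hy

theorem exists_right (x : Tsirelson 𝕜 r) : ∃ z : Tsirelson 𝕜 r,
    seq 𝕜 r z = rightShiftLinear 𝕜 (seq 𝕜 r x) ∧ ‖z‖ ≤ 6 ^ (r : ℝ)⁻¹ * ‖x‖ := by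
  refine exists_map (by positivity) (fun a => ?_) (fun a ha => ?_) x
  · refine (convexNorm_rightShift_le a).trans (le_of_eq ?_)
    rw [← ENNReal.ofReal_rpow_of_nonneg (by norm_num) (inv_nonneg.2 (Ici_pos r).le)]
    norm_num
  · refine (ha.image (· + 1)).subset fun i hi => ?_
    cases i with
    | zero => exact absurd rfl hi
    | succ i => exact ⟨i, hi, rfl⟩

theorem exists_left (x : Tsirelson 𝕜 r) : ∃ z : Tsirelson 𝕜 r,
    seq 𝕜 r z = LinearMap.funLeft 𝕜 𝕜 (· + 1) (seq 𝕜 r x) ∧ ‖z‖ ≤ 1 * ‖x‖ := by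
  refine exists_map zero_le_one (fun a => ?_) (fun a ha => ?_) x
  · rw [ENNReal.ofReal_one, one_mul]
    exact convexNorm_leftShift_le a
  · exact ha.preimage (add_left_injective 1).injOn

theorem exists_vec (k : ℕ) : ∃ x : Tsirelson 𝕜 r, seq 𝕜 r x = Pi.single k 1 := by
  obtain ⟨x, hx⟩ := FiniteNorm.exists_toSeq (convexNorm_single_ne_top (𝕜 := 𝕜) (r := r) k)
  refine ⟨⟨x, subset_closure ?_⟩, hx⟩
  change (Function.support (FiniteNorm.toSeq 𝕜 r x)).Finite
  rw [hx]
  exact (Set.finite_singleton k).subset Pi.support_single_subset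

theorem exists_norm_sub_lt (x : Tsirelson 𝕜 r) (ε : ℝ) (hε : 0 < ε) :
    ∃ (y : Tsirelson 𝕜 r) (n : ℕ), (∀ i ≥ n, seq 𝕜 r y i = 0) ∧ ‖x - y‖ < ε := by
  obtain ⟨y, hy, hxy⟩ := Metric.mem_closure_iff.1 x.2 ε hε
  obtain ⟨n, hn⟩ := Set.Finite.bddAbove (show (Function.support (FiniteNorm.toSeq 𝕜 r y)).Finite
    from hy)
  refine ⟨⟨y, subset_closure hy⟩, n + 1, fun i hi => ?_, ?_⟩
  · by_contra h
    have := hn h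
    omega
  · rwa [dist_eq_norm] at hxy

variable (𝕜 r) in
/-- The unit vector basis of `T^{(r)}`. -/
noncomputable def basis : ShiftBasis 𝕜 (Tsirelson 𝕜 r) :=
  ShiftBasis.ofSeq (seq 𝕜 r) norm_mono norm_seq_le
    (fun k => (exists_vec k).choose) (fun k => (exists_vec k).choose_spec)
    (liftOfSeq seq_injective _ _ exists_right) (liftOfSeq seq_injective _ _ exists_left)
    (fun x => seq_liftOfSeq _ _ _ _ x) (fun x i => congrFun (seq_liftOfSeq _ _ _ _ x) i)
    exists_norm_sub_lt

theorem seq_tail (n : ℕ) (x : Tsirelson 𝕜 r) (i : ℕ) :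
    seq 𝕜 r ((basis 𝕜 r).tail n x) i = if i < n then 0 else seq 𝕜 r x i :=
  ShiftBasis.seq_tail_ofSeq n x i

/-! ### Block estimates in the convexified Tsirelson spaces. -/

theorem seq_eq_zero_of_lt {n : ℕ} {x : Tsirelson 𝕜 r} (hx : (basis 𝕜 r).tail n x = x) {i : ℕ}
    (hi : i < n) : seq 𝕜 r x i = 0 := by
  rw [← hx, seq_tail, if_pos hi]

theorem seq_eq_zero_of_le {n : ℕ} {x : Tsirelson 𝕜 r} (hx : (basis 𝕜 r).tail n x = 0) {i : ℕ}
    (hi : n ≤ i) : seq 𝕜 r x i = 0 := by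
  have := seq_tail n x i
  rwa [hx, map_zero, if_neg (not_lt.2 hi), Pi.zero_apply, eq_comm] at this

/-- For disjoint supports `|x + y|^r = |x|^r + |y|^r`, and the Tsirelson norm is subadditive. -/
theorem isUpper : (basis 𝕜 r).IsUpper (r : ℝ) := by
  intro n x y hx hy
  rw [← ENNReal.ofReal_le_ofReal_iff (by positivity),
    ENNReal.ofReal_add (by positivity) (by positivity), ofReal_norm_rpow, ofReal_norm_rpow,
    ofReal_norm_rpow]
  refine (tsirelsonNorm_mono fun i => ?_).trans (tsirelsonNorm_add _ _)
  rw [map_add, Pi.add_apply, Pi.add_apply]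
  rcases lt_or_ge i n with hi | hi
  · simp [seq_eq_zero_of_lt hy hi]
  · simp [seq_eq_zero_of_le hx hi]

/-- The `N` intervals start beyond `n N ≥ N`, hence form an admissible family. The constant 2 is the
inverse of the factor `1 / 2` in the norm. -/
theorem isAsymptoticLower : (basis 𝕜 r).IsAsymptoticLower (r : ℝ) := by
  intro n hn N x
  have hE : Admissible fun j : Fin N => Finset.Ico (n (N + j)) (n (N + j + 1)) := by
    refine ⟨fun j i hi => ?_, fun j l hjl i hi i' hi' => ?_⟩
    · have := hn.le_apply (x := N + j)
      have := (Finset.mem_Ico.1 hi).1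
      omega
    · have h1 : n (N + j + 1) ≤ n (N + l) := hn.monotone (by omega)
      have h2 := (Finset.mem_Ico.1 hi).2
      have h3 := (Finset.mem_Ico.1 hi').1
      omega
  have h := half_sum_norm_le hE fun i => ‖seq 𝕜 r x i‖ₑ ^ (r : ℝ)
  rw [← ENNReal.ofReal_le_ofReal_iff (by positivity), ENNReal.ofReal_mul zero_le_two,
    ENNReal.ofReal_sum_of_nonneg fun _ _ => by positivity, ofReal_norm_rpow]
  have h2 : ENNReal.ofReal 2 = 2 := by norm_num
  rw [h2]
  calc _ = ∑ j : Fin N, tsirelsonNorm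
        ((Finset.Ico (n (N + j)) (n (N + j + 1)) : Set ℕ).indicator
          fun i => ‖seq 𝕜 r x i‖ₑ ^ (r : ℝ)) := by
        rw [Finset.sum_range]
        refine Finset.sum_congr rfl fun j _ => ?_
        rw [ofReal_norm_rpow]
        congr 1
        ext i
        rw [map_sub, Pi.sub_apply, seq_tail, seq_tail, Set.indicator_apply]
        have : n (N + j) < n (N + j + 1) := hn (Nat.lt_succ_self _)
        simp only [Finset.coe_Ico, Set.mem_Ico]
        split_ifs <;> first | omega | simp [Ici_pos r]
    _ = 2 * (2⁻¹ * ∑ j : Fin N, tsirelsonNorm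
        ((Finset.Ico (n (N + j)) (n (N + j + 1)) : Set ℕ).indicator
          fun i => ‖seq 𝕜 r x i‖ₑ ^ (r : ℝ))) := by
        rw [← mul_assoc, ENNReal.mul_inv_cancel two_ne_zero ENNReal.ofNat_ne_top, one_mul]
    _ ≤ _ := by gcongr

theorem enorm_sum_rpow {s : ℝ} (hs : 0 < s) {f : ℕ → 𝕜} (hf : ∀ k l, k ≠ l → f k = 0 ∨ f l = 0)
    (N : ℕ) : ‖∑ k ∈ Finset.range N, f k‖ₑ ^ s = ∑ k ∈ Finset.range N, ‖f k‖ₑ ^ s := by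
  by_cases h : ∃ k ∈ Finset.range N, f k ≠ 0
  · obtain ⟨k, hk, hfk⟩ := h
    have h0 : ∀ l, l ≠ k → f l = 0 := fun l hl => (hf l k hl).resolve_right hfk
    rw [Finset.sum_eq_single_of_mem k hk fun l _ hl => h0 l hl,
      Finset.sum_eq_single_of_mem k hk fun l _ hl => by simp [h0 l hl, hs]]
  · push Not at h
    rw [Finset.sum_eq_zero h, Finset.sum_eq_zero fun k hk => by simp [h k hk, hs]]
    simp [hs]

/-- The `7 / 4` estimate applied to `r`-th powers: the weight `N ^ (-r⁻¹)` becomes `N⁻¹`. -/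
theorem upperSpread : (basis 𝕜 r).UpperSpread (r : ℝ)⁻¹ ((7 / 4) ^ (r : ℝ)⁻¹) := by
  intro n u hu hu1
  refine ⟨max 1 (2 * n 1), fun N hN => ?_⟩
  have hr := Ici_pos r
  have hN0 : 0 < N := lt_of_lt_of_le one_pos ((le_max_left _ _).trans hN)
  have hsupp : ∀ k i, seq 𝕜 r (u k) i ≠ 0 → n k ≤ i ∧ i < n (k + 1) := fun k i h =>
    ⟨not_lt.1 fun hi => h (seq_eq_zero_of_lt (hu.2 k).1 hi),
      not_le.1 fun hi => h (seq_eq_zero_of_le (hu.2 k).2 hi)⟩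
  have key := tsirelsonNorm_spread_le (w := fun k i => ‖seq 𝕜 r (u k) i‖ₑ ^ (r : ℝ)) hu.1
    (fun k i h => hsupp k i fun h0 => h (by simp [h0, hr]))
    (fun k => by
      rw [← ofReal_norm_rpow]
      exact ENNReal.ofReal_le_one.2 (Real.rpow_le_one (norm_nonneg _) (hu1 k) hr.le))
    hN0 ((le_max_right _ _).trans hN)
  refine (Real.le_rpow_inv_iff_of_pos (norm_nonneg _) (by norm_num) hr).2 ?_
  rw [← ENNReal.ofReal_le_ofReal_iff (by norm_num), ofReal_norm_rpow]
  refine le_trans (le_of_eq ?_) (key.trans (le_of_eq ?_))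
  · congr 1
    ext i
    set c : 𝕜 := (((N : ℝ) ^ (-(r : ℝ)⁻¹) : ℝ) : 𝕜) with hc
    have hcr : ‖c‖ₑ ^ (r : ℝ) = (N : ℝ≥0∞)⁻¹ := by
      have hN1 : (0 : ℝ) < N := by exact_mod_cast hN0
      rw [← ofReal_norm, hc, RCLike.norm_ofReal, abs_of_nonneg (by positivity),
        ENNReal.ofReal_rpow_of_nonneg (by positivity) hr.le, ← Real.rpow_mul hN1.le, neg_mul,
        inv_mul_cancel₀ hr.ne', Real.rpow_neg_one, ENNReal.ofReal_inv_of_pos hN1,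
        ENNReal.ofReal_natCast]
    -- At each coordinate `i` at most one block is nonzero, so taking `r`-th powers commutes with
    -- the sum.
    set f : ℕ → 𝕜 := fun k => (if k = 0 then 1 else c) * seq 𝕜 r (u k) i with hf
    have h1 : seq 𝕜 r (ShiftBasis.spread 𝕜 (r : ℝ)⁻¹ N u) i = ∑ k ∈ Finset.range (N + 1), f k := by
      rw [Finset.sum_range_succ', ShiftBasis.spread, ← hc]
      simp [hf, Finset.mul_sum, add_comm]
    rw [h1, enorm_sum_rpow hr, Finset.sum_range_succ', add_comm]
    · simp [hf, Finset.mul_sum, enorm_mul, ENNReal.mul_rpow_of_nonneg _ _ hr.le, hcr]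
    · intro k l hkl
      by_contra! h
      have hk := hsupp k i (right_ne_zero_of_mul h.1)
      have hl := hsupp l i (right_ne_zero_of_mul h.2)
      rcases lt_or_gt_of_ne hkl with hlt | hlt
      · have := hu.1.monotone (Nat.succ_le_of_lt hlt)
        simp only [Nat.succ_eq_add_one] at this
        omega
      · have := hu.1.monotone (Nat.succ_le_of_lt hlt)
        simp only [Nat.succ_eq_add_one] at this
        omega
  · rw [ENNReal.ofReal_div_of_pos (by norm_num)]
    norm_num

theorem upperEstimate : (basis 𝕜 r).UpperEstimate (r : ℝ)⁻¹ 1 := isUpper.upperEstimate (Ici_pos r)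

/-- For `r = 1` the upper estimate has exponent 1 and is useless here; the constant `7 / 4 < 2`
takes over. For `r > 1` the exponent is less than 1. -/
theorem shrinking : (basis 𝕜 r).Shrinking := by
  rcases eq_or_lt_of_le (show (1 : ℝ) ≤ r from r.2) with h | h
  · refine ShiftBasis.shrinking_of_upperSpread (κ := (7 / 4) ^ (r : ℝ)⁻¹) (by positivity) ?_ ?_
    · rw [← h]; norm_num
    · have := upperSpread (𝕜 := 𝕜) (r := r)
      rwa [← h, inv_one] at this ⊢
  · exact ShiftBasis.shrinking_of_upperEstimate (inv_nonneg.2 (Ici_pos r).le)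
      (inv_lt_one_of_one_lt₀ h) upperEstimate

end Tsirelson

end Tsirelson

/-! ### The family of the theorem -/

/-- The space has an asymptotic upper and an asymptotic lower `1 / α`-estimate for blocks (with no
lower estimate required if `α = 0`), and the basis is shrinking if `α < 1`. -/
structure ShiftBasis.HasExponent {𝕜 : Type*} [RCLike 𝕜] {X : Type*} [NormedAddCommGroup X]
    [NormedSpace 𝕜 X] (E : ShiftBasis 𝕜 X) (α : ℝ) : Prop where
  nonneg : 0 ≤ α
  upper : ∃ C, E.UpperEstimate α C
  lower : 0 < α → ∃ c > 0, E.LowerEstimate α c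
  shrinking : α < 1 → E.Shrinking

section

variable {𝕜 : Type*} [RCLike 𝕜]

/-- The smaller exponent is less than `α' ≤ 1`, so the domain has a shrinking basis. The larger one
is positive, so the range has a lower estimate. -/
theorem ShiftBasis.HasExponent.smallOnTails {X Y : Type*} [NormedAddCommGroup X] [NormedSpace 𝕜 X]
    [NormedAddCommGroup Y] [NormedSpace 𝕜 Y] {E : ShiftBasis 𝕜 X} {F : ShiftBasis 𝕜 Y} {α α' : ℝ}
    (hE : E.HasExponent α) (hF : F.HasExponent α') (hα' : α' ≤ 1) (h : α < α') :
    SmallOnTails E Y := by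
  obtain ⟨C, hC⟩ := hE.upper
  obtain ⟨c, hc0, hc⟩ := hF.lower (hE.nonneg.trans_lt h)
  exact ShiftBasis.smallOnTails_of_estimates (hE.shrinking (h.trans_le hα')) hE.nonneg h hc0 hC hc

theorem Ell.hasExponent (p : Set.Ici (1 : ℝ≥0∞)) :
    (Ell.basis 𝕜 p).HasExponent (p : ℝ≥0∞).toReal⁻¹ := by
  have h : ∃ C, (Ell.basis 𝕜 p).UpperEstimate (p : ℝ≥0∞).toReal⁻¹ C := by
    by_cases hp : (p : ℝ≥0∞) = ∞
    · have h0 : (p : ℝ≥0∞).toReal⁻¹ = 0 := by simp [hp]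
      rw [h0]
      exact ⟨1, (Ell.isUpperSup hp).upperEstimate⟩
    · exact ⟨1, (Ell.isUpper hp).upperEstimate (toReal_pos_of_ne_top hp)⟩
  refine ⟨inv_nonneg.2 ENNReal.toReal_nonneg, h, fun h0 => ?_, fun h1 => ?_⟩
  · have hp : (p : ℝ≥0∞) ≠ ∞ := fun hp => by simp [hp] at h0
    exact ⟨1, one_pos, (Ell.isLower hp).lowerEstimate (toReal_pos_of_ne_top hp)⟩
  · exact ShiftBasis.shrinking_of_upperEstimate (inv_nonneg.2 ENNReal.toReal_nonneg) h1
      h.choose_spec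

theorem Ell.upperSpread (p : Set.Ici (1 : ℝ≥0∞)) :
    (Ell.basis 𝕜 p).UpperSpread (p : ℝ≥0∞).toReal⁻¹ (2 ^ (p : ℝ≥0∞).toReal⁻¹) := by
  by_cases hp : (p : ℝ≥0∞) = ∞
  · have h0 : (p : ℝ≥0∞).toReal⁻¹ = 0 := by simp [hp]
    rw [h0, Real.rpow_zero]
    exact (Ell.isUpperSup hp).upperSpread
  · exact (Ell.isUpper hp).upperSpread (toReal_pos_of_ne_top hp)

theorem Tsirelson.hasExponent (r : Set.Ici (1 : ℝ)) :
    (Tsirelson.basis 𝕜 r).HasExponent (r : ℝ)⁻¹ :=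
  ⟨inv_nonneg.2 (Ici_pos r).le, ⟨1, Tsirelson.upperEstimate⟩,
    fun _ => ⟨_, by positivity, Tsirelson.isAsymptoticLower.lowerEstimate (Ici_pos r)⟩,
    fun _ => Tsirelson.shrinking⟩

variable (𝕜) in
/-- The basis of `T_*^{(s)}` which is dual to the unit vector basis of `T^{(r)}`. -/
noncomputable def TsirelsonDual.basis (s : Set.Ioi (1 : ℝ≥0∞)) :
    ShiftBasis 𝕜 (TsirelsonDual 𝕜 s) :=
  (Tsirelson.basis 𝕜 (conjExp s)).dual Tsirelson.shrinking

theorem TsirelsonDual.hasExponent (s : Set.Ioi (1 : ℝ≥0∞)) :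
    (TsirelsonDual.basis 𝕜 s).HasExponent (1 - (conjExp s : ℝ)⁻¹) := by
  have h0 : 0 ≤ 1 - (conjExp s : ℝ)⁻¹ := sub_nonneg.2 (inv_le_one_of_one_le₀ (conjExp s).2)
  have h : (TsirelsonDual.basis 𝕜 s).UpperEstimate (1 - (conjExp s : ℝ)⁻¹) _ :=
    Tsirelson.isAsymptoticLower.dual_upperEstimate Tsirelson.shrinking (conjExp s).2
  refine ⟨h0, ⟨_, h⟩, fun h1 => ⟨_, ?_, Tsirelson.upperEstimate.dual_lowerEstimate
    Tsirelson.shrinking (sub_pos.1 h1) one_pos⟩, fun h1 =>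
    ShiftBasis.shrinking_of_upperEstimate h0 h1 h⟩
  norm_num

/-- Duality gives every constant below `2 / (7 / 4) ^ r⁻¹` with `r = conjExp s`, and `7 / 4 < 2`
makes this larger than `2 / 2 ^ r⁻¹ = 2 ^ (1 - r⁻¹)`. -/
theorem TsirelsonDual.exists_lowerSpread (s : Set.Ioi (1 : ℝ≥0∞)) :
    ∃ κ, (2 : ℝ) ^ (1 - (conjExp s : ℝ)⁻¹) < κ ∧
      (TsirelsonDual.basis 𝕜 s).LowerSpread (1 - (conjExp s : ℝ)⁻¹) κ := by
  have hr := inv_pos.2 (Ici_pos (conjExp s))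
  have h0 : (0 : ℝ) < (7 / 4) ^ (conjExp s : ℝ)⁻¹ := by positivity
  have h : (2 : ℝ) ^ (1 - (conjExp s : ℝ)⁻¹) < 2 / (7 / 4) ^ (conjExp s : ℝ)⁻¹ := by
    rw [lt_div_iff₀ h0]
    calc (2 : ℝ) ^ (1 - (conjExp s : ℝ)⁻¹) * (7 / 4) ^ (conjExp s : ℝ)⁻¹
        < 2 ^ (1 - (conjExp s : ℝ)⁻¹) * 2 ^ (conjExp s : ℝ)⁻¹ := by
          gcongr
          norm_num
      _ = 2 := by rw [← Real.rpow_add two_pos, sub_add_cancel, Real.rpow_one]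
  obtain ⟨κ, h1, h2⟩ := exists_between h
  refine ⟨κ, h1, Tsirelson.upperSpread.dual_lowerSpread Tsirelson.shrinking h0 ?_
    ((lt_div_iff₀ h0).1 h2)⟩
  exact (Real.rpow_nonneg zero_le_two _).trans h1.le

/-- The gap between the constants is `(7 / 4) ^ r⁻¹ < 2 ^ r⁻¹`. The case `p = ∞` is excluded since
`r⁻¹ > 0`. -/
theorem smallOnTails_tsirelson_ell (r : Set.Ici (1 : ℝ)) (p : Set.Ici (1 : ℝ≥0∞))
    (h : (r : ℝ)⁻¹ = (p : ℝ≥0∞).toReal⁻¹) : SmallOnTails (Tsirelson.basis 𝕜 r) (Ell 𝕜 p) := by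
  have hr := inv_pos.2 (Ici_pos r)
  have hp : (p : ℝ≥0∞) ≠ ∞ := fun hp => by simp [hp] at h; simp [h] at hr
  have h' := (Ell.isLower (𝕜 := 𝕜) hp).lowerSpread (toReal_pos_of_ne_top hp)
  rw [← h] at h'
  exact ShiftBasis.smallOnTails_of_spread Tsirelson.shrinking hr.le (by positivity)
    (Real.rpow_lt_rpow (by norm_num) (by norm_num) hr) Tsirelson.upperSpread h'

/-- The common exponent is less than 1 because `conjExp s` is finite, so the basis of `ℓ_p` is
shrinking. For exponent 0 this compares `c₀` with the dual of `T^{(1)}`. -/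
theorem smallOnTails_ell_tsirelsonDual (p : Set.Ici (1 : ℝ≥0∞)) (s : Set.Ioi (1 : ℝ≥0∞))
    (h : (p : ℝ≥0∞).toReal⁻¹ = 1 - (conjExp s : ℝ)⁻¹) :
    SmallOnTails (Ell.basis 𝕜 p) (TsirelsonDual 𝕜 s) := by
  obtain ⟨κ, hκ, hs⟩ := TsirelsonDual.exists_lowerSpread (𝕜 := 𝕜) s
  have hr := inv_pos.2 (Ici_pos (conjExp s))
  rw [← h] at hκ hs
  exact ShiftBasis.smallOnTails_of_spread ((Ell.hasExponent p).shrinking (by linarith))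
    (Ell.hasExponent (𝕜 := 𝕜) p).nonneg (by positivity) hκ (Ell.upperSpread p) hs

theorem smallOnTails_tsirelson_tsirelsonDual (r : Set.Ici (1 : ℝ)) (s : Set.Ioi (1 : ℝ≥0∞))
    (h : (r : ℝ)⁻¹ = 1 - (conjExp s : ℝ)⁻¹) :
    SmallOnTails (Tsirelson.basis 𝕜 r) (TsirelsonDual 𝕜 s) := by
  obtain ⟨κ, hκ, hs⟩ := TsirelsonDual.exists_lowerSpread (𝕜 := 𝕜) s
  have hr := inv_pos.2 (Ici_pos r)
  rw [← h] at hκ hs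
  refine ShiftBasis.smallOnTails_of_spread Tsirelson.shrinking hr.le (by positivity)
    (lt_of_le_of_lt ?_ hκ) Tsirelson.upperSpread hs
  exact Real.rpow_le_rpow (by norm_num) (by norm_num) hr.le

end

/-! ### Equal exponents determine the parameter within each of the three kinds of spaces. -/

theorem toReal_inv_injective :
    Function.Injective fun p : Set.Ici (1 : ℝ≥0∞) => (p : ℝ≥0∞).toReal⁻¹ := fun p q h => by
  have hfin : ∀ p : Set.Ici (1 : ℝ≥0∞), (p : ℝ≥0∞)⁻¹ ≠ ∞ := fun p =>
    ENNReal.inv_ne_top.2 (zero_lt_one.trans_le p.2).ne'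
  simp only [← ENNReal.toReal_inv] at h
  exact Subtype.ext (inv_injective ((ENNReal.toReal_eq_toReal_iff' (hfin p) (hfin q)).1 h))

theorem conjExp_injective : Function.Injective conjExp := fun s t h => by
  have hfin : ∀ s : Set.Ioi (1 : ℝ≥0∞), ((s : ℝ≥0∞) - 1)⁻¹ ≠ ∞ := fun s =>
    ENNReal.inv_ne_top.2 (tsub_pos_of_lt s.2).ne'
  have h0 : (1 + ((s : ℝ≥0∞) - 1)⁻¹).toReal = (1 + ((t : ℝ≥0∞) - 1)⁻¹).toReal :=
    congrArg (fun x : Set.Ici (1 : ℝ) => (x : ℝ)) h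
  have h1 := (ENNReal.toReal_eq_toReal_iff' (ENNReal.add_ne_top.2 ⟨ENNReal.one_ne_top, hfin s⟩)
    (ENNReal.add_ne_top.2 ⟨ENNReal.one_ne_top, hfin t⟩)).1 h0
  have h2 := inv_injective ((ENNReal.add_right_inj ENNReal.one_ne_top).1 h1)
  refine Subtype.ext ?_
  rw [← tsub_add_cancel_of_le (show (1 : ℝ≥0∞) ≤ s from s.2.le), h2,
    tsub_add_cancel_of_le (show (1 : ℝ≥0∞) ≤ t from t.2.le)]

section Family

variable (𝕜 : Type*) [RCLike 𝕜] (A : Finset (Set.Ici (1 : ℝ≥0∞))) (B : Finset (Set.Ici (1 : ℝ)))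
  (D : Finset (Set.Ioi (1 : ℝ≥0∞)))

instance : ∀ i, CompleteSpace (Family 𝕜 A B D i)
  | .inl p => inferInstanceAs (CompleteSpace (Ell 𝕜 p))
  | .inr (.inl r) => inferInstanceAs (CompleteSpace (Tsirelson 𝕜 r))
  | .inr (.inr s) => inferInstanceAs (CompleteSpace (TsirelsonDual 𝕜 s))

/-- The bases of the members of the family. -/
noncomputable def familyBasis : ∀ i, ShiftBasis 𝕜 (Family 𝕜 A B D i)
  | .inl p => Ell.basis 𝕜 p
  | .inr (.inl r) => Tsirelson.basis 𝕜 r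
  | .inr (.inr s) => TsirelsonDual.basis 𝕜 s

variable {A B D} in
/-- The exponents of the members of the family. -/
noncomputable def familyExponent : A ⊕ B ⊕ D → ℝ
  | .inl p => ((p : Set.Ici (1 : ℝ≥0∞)) : ℝ≥0∞).toReal⁻¹
  | .inr (.inl r) => ((r : Set.Ici (1 : ℝ)) : ℝ)⁻¹
  | .inr (.inr s) => 1 - (conjExp s : ℝ)⁻¹

variable {A B D}

theorem familyExponent_le_one (i : A ⊕ B ⊕ D) : familyExponent i ≤ 1 := by
  rcases i with p | r | s
  · by_cases hp : ((p : Set.Ici (1 : ℝ≥0∞)) : ℝ≥0∞) = ∞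
    · simp [familyExponent, hp]
    · refine inv_le_one_of_one_le₀ ?_
      rw [← ENNReal.toReal_one]
      exact ENNReal.toReal_mono hp p.1.2
  · exact inv_le_one_of_one_le₀ r.1.2
  · exact sub_le_self _ (inv_pos.2 (Ici_pos _)).le

theorem hasExponent_familyBasis (i : A ⊕ B ⊕ D) :
    (familyBasis 𝕜 A B D i).HasExponent (familyExponent i) :=
  match i with
  | .inl p => Ell.hasExponent (p : Set.Ici (1 : ℝ≥0∞))
  | .inr (.inl r) => Tsirelson.hasExponent (r : Set.Ici (1 : ℝ))
  | .inr (.inr s) => TsirelsonDual.hasExponent (s : Set.Ioi (1 : ℝ≥0∞))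

/-- Two spaces of the same kind with equal exponents coincide, so only different kinds remain. Among
these, smallness holds in the direction from `T^{(r)}` through `ℓ_p` to `T_*^{(s)}`, in which the
spread constants increase strictly. -/
theorem smallOnTails_of_familyExponent_eq : ∀ i j : A ⊕ B ⊕ D, i ≠ j →
    familyExponent i = familyExponent j →
    SmallOnTails (familyBasis 𝕜 A B D i) (Family 𝕜 A B D j) ∨
      SmallOnTails (familyBasis 𝕜 A B D j) (Family 𝕜 A B D i)
  | .inl _, .inl _, hij, h => (hij (congrArg _ (Subtype.ext (toReal_inv_injective h)))).elim
  | .inl p, .inr (.inl r), _, h => .inr (smallOnTails_tsirelson_ell r.1 p.1 h.symm)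
  | .inl p, .inr (.inr s), _, h => .inl (smallOnTails_ell_tsirelsonDual p.1 s.1 h)
  | .inr (.inl r), .inl p, _, h => .inl (smallOnTails_tsirelson_ell r.1 p.1 h)
  | .inr (.inl _), .inr (.inl _), hij, h =>
    (hij (congrArg _ (congrArg _ (Subtype.ext (Subtype.ext (inv_injective h)))))).elim
  | .inr (.inl r), .inr (.inr s), _, h => .inl (smallOnTails_tsirelson_tsirelsonDual r.1 s.1 h)
  | .inr (.inr s), .inl p, _, h => .inr (smallOnTails_ell_tsirelsonDual p.1 s.1 h.symm)
  | .inr (.inr s), .inr (.inl r), _, h =>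
    .inr (smallOnTails_tsirelson_tsirelsonDual r.1 s.1 h.symm)
  | .inr (.inr _), .inr (.inr _), hij, h =>
    (hij (congrArg _ (congrArg _ (Subtype.ext (conjExp_injective
      (Subtype.ext (inv_injective (sub_right_injective h)))))))).elim

theorem smallOnTails_familyBasis (i j : A ⊕ B ⊕ D) (hij : i ≠ j) :
    SmallOnTails (familyBasis 𝕜 A B D i) (Family 𝕜 A B D j) ∨
      SmallOnTails (familyBasis 𝕜 A B D j) (Family 𝕜 A B D i) := by
  have hi := hasExponent_familyBasis 𝕜 i
  have hj := hasExponent_familyBasis 𝕜 j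
  rcases lt_trichotomy (familyExponent i) (familyExponent j) with h | h | h
  · exact .inl (hi.smallOnTails hj (familyExponent_le_one j) h)
  · exact smallOnTails_of_familyExponent_eq 𝕜 i j hij h
  · exact .inr (hj.smallOnTails hi (familyExponent_le_one i) h)

end Family

end UncBasis

theorem mainTheorem6 {𝕜 : Type u} [RCLike 𝕜]
    (A : Finset (Set.Ici (1 : ENNReal))) (B : Finset (Set.Ici (1 : ℝ)))
    (D : Finset (Set.Ioi (1 : ENNReal))) :
    UncBasis.SplittingForUnconditionalBases.{u, 0, u, w} 𝕜 (UncBasis.Family 𝕜 A B D) := by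
  classical
  exact UncBasis.splitting_of_smallOnTails (UncBasis.familyBasis 𝕜 A B D)
    (UncBasis.smallOnTails_familyBasis 𝕜)
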